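/- Let $p\ge 1$, $d,n\ge 0$ be integers, $r=pd$, let $\xi\in\mathbb C$ be a primitive $p$th root of unity, $v_0,\dots,v_{d-1}\in\mathbb C$, $0\ne q\in\mathbb C$, and put $u_{lp+k+1}=\xi^k v_l$ for $0\le k<p$, $0\le l<d$. Let $\mathcal H=\mathcal H_{r,1,n}(u_1,\dots,u_r,q)$ be the $\mathbb C$-algebra with generators $T_1,\dots,T_n$ and relations $T_iT_j=T_jT_i$ for $|i-j|>1$; $T_iT_{i+1}T_i=T_{i+1}T_iT_{i+1}$ for $2\le i\le n-1$; $T_1T_2T_1T_2=T_2T_1T_2T_1$; $(T_1-u_1)\cdots(T_1-u_r)=0$; $(T_i-1)(T_i+q)=0$ for $2\le i\le n$. Assume that $\mathcal H$ is semisimple. Let $G=\langle\tau\rangle\simeq\mathbb Z/p\mathbb Z$ act on $\mathcal H$ by the automorphism $\tau(T_1)=\xi T_1$, $\tau(T_i)=T_i$ $(i\ge2)$, and for a subgroup $K\le G$ let $\mathcal H\rtimes K$ be the crossed product, with $g\,r=g(r)\,g$ for $g\in K$, $r\in\mathcal H$. Let $\lambda=(\lambda^i_j)_{i\in\mathbb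 Z/p,\,1\le j\le d}$ be an $r$-tuple of Young diagrams with $n$ cells in total; the component $(i,j)$ belongs to the parameter $\xi^iv_{j-1}$. Put $\mathrm{shift}(\lambda)=(\lambda^{i+1}_j)$; call $\lambda,\mu$ cyclic equivalent if $\mathrm{shift}^k(\lambda)=\mu$ for some $k$, and let $G_\lambda\le G$ be the stabilizer of $\lambda$, where $\tau^k$ acts as $\mathrm{shift}^k$. Let $V(\lambda)$ be the $\mathcal H$-module generated by symbols $v(\mathbb T)$, $\mathbb T$ a standard tableau of shape $\lambda$, subject to the relations $$T_1v(\mathbb T)=w_1\,v(\mathbb T),\qquad T_iv(\mathbb T)=A\,v(\mathbb T)+(1-A)\,v(s_i\mathbb T)\quad(2\le i\le n).$$ Here $w_y$ is the parameter of the component of $\lambda$ containing $y$ in $\mathbb T$, and $c_y$ is the content (column minus row) of the cell of $y$. The filling $s_i\mathbb T$ is $\mathbb T$ with $i-1,i$ exchanged, and $v(s_i\mathbb T)=0$ if it is not standard. Further $A=1/[c_i-c_{i-1}]_q$ with $[m]_q=(1-q^m)/(1-q)$ ($=m$ if $q=1$) if $i-1,i$ lie in the same component, and $A=(1-q)R_i/(R_i-R_{i-1})$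 with $R_y=w_yq^{-c_y}$ otherwise. For $h\in G_\lambda$ choose a linear automorphism $\varphi_h=\varphi_{\lambda,h}$ of $V(\lambda)$ with $\varphi_h(rm)=h(r)\varphi_h(m)$ for $r\in\mathcal H$, $m\in V(\lambda)$, and let $\alpha_\lambda:G_\lambda\times G_\lambda\to\mathbb C^\times$ be given by $\varphi_g\varphi_h=\alpha_\lambda(g,h)\varphi_{gh}$. Let $(\mathbb CG_\lambda)_{\alpha_\lambda^{-1}}$ be the twisted group algebra with basis $c_h$ $(h\in G_\lambda)$ and $c_gc_h=\alpha_\lambda(g,h)^{-1}c_{gh}$. For a $(\mathbb CG_\lambda)_{\alpha_\lambda^{-1}}$-module $\pi$, let $\mathcal H\rtimes G_\lambda$ act on $V(\lambda)\otimes_{\mathbb C}\pi$ by $(rh)(m\otimes x)=r\varphi_h(m)\otimes c_hx$, and put $$RG^{V(\lambda),\pi}=\mathrm{Ind}_{\mathcal H\rtimes G_\lambda}^{\mathcal H\rtimes G}(V(\lambda)\otimes\pi).$$ The choices are called compatible if $\varphi_{\mu,h}\theta=\theta\varphi_{\lambda,h}$ for all $h\in G_\lambda\cap G_\mu$ whenever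 $\theta:V(\lambda)\to V(\mu)$ is a linear bijection such that, for some $k\in G$, $\theta(rm)=k(r)\theta(m)$ for all $r,m$. If the choices are compatible and $\lambda,\mu$ are cyclic equivalent, then $G_\lambda=G_\mu$ and $\alpha_\lambda=\alpha_\mu$, so modules over the two twisted group algebras can be compared. **Theorem.** 1. Each $V(\lambda)$ is a simple $\mathcal H$-module with $\mathbb C$-basis the $v(\mathbb T)$. Compatible choices of the $\varphi_{\lambda,h}$ exist, and for every choice of the $\varphi_{\lambda,h}$ the function $\alpha_\lambda$ exists and is unique. 2. For every choice of the $\varphi_{\lambda,h}$ and every simple $(\mathbb CG_\lambda)_{\alpha_\lambda^{-1}}$-module $\pi$, $\pi$ is one-dimensional and $RG^{V(\lambda),\pi}$ is a simple $\mathcal H\rtimes G$-module. 3. For every choice of the $\varphi_{\lambda,h}$, every simple $\mathcal H\rtimes G$-module is isomorphic to $RG^{V(\lambda),\pi}$ for some $\lambda$ and some simple $(\mathbb CG_\lambda)_{\alpha_\lambda^{-1}}$-module $\pi$. 4. If the choices are compatible, then for all $\lambda,\lambda'$ and all simple modules $\pi$ of $(\mathbb CG_\lambda)_{\alpha_\lambda^{-1}}$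 and $\pi'$ of $(\mathbb CG_{\lambda'})_{\alpha_{\lambda'}^{-1}}$: $RG^{V(\lambda),\pi}\cong RG^{V(\lambda'),\pi'}$ if and only if $\lambda$ and $\lambda'$ are cyclic equivalent and $\pi\cong\pi'$. -/

import Mathlib

open scoped TensorProduct

noncomputable section

namespace CliffordHecke

/-! ### The cyclotomic Hecke algebra of type `G(r,1,n)` -/

/-- The defining relations of the cyclotomic Hecke algebra. The generators `T₁, …, Tₙ` are indexed
by `Fin n`, so that the generator usually called `T₁` is the one with index `0`. -/
inductive HeckeRel (r n : ℕ) (u : Fin r → ℂ) (q : ℂ) :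
    FreeAlgebra ℂ (Fin n) → FreeAlgebra ℂ (Fin n) → Prop
  | comm (i j : Fin n) (h : i.val + 1 < j.val) :
      HeckeRel r n u q (FreeAlgebra.ι ℂ i * FreeAlgebra.ι ℂ j)
        (FreeAlgebra.ι ℂ j * FreeAlgebra.ι ℂ i)
  | braid (i j : Fin n) (hi : 1 ≤ i.val) (hj : j.val = i.val + 1) :
      HeckeRel r n u q (FreeAlgebra.ι ℂ i * FreeAlgebra.ι ℂ j * FreeAlgebra.ι ℂ i)
        (FreeAlgebra.ι ℂ j * FreeAlgebra.ι ℂ i * FreeAlgebra.ι ℂ j)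
  | braid_four (i j : Fin n) (hi : i.val = 0) (hj : j.val = 1) :
      HeckeRel r n u q
        (FreeAlgebra.ι ℂ i * FreeAlgebra.ι ℂ j * FreeAlgebra.ι ℂ i * FreeAlgebra.ι ℂ j)
        (FreeAlgebra.ι ℂ j * FreeAlgebra.ι ℂ i * FreeAlgebra.ι ℂ j * FreeAlgebra.ι ℂ i)
  | cyclotomic (i : Fin n) (hi : i.val = 0) :
      HeckeRel r n u q
        (List.ofFn fun k : Fin r => FreeAlgebra.ι ℂ i - algebraMap ℂ _ (u k)).prod 0
  | quadratic (i : Fin n) (hi : 1 ≤ i.val) :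
      HeckeRel r n u q
        ((FreeAlgebra.ι ℂ i - 1) * (FreeAlgebra.ι ℂ i + algebraMap ℂ _ q)) 0

/-- The cyclotomic Hecke algebra `H_{r,1,n}(u₁, …, u_r, q)` over `ℂ`. -/
def HeckeAlg (r n : ℕ) (u : Fin r → ℂ) (q : ℂ) : Type := RingQuot (HeckeRel r n u q)

instance (r n : ℕ) (u : Fin r → ℂ) (q : ℂ) : Ring (HeckeAlg r n u q) :=
  inferInstanceAs (Ring (RingQuot (HeckeRel r n u q)))

instance (r n : ℕ) (u : Fin r → ℂ) (q : ℂ) : Algebra ℂ (HeckeAlg r n u q) :=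
  inferInstanceAs (Algebra ℂ (RingQuot (HeckeRel r n u q)))

/-- The quotient map from the free algebra. -/
def HeckeAlg.mk (r n : ℕ) (u : Fin r → ℂ) (q : ℂ) : FreeAlgebra ℂ (Fin n) →ₐ[ℂ] HeckeAlg r n u q :=
  RingQuot.mkAlgHom ℂ (HeckeRel r n u q)

theorem HeckeAlg.mk_rel {r n : ℕ} {u : Fin r → ℂ} {q : ℂ} {x y : FreeAlgebra ℂ (Fin n)}
    (h : HeckeRel r n u q x y) : mk r n u q x = mk r n u q y :=
  RingQuot.mkAlgHom_rel ℂ h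

/-- The universal property of the cyclotomic Hecke algebra. -/
def HeckeAlg.lift {r n : ℕ} {u : Fin r → ℂ} {q : ℂ} {A : Type} [Ring A] [Algebra ℂ A]
    (f : FreeAlgebra ℂ (Fin n) →ₐ[ℂ] A) (hf : ∀ ⦃x y⦄, HeckeRel r n u q x y → f x = f y) :
    HeckeAlg r n u q →ₐ[ℂ] A :=
  RingQuot.liftAlgHom ℂ ⟨f, hf⟩

theorem HeckeAlg.lift_mk {r n : ℕ} {u : Fin r → ℂ} {q : ℂ} {A : Type} [Ring A] [Algebra ℂ A]
    (f : FreeAlgebra ℂ (Fin n) →ₐ[ℂ] A) (hf : ∀ ⦃x y⦄, HeckeRel r n u q x y → f x = f y)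
    (x : FreeAlgebra ℂ (Fin n)) : lift f hf (mk r n u q x) = f x :=
  RingQuot.liftAlgHom_mkAlgHom_apply ℂ f hf x

theorem HeckeAlg.hom_ext {r n : ℕ} {u : Fin r → ℂ} {q : ℂ} {A : Type} [Ring A] [Algebra ℂ A]
    {f g : HeckeAlg r n u q →ₐ[ℂ] A}
    (h : ∀ i, f (mk r n u q (FreeAlgebra.ι ℂ i)) = g (mk r n u q (FreeAlgebra.ι ℂ i))) : f = g :=
  RingQuot.ringQuot_ext' (S := ℂ) (s := HeckeRel r n u q) f g (FreeAlgebra.hom_ext (funext h))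

/-- Parameters: a primitive `p`-th root of unity `ξ`, complex numbers `v₀, …, v_{d-1}`, and
a nonzero `q`. -/
structure Params (p d : ℕ) where
  ξ : ℂ
  isPrimitiveRoot : IsPrimitiveRoot ξ p
  v : Fin d → ℂ
  q : ℂ
  q_ne_zero : q ≠ 0

variable {p d : ℕ}

/-- With `r = d * p`, the parameters `u_j = ξ ^ k * v_l` for `j - 1 = l p + k`, `0 ≤ k < p`. -/
def Params.u (P : Params p d) (j : Fin (d * p)) : ℂ :=
  P.ξ ^ (finProdFinEquiv.symm j).2.val * P.v (finProdFinEquiv.symm j).1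

/-- `H_{r,1,n}(u₁, …, u_r, q)` for the special parameters `u_j = ξ ^ k * v_l`. -/
abbrev H (P : Params p d) (n : ℕ) : Type := HeckeAlg (d * p) n P.u P.q

/-- The generators of the Hecke algebra. -/
def T (P : Params p d) {n : ℕ} (i : Fin n) : H P n :=
  HeckeAlg.mk (d * p) n P.u P.q (FreeAlgebra.ι ℂ i)

theorem prod_ofFn_eq_aeval {A : Type*} [Ring A] [Algebra ℂ A] (r : ℕ) (u : Fin r → ℂ) (a : A) :
    (List.ofFn fun k : Fin r => a - algebraMap ℂ A (u k)).prod =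
      Polynomial.aeval a (∏ k : Fin r, (Polynomial.X - Polynomial.C (u k))) := by
  rw [← List.prod_ofFn, map_list_prod, List.map_ofFn]
  congr 2
  funext k
  simp

theorem Params.prod_u [NeZero p] (P : Params p d) :
    (∏ k : Fin (d * p), (Polynomial.X - Polynomial.C (P.u k)) : Polynomial ℂ) =
      ∏ l : Fin d, (Polynomial.X ^ p - Polynomial.C (P.v l ^ p)) := by
  rw [← finProdFinEquiv.prod_comp, Fintype.prod_prod_type]
  refine Finset.prod_congr rfl fun l _ => ?_
  rw [X_pow_sub_C_eq_prod P.isPrimitiveRoot (NeZero.pos p) (α := P.v l) rfl,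
    ← Fin.prod_univ_eq_prod_range
      (fun i => (Polynomial.X - Polynomial.C (P.ξ ^ i * P.v l) : Polynomial ℂ)) p]
  simp [Params.u]

/-- Images of the generators under `τ`: `T₁ ↦ ξ T₁` and `T_i ↦ T_i` for `i ≥ 2`. -/
def tauGen (P : Params p d) {n : ℕ} (i : Fin n) : H P n :=
  if i.val = 0 then P.ξ • T P i else T P i

theorem tauGen_rel [NeZero p] (P : Params p d) {n : ℕ} ⦃x y : FreeAlgebra ℂ (Fin n)⦄
    (h : HeckeRel (d * p) n P.u P.q x y) :
    FreeAlgebra.lift ℂ (tauGen P) x = FreeAlgebra.lift ℂ (tauGen P) y := by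
  have key := HeckeAlg.mk_rel h
  have hT : ∀ i : Fin n, HeckeAlg.mk (d * p) n P.u P.q (FreeAlgebra.ι ℂ i) = (T P i : H P n) := fun _ => rfl
  cases h with
  | comm i j h =>
    simp only [map_mul, hT] at key
    have hj : j.val ≠ 0 := by omega
    simp only [map_mul, FreeAlgebra.lift_ι_apply, tauGen, hj, if_false]
    split_ifs
    · rw [smul_mul_assoc, mul_smul_comm]
      exact congrArg (P.ξ • ·) key
    · exact key
  | braid i j hi hj =>
    simp only [map_mul, hT] at key
    have hi' : i.val ≠ 0 := by omega
    have hj' : j.val ≠ 0 := by omega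
    simp only [map_mul, FreeAlgebra.lift_ι_apply, tauGen, hi', hj', if_false]
    exact key
  | braid_four i j hi hj =>
    simp only [map_mul, hT] at key
    have hj' : j.val ≠ 0 := by omega
    simp only [map_mul, FreeAlgebra.lift_ι_apply, tauGen, hi, hj', if_false, if_true,
      smul_mul_assoc, mul_smul_comm]
    exact congrArg (fun z => P.ξ • P.ξ • z) key
  | cyclotomic i hi =>
    rw [prod_ofFn_eq_aeval, Params.prod_u, map_zero] at key ⊢
    rw [← Polynomial.aeval_algHom_apply] at key ⊢
    rw [hT] at key
    have e : FreeAlgebra.lift ℂ (tauGen P) (FreeAlgebra.ι ℂ i) = P.ξ • (T P i : H P n) := by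
      simp [tauGen, hi]
    rw [e]
    refine Eq.trans ?_ key
    have ex : (∏ l : Fin d, (Polynomial.X ^ p - Polynomial.C (P.v l ^ p)) : Polynomial ℂ) =
        Polynomial.expand ℂ p (∏ l : Fin d, (Polynomial.X - Polynomial.C (P.v l ^ p))) := by
      rw [map_prod]
      exact Finset.prod_congr rfl fun l _ => by
        rw [map_sub, Polynomial.expand_X, Polynomial.expand_C]
    rw [ex, Polynomial.expand_aeval, Polynomial.expand_aeval, smul_pow,
      P.isPrimitiveRoot.pow_eq_one, one_smul]
  | quadratic i hi =>
    simp only [map_mul, map_sub, map_add, map_one, map_zero, hT, AlgHom.commutes] at key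
    have hi' : i.val ≠ 0 := by omega
    simp only [map_mul, map_sub, map_add, map_one, map_zero, AlgHom.commutes,
      FreeAlgebra.lift_ι_apply, tauGen, hi', if_false]
    exact key

/-- The algebra automorphism `τ` of `H_{r,1,n}`: `τ(T₁) = ξ T₁`, `τ(T_i) = T_i` for `i ≥ 2`. -/
def tau [NeZero p] (P : Params p d) (n : ℕ) : H P n →ₐ[ℂ] H P n :=
  HeckeAlg.lift (FreeAlgebra.lift ℂ (tauGen P)) (tauGen_rel P)

theorem tau_pow [NeZero p] (P : Params p d) (n : ℕ) : tau P n ^ p = 1 := by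
  have hgen : ∀ i : Fin n, tau P n (T P i) = tauGen P i := fun i => by
    refine (HeckeAlg.lift_mk (FreeAlgebra.lift ℂ (tauGen P)) (tauGen_rel P) _).trans ?_
    simp
  have hpow : ∀ (k : ℕ) (i : Fin n), (tau P n ^ k) (T P i) =
      if i.val = 0 then P.ξ ^ k • T P i else T P i := by
    intro k i
    induction k with
    | zero => simp
    | succ k ih =>
      rw [pow_succ', AlgHom.mul_apply, ih]
      split_ifs with hi
      · rw [map_smul, hgen, tauGen, if_pos hi, smul_smul, pow_succ]
      · rw [hgen, tauGen, if_neg hi]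
  refine HeckeAlg.hom_ext fun i => ?_
  refine (hpow p i).trans ?_
  rw [P.isPrimitiveRoot.pow_eq_one, one_smul, ite_self]
  rfl

/-- The cyclic group `G = ⟨τ⟩ ≃ ℤ/p`, written multiplicatively. -/
abbrev G (p : ℕ) : Type := Multiplicative (ZMod p)

/-- `G` acts on the Hecke algebra by algebra automorphisms, the class of `k` acting as `τ ^ k`. -/
instance [NeZero p] (P : Params p d) (n : ℕ) : MulSemiringAction (G p) (H P n) where
  smul g x := (tau P n ^ (Multiplicative.toAdd g).val) x
  one_smul x := by
    change (tau P n ^ (0 : ZMod p).val) x = x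
    simp
  mul_smul g h x := by
    change (tau P n ^ (Multiplicative.toAdd g + Multiplicative.toAdd h).val) x =
      (tau P n ^ (Multiplicative.toAdd g).val) ((tau P n ^ (Multiplicative.toAdd h).val) x)
    rw [ZMod.val_add, ← pow_eq_pow_mod _ (tau_pow P n), pow_add]
    rfl
  smul_zero g := map_zero (tau P n ^ (Multiplicative.toAdd g).val)
  smul_add g := map_add (tau P n ^ (Multiplicative.toAdd g).val)
  smul_one g := map_one (tau P n ^ (Multiplicative.toAdd g).val)
  smul_mul g := map_mul (tau P n ^ (Multiplicative.toAdd g).val)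

/-! ### Multipartitions, the shift operator, standard tableaux -/

/-- The `r`-tuples `λ = (λ^i_j)` of Young diagrams, `i` modulo `p`, `j` in `Fin d`, with `n` cells
in total. -/
@[ext]
structure MultiPart (p d n : ℕ) [NeZero p] where
  diag : ZMod p → Fin d → YoungDiagram
  sum_card : ∑ i, ∑ j, (diag i j).card = n

variable [NeZero p] {n : ℕ}

/-- Ariki's shift operator: `shift(λ)^i_j = λ^{i+1}_j`. -/
def shift (lam : MultiPart p d n) : MultiPart p d n where
  diag i j := lam.diag (i + 1) j
  sum_card := by
    exact (Equiv.sum_comp (Equiv.addRight (1 : ZMod p))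
      fun i => ∑ j, (lam.diag i j).card).trans lam.sum_card

/-- Two tuples are cyclic equivalent if one is an iterated shift of the other. -/
def CyclicEquiv (lam mu : MultiPart p d n) : Prop := ∃ k : ℕ, shift^[k] lam = mu

theorem shift_iterate_diag (k : ℕ) (lam : MultiPart p d n) (i : ZMod p) (j : Fin d) :
    (shift^[k] lam).diag i j = lam.diag (i + k) j := by
  induction k generalizing i with
  | zero => simp
  | succ k ih =>
    rw [Function.iterate_succ_apply']
    change (shift^[k] lam).diag (i + 1) j = _
    rw [ih]
    push_cast
    congr 1
    ring

/-- `G ≃ ⟨shift⟩` acts on tuples of Young diagrams, the class of `k` acting as `shift ^ k`. -/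
instance : MulAction (G p) (MultiPart p d n) where
  smul g lam := shift^[(Multiplicative.toAdd g).val] lam
  one_smul lam := by
    change shift^[(0 : ZMod p).val] lam = lam
    simp
  mul_smul g h lam := by
    change shift^[(Multiplicative.toAdd g + Multiplicative.toAdd h).val] lam =
      shift^[(Multiplicative.toAdd g).val] (shift^[(Multiplicative.toAdd h).val] lam)
    ext i j : 3
    simp only [shift_iterate_diag, ZMod.natCast_val, ZMod.cast_id', id]
    rw [add_assoc]

/-- The stabilizer `G_λ` of `λ` in `G`. -/
abbrev Stab (lam : MultiPart p d n) : Subgroup (G p) := MulAction.stabilizer (G p) lam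

/-- The cells of `λ`: a component `(i, j)` together with a cell (row, column) of `λ^i_j`. -/
def Cell (lam : MultiPart p d n) : Type :=
  {c : (ZMod p × Fin d) × (ℕ × ℕ) // c.2 ∈ lam.diag c.1.1 c.1.2}

/-- A bijective filling of `λ` with `n` numbers is standard if entries increase along rows and
columns of each component. -/
def IsStandard (lam : MultiPart p d n) (t : Fin n ≃ Cell lam) : Prop :=
  ∀ x y : Fin n, (t x).1.1 = (t y).1.1 → (t x).1.2 ≤ (t y).1.2 → x ≤ y

/-- Standard tableaux of shape `λ` (the entries `1, …, n` are indexed by `Fin n`). -/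
def StdTab (lam : MultiPart p d n) : Type := {t : Fin n ≃ Cell lam // IsStandard lam t}

/-- The content (column minus row) of the cell occupied by `x`. -/
def content {lam : MultiPart p d n} (t : StdTab lam) (x : Fin n) : ℤ :=
  ((t.1 x).1.2.2 : ℤ) - ((t.1 x).1.2.1 : ℤ)

/-! ### The modules `V(λ)` -/

/-- The parameter `ξ ^ a * v_b` of the component `(a, b)` of `λ` that contains `x`. -/
def param (P : Params p d) {lam : MultiPart p d n} (t : StdTab lam) (x : Fin n) : ℂ :=
  P.ξ ^ (t.1 x).1.1.1.val * P.v (t.1 x).1.1.2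

/-- The quantum integer `[m]_q = (1 - q ^ m) / (1 - q)`, equal to `m` if `q = 1`. -/
def qInt (q : ℂ) (m : ℤ) : ℂ := if q = 1 then (m : ℂ) else (1 - q ^ m) / (1 - q)

/-- The diagonal entry of the seminormal form for the exchange of consecutive entries `x, y`.
Let `R_x = param x * q ^ (- content x)`. In different components it is `(1 - q) R_y / (R_y - R_x)`;
in the same component this expression simplifies to `1 / [content y - content x]_q`. -/
def seminormalCoeff (P : Params p d) {lam : MultiPart p d n} (t : StdTab lam) (x y : Fin n) : ℂ :=
  if (t.1 x).1.1 = (t.1 y).1.1 then 1 / qInt P.q (content t y - content t x)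
  else
    (1 - P.q) * (param P t y * P.q ^ (-content t y)) /
      (param P t y * P.q ^ (-content t y) - param P t x * P.q ^ (-content t x))

/-- The free `H_{r,1,n}`-module on symbols `v(𝕋)`, `𝕋` a standard tableau of shape `λ`. -/
abbrev FreeOnTab (P : Params p d) (lam : MultiPart p d n) : Type := StdTab lam →₀ H P n

/-- The symbol `v(𝕋)` in the free module. -/
def sym (P : Params p d) {lam : MultiPart p d n} (t : StdTab lam) : FreeOnTab P lam :=
  Finsupp.single t 1

open Classical in
/-- The vector `v(𝕋')` if the filling `𝕋'` is standard, and `0` otherwise. -/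
def symOrZero (P : Params p d) {lam : MultiPart p d n} (t : Fin n ≃ Cell lam) : FreeOnTab P lam :=
  if h : IsStandard lam t then sym P ⟨t, h⟩ else 0

/-- The seminormal action of the generators on the symbols `v(𝕋)`:
`T₁ v(𝕋) = ξ ^ a v_b v(𝕋)`, where the entry `1` of `𝕋` lies in the component `(a, b)`, and
`T_i v(𝕋) = A v(𝕋) + (1 - A) v(s_i 𝕋)` for `i ≥ 2`, where `A` is the seminormal coefficient
for the entries `i - 1, i` of `𝕋`, `s_i 𝕋` is `𝕋` with `i - 1` and `i` exchanged, and `v(s_i 𝕋)`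
is read as `0` if `s_i 𝕋` is not standard. -/
inductive SeminormalRel (P : Params p d) (lam : MultiPart p d n) : FreeOnTab P lam → Prop
  | first (t : StdTab lam) (i : Fin n) (hi : i.val = 0) :
      SeminormalRel P lam (T P i • sym P t - param P t i • sym P t)
  | next (t : StdTab lam) (x y : Fin n) (h : y.val = x.val + 1) :
      SeminormalRel P lam (T P y • sym P t - (seminormalCoeff P t x y • sym P t +
        (1 - seminormalCoeff P t x y) • symOrZero P ((Equiv.swap x y).trans t.1)))

/-- The `H_{r,1,n}`-module `V(λ)`, generated by the symbols `v(𝕋)` with the seminormal action of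
the generators. -/
def V (P : Params p d) (lam : MultiPart p d n) : Type :=
  FreeOnTab P lam ⧸ Submodule.span (H P n) {x | SeminormalRel P lam x}

instance (P : Params p d) (lam : MultiPart p d n) : AddCommGroup (V P lam) :=
  inferInstanceAs (AddCommGroup
    (FreeOnTab P lam ⧸ Submodule.span (H P n) {x | SeminormalRel P lam x}))

instance (P : Params p d) (lam : MultiPart p d n) : Module (H P n) (V P lam) :=
  inferInstanceAs (Module (H P n)
    (FreeOnTab P lam ⧸ Submodule.span (H P n) {x | SeminormalRel P lam x}))

instance (P : Params p d) (lam : MultiPart p d n) : Module ℂ (V P lam) :=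
  inferInstanceAs (Module ℂ
    (FreeOnTab P lam ⧸ Submodule.span (H P n) {x | SeminormalRel P lam x}))

instance (P : Params p d) (lam : MultiPart p d n) : IsScalarTower ℂ (H P n) (V P lam) :=
  inferInstanceAs (IsScalarTower ℂ (H P n)
    (FreeOnTab P lam ⧸ Submodule.span (H P n) {x | SeminormalRel P lam x}))

/-- The vector `v(𝕋)` of `V(λ)`. -/
def vec (P : Params p d) {lam : MultiPart p d n} (t : StdTab lam) : V P lam :=
  (Submodule.Quotient.mk (sym P t) :
    FreeOnTab P lam ⧸ Submodule.span (H P n) {x | SeminormalRel P lam x})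

/-! ### Intertwiners, factor sets and twisted group algebras -/

/-- A choice, for each `h ∈ G_λ`, of a linear automorphism `φ_h` of `V(λ)` with
`φ_h r = h(r) φ_h` as operators, for all `r` in the Hecke algebra. -/
structure Intertwiners (P : Params p d) (lam : MultiPart p d n) where
  φ : Stab lam → (V P lam ≃ₗ[ℂ] V P lam)
  φ_smul : ∀ (h : Stab lam) (r : H P n) (m : V P lam), φ h (r • m) = ((h : G p) • r) • φ h m

/-- Intertwiners `φ_h` together with the function `α_λ` determined by
`φ_g φ_h = α_λ(g, h) φ_{gh}`. -/
structure CliffordDatum (P : Params p d) (lam : MultiPart p d n) extends Intertwiners P lam where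
  α : Stab lam → Stab lam → ℂˣ
  φ_mul : ∀ (g h : Stab lam) (m : V P lam), φ g (φ h m) = (α g h : ℂ) • φ (g * h) m

/-- The relations `c_g c_h = β(g, h) c_{gh}` and `c_1 = β(1, 1) 1` of a twisted group algebra. -/
inductive TwistedRel (K : Type) [Group K] (β : K → K → ℂˣ) :
    FreeAlgebra ℂ K → FreeAlgebra ℂ K → Prop
  | mul (g h : K) :
      TwistedRel K β (FreeAlgebra.ι ℂ g * FreeAlgebra.ι ℂ h)
        ((β g h : ℂ) • FreeAlgebra.ι ℂ (g * h))
  | one : TwistedRel K β (FreeAlgebra.ι ℂ 1) ((β 1 1 : ℂ) • 1)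

/-- The twisted group algebra `(ℂK)_β`. For a 2-cocycle `β` the elements `c_g` form a basis and
the unit element is `β(1, 1)⁻¹ c_1`. -/
def TwistedGroupAlg (K : Type) [Group K] (β : K → K → ℂˣ) : Type := RingQuot (TwistedRel K β)

instance (K : Type) [Group K] (β : K → K → ℂˣ) : Ring (TwistedGroupAlg K β) :=
  inferInstanceAs (Ring (RingQuot (TwistedRel K β)))

instance (K : Type) [Group K] (β : K → K → ℂˣ) : Algebra ℂ (TwistedGroupAlg K β) :=
  inferInstanceAs (Algebra ℂ (RingQuot (TwistedRel K β)))

/-- The element `c_g` of a twisted group algebra. -/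
def TwistedGroupAlg.c {K : Type} [Group K] (β : K → K → ℂˣ) (g : K) : TwistedGroupAlg K β :=
  RingQuot.mkAlgHom ℂ (TwistedRel K β) (FreeAlgebra.ι ℂ g)

theorem TwistedGroupAlg.c_mul {K : Type} [Group K] (β : K → K → ℂˣ) (g h : K) :
    c β g * c β h = (β g h : ℂ) • c β (g * h) := by
  exact ((RingQuot.mkAlgHom ℂ (TwistedRel K β)).map_mul _ _).symm.trans
    ((RingQuot.mkAlgHom_rel ℂ (TwistedRel.mul (β := β) g h)).trans
      (map_smul (RingQuot.mkAlgHom ℂ (TwistedRel K β)) _ _))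

theorem TwistedGroupAlg.c_one {K : Type} [Group K] (β : K → K → ℂˣ) :
    c β 1 = (β 1 1 : ℂ) • 1 := by
  exact (RingQuot.mkAlgHom_rel ℂ (TwistedRel.one (K := K) (β := β))).trans
    ((map_smul (RingQuot.mkAlgHom ℂ (TwistedRel K β)) _ _).trans
      (congrArg ((β 1 1 : ℂ) • ·) (map_one (RingQuot.mkAlgHom ℂ (TwistedRel K β)))))

variable {P : Params p d} {lam mu : MultiPart p d n}

/-- The algebra `(ℂ G_λ)_{α_λ⁻¹}`. -/
abbrev CliffordDatum.Tw (D : CliffordDatum P lam) : Type :=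
  TwistedGroupAlg (Stab lam) fun g h => (D.α g h)⁻¹

/-- The element `c_h` of `(ℂ G_λ)_{α_λ⁻¹}`. -/
def CliffordDatum.c (D : CliffordDatum P lam) (h : Stab lam) : D.Tw :=
  TwistedGroupAlg.c (fun g h => (D.α g h)⁻¹) h

/-! ### Crossed products and the modules `V(λ) ⊗ π` -/

/-- The crossed product `H_{r,1,n} ⋊ G`. -/
abbrev Cross (P : Params p d) (n : ℕ) : Type := SkewMonoidAlgebra (H P n) (G p)

/-- The crossed product `H_{r,1,n} ⋊ G_λ`. -/
abbrev CrossStab (P : Params p d) (lam : MultiPart p d n) : Type :=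
  SkewMonoidAlgebra (H P n) (Stab lam)

/-- The inclusion `H_{r,1,n} ⋊ G_λ → H_{r,1,n} ⋊ G`. -/
def crossIncl (P : Params p d) (lam : MultiPart p d n) : CrossStab P lam →+* Cross P n :=
  SkewMonoidAlgebra.mapDomainRingHom (f := (Stab lam).subtype) fun _ _ => rfl

section Tensor

variable (D : CliffordDatum P lam) (π : Type*) [AddCommGroup π] [Module ℂ π] [Module D.Tw π]
  [IsScalarTower ℂ D.Tw π]

/-- The action of `c_h` on a module over `(ℂ G_λ)_{α_λ⁻¹}`, as a linear map. -/
def CliffordDatum.cAct (h : Stab lam) : π →ₗ[ℂ] π := Algebra.lsmul ℂ ℂ π (D.c h)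

theorem CliffordDatum.cAct_apply (h : Stab lam) (x : π) : D.cAct π h x = D.c h • x := rfl

theorem CliffordDatum.cAct_one (x : π) : D.cAct π 1 x = ((D.α 1 1)⁻¹ : ℂ) • x := by
  rw [cAct_apply, CliffordDatum.c, TwistedGroupAlg.c_one, smul_assoc, one_smul,
    Units.val_inv_eq_inv_val]

theorem CliffordDatum.cAct_mul (g h : Stab lam) (x : π) :
    D.cAct π g (D.cAct π h x) = ((D.α g h)⁻¹ : ℂ) • D.cAct π (g * h) x := by
  rw [cAct_apply, cAct_apply, smul_smul, CliffordDatum.c, CliffordDatum.c,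
    TwistedGroupAlg.c_mul, smul_assoc, Units.val_inv_eq_inv_val]
  rfl

theorem CliffordDatum.φ_one (m : V P lam) : D.φ 1 m = (D.α 1 1 : ℂ) • m := by
  obtain ⟨m, rfl⟩ := (D.φ 1).surjective m
  simpa using D.φ_mul 1 1 m

/-- `h` acts on `V(λ) ⊗ π` by `φ_h ⊗ c_h`. -/
def groupAct : Stab lam →* Module.End ℂ (V P lam ⊗[ℂ] π) where
  toFun h := TensorProduct.map (D.φ h).toLinearMap (D.cAct π h)
  map_one' := by
    refine TensorProduct.ext' fun m x => ?_
    rw [TensorProduct.map_tmul, LinearEquiv.coe_coe, D.φ_one, D.cAct_one,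
      TensorProduct.smul_tmul_smul, mul_inv_cancel₀ (Units.ne_zero _), one_smul]
    rfl
  map_mul' g h := by
    refine TensorProduct.ext' fun m x => ?_
    rw [Module.End.mul_apply, TensorProduct.map_tmul, TensorProduct.map_tmul,
      TensorProduct.map_tmul, LinearEquiv.coe_coe, LinearEquiv.coe_coe, LinearEquiv.coe_coe,
      D.φ_mul, D.cAct_mul, TensorProduct.smul_tmul_smul, mul_inv_cancel₀ (Units.ne_zero _),
      one_smul]

/-- `r` acts on `V(λ) ⊗ π` by `r ⊗ 1`. -/
def heckeAct (P : Params p d) (lam : MultiPart p d n) (π : Type*) [AddCommGroup π] [Module ℂ π] :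
    H P n →+* Module.End ℂ (V P lam ⊗[ℂ] π) :=
  (Module.End.rTensorAlgHom ℂ (V P lam) π).toRingHom.comp
    (Algebra.lsmul ℂ ℂ (V P lam)).toRingHom

theorem heckeAct_tmul (r : H P n) (m : V P lam) (x : π) :
    heckeAct P lam π r (m ⊗ₜ x) = (r • m) ⊗ₜ x := rfl

theorem groupAct_tmul (h : Stab lam) (m : V P lam) (x : π) :
    groupAct D π h (m ⊗ₜ x) = D.φ h m ⊗ₜ (D.c h • x) := rfl

/-- The action of `H_{r,1,n} ⋊ G_λ` on `V(λ) ⊗ π`: `(r h)(m ⊗ x) = r φ_h m ⊗ c_h x`. -/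
def crossAct : CrossStab P lam →+* Module.End ℂ (V P lam ⊗[ℂ] π) :=
  SkewMonoidAlgebra.liftNCRingHom (heckeAct P lam π) (groupAct D π) (by
    intro r h
    refine TensorProduct.ext' fun m x => ?_
    rw [Module.End.mul_apply, Module.End.mul_apply, groupAct_tmul, heckeAct_tmul, heckeAct_tmul,
      groupAct_tmul, D.φ_smul]
    rfl)

end Tensor

/-- The vector space `V(λ) ⊗ π`, regarded as an `H_{r,1,n} ⋊ G_λ`-module. -/
def VTensor (_D : CliffordDatum P lam) (π : Type*) [AddCommGroup π] [Module ℂ π] : Type _ :=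
  V P lam ⊗[ℂ] π

instance (D : CliffordDatum P lam) (π : Type*) [AddCommGroup π] [Module ℂ π] :
    AddCommGroup (VTensor D π) := inferInstanceAs (AddCommGroup (V P lam ⊗[ℂ] π))

instance (D : CliffordDatum P lam) (π : Type*) [AddCommGroup π] [Module ℂ π] [Module D.Tw π]
    [IsScalarTower ℂ D.Tw π] : Module (CrossStab P lam) (VTensor D π) :=
  letI : Module (Module.End ℂ (V P lam ⊗[ℂ] π)) (VTensor D π) :=
    inferInstanceAs (Module (Module.End ℂ (V P lam ⊗[ℂ] π)) (V P lam ⊗[ℂ] π))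
  Module.compHom _ (crossAct D π)

/-! ### Induction -/

/-- For a ring homomorphism `f : B → A` of (noncommutative) rings and a left `B`-module `N`, the
induced left `A`-module `A ⊗_B N`: the quotient of `A ⊗_ℤ N` by the elements
`a f(b) ⊗ x - a ⊗ b x`. -/
abbrev Ind {B A : Type*} [Ring B] [Ring A] (f : B →+* A) (N : Type*) [AddCommGroup N]
    [Module B N] : Type _ :=
  (A ⊗[ℤ] N) ⧸ Submodule.span A
    {z : A ⊗[ℤ] N | ∃ (a : A) (b : B) (x : N), z = (a * f b) ⊗ₜ[ℤ] x - a ⊗ₜ[ℤ] (b • x)}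

/-- The `H_{r,1,n} ⋊ G`-module `RG^{V(λ), π}`, induced from the `H_{r,1,n} ⋊ G_λ`-module
`V(λ) ⊗ π`. -/
abbrev RG (D : CliffordDatum P lam) (π : Type*) [AddCommGroup π] [Module ℂ π] [Module D.Tw π]
    [IsScalarTower ℂ D.Tw π] : Type _ :=
  Ind (crossIncl P lam) (VTensor D π)

/-! ### Comparison of modules over the twisted group algebras -/

/-- A family of choices of intertwiners, one for each `λ`, is compatible if it is transported along
the twisted isomorphisms between the `V(λ)`: whenever `θ : V(λ) → V(μ)` is bijective with
`θ(r m) = k(r) θ(m)` for some `k ∈ G`, then `φ_{μ,h} θ = θ φ_{λ,h}` for all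
`h ∈ G_λ ∩ G_μ`. -/
def Compatible (D : ∀ lam : MultiPart p d n, CliffordDatum P lam) : Prop :=
  ∀ (lam mu : MultiPart p d n) (k : G p) (θ : V P lam ≃ₗ[ℂ] V P mu),
    (∀ (r : H P n) (m : V P lam), θ (r • m) = (k • r) • θ m) →
    ∀ (h : G p) (h₁ : h ∈ Stab lam) (h₂ : h ∈ Stab mu) (m : V P lam),
      (D mu).φ ⟨h, h₂⟩ (θ m) = θ ((D lam).φ ⟨h, h₁⟩ m)

/-- An isomorphism between an `(ℂ G_λ)_{α_λ⁻¹}`-module `π` and an `(ℂ G_μ)_{α_μ⁻¹}`-module `π'`: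
a linear bijection that commutes with the elements `c_h`. It is used for `G_λ = G_μ`. -/
def TwIso (D : CliffordDatum P lam) (E : CliffordDatum P mu)
    (π π' : Type*) [AddCommGroup π] [Module ℂ π] [Module D.Tw π]
    [AddCommGroup π'] [Module ℂ π'] [Module E.Tw π'] : Prop :=
  ∃ f : π ≃ₗ[ℂ] π', ∀ (h : G p) (h₁ : h ∈ Stab lam) (h₂ : h ∈ Stab mu) (x : π),
    f (D.c ⟨h, h₁⟩ • x) = E.c ⟨h, h₂⟩ • f x

end CliffordHecke

end

/-! The proof is Clifford theory for the extension of the Hecke algebra by the cyclic group `G`,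
built on a description of all simple Hecke modules by seminormal forms.

Semisimplicity first yields numerical conditions on the parameters. A linear functional that is a
joint eigenvector of the generators has, over a semisimple algebra, a joint eigenvector with the
same eigenvalues at which it does not vanish (`exists_eigenvector_of_functional`). For two modules
of functions on words, the value of the functional at this vector is a multiple of the quantum
factorial of `n` (`qFactorial_ne_zero`) or of the product of the `u k - q ^ i * u l`
(`prod_sub_pow_mul_ne_zero`), so these numbers are nonzero. Hence the relevant seminormal
denominators do not vanish, the formulas define a representation (`isHeckeFamily_seminormalOp`), and
the vectors `v(𝕋)` are independent. A homomorphism between two `V(λ)` has matrix entries only at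
equal tableaux (`word_eq_of_tabCoord_ne_zero`). This gives Schur's lemma, and with it simplicity and
the absence of isomorphisms between different shapes.

That there are no other simple modules follows by counting. With `r = d * p`, the Hecke algebra has
dimension at most `r ^ n * n!` (`exists_finrank_le`), while the squares of the numbers of standard
tableaux add up to at least this number, because the multipartitions form a differential poset
(`exists_finset_sum_natCard_sq`). So the algebra is, as a left module, a sum of copies of the `V(λ)`
(`exists_equiv_V`).

For the crossed product, moving the components gives twisted isomorphisms `V(λ) → V(k λ)`
(`relabel`), and all other twisted maps are multiples of them. Stabilizers are cyclic, so a nonzero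
projective representation in which the group elements act has a common eigenvector
(`exists_common_eigenvector`); thus a simple `π` is a line with a character `χ`. A module `M` is
then studied through its type maps, the Hecke maps `V(λ) → M` that transform under `G_λ` by `χ`.
Every nonzero `M` has a nonzero one (`exists_isTypeMap`). If the translates of its image generate
`M`, every Hecke map `V(λ) → M` is a multiple of it (`Generates.eq_smul`), which makes `M` simple.
The induced module carries the universal type map (`IsTypeMap.exists_linearMap`), so each simple `M`
is induced, and the multiplicity one property recovers `λ` up to shift and the character `χ`. -/

noncomputable section

namespace CliffordHecke

section

/-! ### Generators and representations of the Hecke algebra -/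

namespace HeckeAlg

variable {r n : ℕ} {u : Fin r → ℂ} {q : ℂ}

/-- The generators of the cyclotomic Hecke algebra with arbitrary parameters. -/
def gen (r : ℕ) {n : ℕ} (u : Fin r → ℂ) (q : ℂ) (i : Fin n) : HeckeAlg r n u q :=
  mk r n u q (FreeAlgebra.ι ℂ i)

theorem mk_surjective : Function.Surjective (mk r n u q) :=
  RingQuot.mkAlgHom_surjective ℂ _

theorem adjoin_gen : Algebra.adjoin ℂ (Set.range (gen r (n := n) u q)) = ⊤ := by
  have h : Set.range (gen r (n := n) u q) = mk r n u q '' Set.range (FreeAlgebra.ι ℂ) := by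
    rw [← Set.range_comp]; rfl
  rw [h, ← AlgHom.map_adjoin, FreeAlgebra.adjoin_range_ι, Algebra.map_top, AlgHom.range_eq_top]
  exact mk_surjective

theorem mem_of_gen (S : Subalgebra ℂ (HeckeAlg r n u q)) (h : ∀ i, gen r u q i ∈ S)
    (x : HeckeAlg r n u q) : x ∈ S := by
  have : (⊤ : Subalgebra ℂ (HeckeAlg r n u q)) ≤ S := by
    rw [← adjoin_gen]
    exact Algebra.adjoin_le (by rintro _ ⟨i, rfl⟩; exact h i)
  exact this trivial

end HeckeAlg

/-- A family of elements of an algebra that satisfies the defining relations of the cyclotomic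
Hecke algebra. -/
structure IsHeckeFamily {A : Type*} [Ring A] [Algebra ℂ A] (r n : ℕ) (u : Fin r → ℂ) (q : ℂ)
    (X : Fin n → A) : Prop where
  comm : ∀ i j : Fin n, i.val + 1 < j.val → X i * X j = X j * X i
  braid : ∀ i j : Fin n, 1 ≤ i.val → j.val = i.val + 1 → X i * X j * X i = X j * X i * X j
  braid_four : ∀ i j : Fin n, i.val = 0 → j.val = 1 →
    X i * X j * X i * X j = X j * X i * X j * X i
  cyclotomic : ∀ i : Fin n, i.val = 0 →
    Polynomial.aeval (X i) (∏ k : Fin r, (Polynomial.X - Polynomial.C (u k))) = 0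
  quadratic : ∀ i : Fin n, 1 ≤ i.val → X i * X i = (1 - q) • X i + q • 1

section Family

variable {r n : ℕ} {u : Fin r → ℂ} {q : ℂ}

theorem isHeckeFamily_gen : IsHeckeFamily r n u q (HeckeAlg.gen r (n := n) u q) where
  comm i j h := by
    simpa only [map_mul, HeckeAlg.gen] using HeckeAlg.mk_rel (HeckeRel.comm (r := r) (u := u) (q := q) i j h)
  braid i j hi hj := by
    simpa only [map_mul, HeckeAlg.gen] using
      HeckeAlg.mk_rel (HeckeRel.braid (r := r) (u := u) (q := q) i j hi hj)
  braid_four i j hi hj := by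
    simpa only [map_mul, HeckeAlg.gen] using
      HeckeAlg.mk_rel (HeckeRel.braid_four (r := r) (u := u) (q := q) i j hi hj)
  cyclotomic i hi := by
    have := HeckeAlg.mk_rel (HeckeRel.cyclotomic (r := r) (u := u) (q := q) i hi)
    rw [prod_ofFn_eq_aeval, map_zero, ← Polynomial.aeval_algHom_apply] at this
    exact this
  quadratic i hi := by
    have := HeckeAlg.mk_rel (HeckeRel.quadratic (r := r) (u := u) (q := q) i hi)
    simp only [map_mul, map_sub, map_add, map_one, map_zero, AlgHom.commutes] at this
    change (HeckeAlg.gen r u q i - 1) * (HeckeAlg.gen r u q i + _) = 0 at this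
    rw [sub_mul, mul_add, one_mul, Algebra.algebraMap_eq_smul_one, mul_smul_comm, mul_one] at this
    rw [← sub_eq_zero, ← this]
    module

theorem IsHeckeFamily.lift_rel {A : Type} [Ring A] [Algebra ℂ A] {X : Fin n → A}
    (hX : IsHeckeFamily r n u q X) ⦃x y : FreeAlgebra ℂ (Fin n)⦄ (h : HeckeRel r n u q x y) :
    FreeAlgebra.lift ℂ X x = FreeAlgebra.lift ℂ X y := by
  cases h with
  | comm i j h => simpa using hX.comm i j h
  | braid i j hi hj => simpa using hX.braid i j hi hj
  | braid_four i j hi hj => simpa using hX.braid_four i j hi hj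
  | cyclotomic i hi =>
    rw [prod_ofFn_eq_aeval, map_zero, ← Polynomial.aeval_algHom_apply, FreeAlgebra.lift_ι_apply]
    exact hX.cyclotomic i hi
  | quadratic i hi =>
    simp only [map_mul, map_sub, map_add, map_one, map_zero, AlgHom.commutes,
      FreeAlgebra.lift_ι_apply]
    rw [sub_mul, mul_add, one_mul, hX.quadratic i hi, Algebra.algebraMap_eq_smul_one,
      mul_smul_comm, mul_one]
    module

/-- The representation of the Hecke algebra given by a family that satisfies the relations. -/
def IsHeckeFamily.rep {A : Type} [Ring A] [Algebra ℂ A] {X : Fin n → A}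
    (hX : IsHeckeFamily r n u q X) : HeckeAlg r n u q →ₐ[ℂ] A :=
  HeckeAlg.lift (FreeAlgebra.lift ℂ X) hX.lift_rel

theorem IsHeckeFamily.rep_gen {A : Type} [Ring A] [Algebra ℂ A] {X : Fin n → A}
    (hX : IsHeckeFamily r n u q X) (i : Fin n) : hX.rep (HeckeAlg.gen r u q i) = X i := by
  refine (HeckeAlg.lift_mk _ hX.lift_rel _).trans ?_
  simp

/-- Over a semisimple Hecke algebra, a nonzero functional that is an eigenvector for the generators
does not vanish on all the vectors with the same eigenvalues. -/
theorem exists_eigenvector_of_functional [hss : IsSemisimpleRing (HeckeAlg r n u q)]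
    {M : Type} [AddCommGroup M] [Module ℂ M] (ρ : HeckeAlg r n u q →ₐ[ℂ] Module.End ℂ M)
    (χ : Fin n → ℂ) (f : M →ₗ[ℂ] ℂ)
    (hf : ∀ i F, f (ρ (HeckeAlg.gen r u q i) F) = χ i * f F) (h0 : ∃ F, f F ≠ 0) :
    ∃ y, f y ≠ 0 ∧ ∀ i, ρ (HeckeAlg.gen r u q i) y = χ i • y := by
  let _ : Module (HeckeAlg r n u q) M := Module.compHom M ρ.toRingHom
  have smul_def : ∀ (h : HeckeAlg r n u q) (m : M), h • m = ρ h m := fun _ _ => rfl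
  -- The elements that preserve the kernel of `f` form a subalgebra that contains the generators. So
  -- the kernel is a submodule, and semisimplicity supplies a complement.
  let S : Subalgebra ℂ (HeckeAlg r n u q) :=
    { carrier := {h | ∀ F, f F = 0 → f (ρ h F) = 0}
      mul_mem' := by
        intro a b ha hb F hF
        rw [map_mul]
        exact ha _ (hb _ hF)
      add_mem' := by
        intro a b ha hb F hF
        rw [map_add, LinearMap.add_apply, map_add, ha _ hF, hb _ hF, add_zero]
      algebraMap_mem' := by
        intro c F hF
        rw [AlgHom.commutes, Module.algebraMap_end_apply, map_smul, hF, smul_zero] }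
  have hS : ∀ h, h ∈ S := HeckeAlg.mem_of_gen S fun i F hF => by rw [hf, hF, mul_zero]
  let K : Submodule (HeckeAlg r n u q) M :=
    { carrier := {F | f F = 0}
      add_mem' := by
        intro a b ha hb
        change f (a + b) = 0
        rw [map_add, show f a = 0 from ha, show f b = 0 from hb, add_zero]
      zero_mem' := map_zero f
      smul_mem' := fun h F hF => hS h F hF }
  obtain ⟨Q, hQ⟩ := exists_isCompl K
  obtain ⟨F, hF⟩ := h0
  have hm : F ∈ K ⊔ Q := by rw [hQ.sup_eq_top]; trivial
  obtain ⟨k, hk, y, hy, rfl⟩ := Submodule.mem_sup.1 hm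
  have hk' : f k = 0 := hk
  refine ⟨y, by simpa [hk'] using hF, fun i => ?_⟩
  have hQs : ∀ c : ℂ, c • y ∈ Q := fun c => by
    have := Q.smul_mem (algebraMap ℂ _ c) hy
    rwa [smul_def, AlgHom.commutes, Module.algebraMap_end_apply] at this
  -- The defect of the eigenvector equation lies in the complement, and by the eigenvalue property
  -- of `f` also in the kernel.
  have h1 : ρ (HeckeAlg.gen r u q i) y - χ i • y ∈ Q := Q.sub_mem (Q.smul_mem _ hy) (hQs _)
  have h2 : ρ (HeckeAlg.gen r u q i) y - χ i • y ∈ K := by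
    change f _ = 0
    rw [map_sub, hf, map_smul, smul_eq_mul, sub_self]
  have := Submodule.disjoint_def.1 hQ.disjoint _ h2 h1
  exact sub_eq_zero.1 this

end Family

end

section

/-! ### Actions on functions of words -/

section Words

variable {n : ℕ} {A : Type} [LinearOrder A]

theorem comp_swap_of_eq {B : Type*} (w : Fin n → B) (x y : Fin n) (h : w x = w y) :
    w ∘ Equiv.swap x y = w := by
  funext z
  rcases eq_or_ne z x with rfl | hx
  · simp [h]
  rcases eq_or_ne z y with rfl | hy
  · simp [h]
  simp [Equiv.swap_apply_of_ne_of_ne hx hy]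

/-- The action of a generator of the Hecke algebra of type `A` on functions of words, exchanging
the letters in the positions `x` and `y`. -/
def wordOp (q : ℂ) (A : Type) [LinearOrder A] (x y : Fin n) : Module.End ℂ ((Fin n → A) → ℂ) where
  toFun F w := if w y < w x then (1 - q) * F w + q * F (w ∘ Equiv.swap x y)
    else F (w ∘ Equiv.swap x y)
  map_add' F G := by
    funext w
    simp only [Pi.add_apply]
    split_ifs <;> ring
  map_smul' c F := by
    funext w
    simp only [Pi.smul_apply, smul_eq_mul, RingHom.id_apply]
    split_ifs <;> ring

theorem wordOp_apply (q : ℂ) (x y : Fin n) (F : (Fin n → A) → ℂ) (w : Fin n → A) :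
    wordOp q A x y F w = if w y < w x then (1 - q) * F w + q * F (w ∘ Equiv.swap x y)
    else F (w ∘ Equiv.swap x y) := rfl

/-- Only `w` and its rearrangement interact. For distinct letters they give a two by two block of
trace `1 - q` and determinant `-q`; for equal letters the operator is the identity. -/
theorem wordOp_quadratic (q : ℂ) (x y : Fin n) :
    wordOp q A x y * wordOp q A x y = (1 - q) • wordOp q A x y + q • 1 := by
  refine LinearMap.ext fun F => funext fun w => ?_
  have e : (w ∘ Equiv.swap x y) ∘ Equiv.swap x y = w := by
    rw [Function.comp_assoc]; ext z; simp
  simp only [Module.End.mul_apply, wordOp_apply, LinearMap.add_apply, LinearMap.smul_apply,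
    Pi.add_apply, Pi.smul_apply, smul_eq_mul, Module.End.one_apply, e, Function.comp_apply,
    Equiv.swap_apply_left, Equiv.swap_apply_right]
  rcases lt_trichotomy (w x) (w y) with h | h | h
  · simp [h, h.not_gt]
  · simp [h, comp_swap_of_eq w x y h]; ring
  · simp [h, h.not_gt]

theorem wordOp_comm (q : ℂ) {x y z t : Fin n} (h5 : x ≠ y) (h6 : z ≠ t) (h1 : x ≠ z) (h2 : x ≠ t) (h3 : y ≠ z)
    (h4 : y ≠ t) : wordOp q A x y * wordOp q A z t = wordOp q A z t * wordOp q A x y := by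
  refine LinearMap.ext fun F => funext fun w => ?_
  have e : (w ∘ Equiv.swap x y) ∘ Equiv.swap z t = (w ∘ Equiv.swap z t) ∘ Equiv.swap x y := by
    rw [Function.comp_assoc, Function.comp_assoc]
    have : Equiv.swap x y * Equiv.swap z t = Equiv.swap z t * Equiv.swap x y :=
      (Equiv.Perm.disjoint_swap_swap (by simp_all)).commute
    rw [← Equiv.Perm.coe_mul, ← Equiv.Perm.coe_mul, this]
  simp only [Module.End.mul_apply, wordOp_apply, e, Function.comp_apply,
    Equiv.swap_apply_of_ne_of_ne h1 h2, Equiv.swap_apply_of_ne_of_ne h3 h4,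
    Equiv.swap_apply_of_ne_of_ne h1.symm h3.symm, Equiv.swap_apply_of_ne_of_ne h2.symm h4.symm]
  split_ifs <;> ring

/-- Both sides depend only on the relative order of three letters and on the values of `F` at the
rearrangements of the word, so this is a finite check over the weak orders of three letters. -/
theorem wordOp_braid (q : ℂ) {x y z : Fin n} (h1 : x ≠ y) (h2 : y ≠ z) (h3 : x ≠ z) :
    wordOp q A x y * wordOp q A y z * wordOp q A x y =
      wordOp q A y z * wordOp q A x y * wordOp q A y z := by
  refine LinearMap.ext fun F => funext fun w => ?_
  have i1 : ∀ v : Fin n → A, (v ∘ Equiv.swap x y) ∘ Equiv.swap x y = v := fun v => by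
    rw [Function.comp_assoc]; ext z; simp
  have i2 : ∀ v : Fin n → A, (v ∘ Equiv.swap y z) ∘ Equiv.swap y z = v := fun v => by
    rw [Function.comp_assoc]; ext z; simp
  have i3 : ((w ∘ Equiv.swap y z) ∘ Equiv.swap x y) ∘ Equiv.swap y z =
      ((w ∘ Equiv.swap x y) ∘ Equiv.swap y z) ∘ Equiv.swap x y := by
    have := Equiv.swap_mul_swap_mul_swap h1 h3
    have h := Equiv.swap_mul_swap_mul_swap h2.symm h3.symm
    rw [Equiv.swap_comm z y, Equiv.swap_comm y x] at h
    rw [Equiv.swap_comm z x, ← h] at this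
    simp only [Function.comp_assoc, ← Equiv.Perm.coe_mul]
    rw [this]
  -- When letters coincide, some of the rearranged words coincide too. These implications record
  -- this before words and letters are replaced by variables.
  have c1 := comp_swap_of_eq w x y
  have c2 := comp_swap_of_eq w y z
  have c3 := comp_swap_of_eq (w ∘ Equiv.swap x y) y z
  have c4 := comp_swap_of_eq (w ∘ Equiv.swap y z) x y
  have c5 := comp_swap_of_eq ((w ∘ Equiv.swap x y) ∘ Equiv.swap y z) x y
  have c6 := comp_swap_of_eq ((w ∘ Equiv.swap y z) ∘ Equiv.swap x y) y z
  have s1 : Equiv.swap x y z = z := Equiv.swap_apply_of_ne_of_ne h3.symm h2.symm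
  have s2 : Equiv.swap y z x = x := Equiv.swap_apply_of_ne_of_ne h1 h3
  rw [i3] at c6
  simp only [Function.comp_apply, Equiv.swap_apply_left, Equiv.swap_apply_right, s1, s2] at c1 c2 c3 c4 c5 c6
  simp only [Module.End.mul_apply, wordOp_apply, i1, i2, i3, Function.comp_apply,
    Equiv.swap_apply_left, Equiv.swap_apply_right, s1, s2]
  clear i1 i2 i3
  generalize ((w ∘ Equiv.swap x y) ∘ Equiv.swap y z) ∘ Equiv.swap x y = w5 at *
  generalize (w ∘ Equiv.swap x y) ∘ Equiv.swap y z = w3 at *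
  generalize (w ∘ Equiv.swap y z) ∘ Equiv.swap x y = w4 at *
  generalize w ∘ Equiv.swap y z = w2 at *
  generalize w ∘ Equiv.swap x y = w1 at *
  generalize w x = a at *
  generalize w y = b at *
  generalize w z = c at *
  have tri : ∀ a b : A, (a < b ∧ ¬ b < a) ∨ (a = b) ∨ (b < a ∧ ¬ a < b) := fun a b => by
    rcases lt_trichotomy a b with h | h | h
    · exact Or.inl ⟨h, h.not_gt⟩
    · exact Or.inr (Or.inl h)
    · exact Or.inr (Or.inr ⟨h, h.not_gt⟩)
  rcases tri a b with ⟨h, h'⟩ | h | ⟨h, h'⟩ <;> rcases tri b c with ⟨k, k'⟩ | k | ⟨k, k'⟩ <;>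
    rcases tri a c with ⟨l, l'⟩ | l | ⟨l, l'⟩ <;> first | (exfalso; order) | skip
  all_goals try subst h
  all_goals try subst k
  all_goals try subst l
  all_goals
    simp only [*, if_true, if_false, lt_self_iff_false, forall_true_left] at *
    try ring

end Words

end

section

/-! ### Hecke modules of functions on words, and counts of ascents -/

section WordModules

variable {n : ℕ} {A : Type} [LinearOrder A]

/-- The predecessor in `Fin n`. -/
def prev (i : Fin n) : Fin n := ⟨i.val - 1, by omega⟩

theorem prev_val (i : Fin n) : (prev i).val = i.val - 1 := rfl

/-- The family of operators on functions of words with a given first operator. -/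
def wordFamily (q : ℂ) (T₀ : Module.End ℂ ((Fin n → A) → ℂ)) (i : Fin n) :
    Module.End ℂ ((Fin n → A) → ℂ) :=
  if i.val = 0 then T₀ else wordOp q A (prev i) i

/-- The relations of type `A` hold for words in any ordered alphabet, so only relations that involve
the first operator remain to be assumed. -/
theorem isHeckeFamily_wordFamily {r : ℕ} {u : Fin r → ℂ} {q : ℂ}
    {T₀ : Module.End ℂ ((Fin n → A) → ℂ)}
    (hcomm : ∀ x y : Fin n, 1 ≤ x.val → 1 ≤ y.val →
      T₀ * wordOp q A x y = wordOp q A x y * T₀)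
    (hfour : ∀ x y : Fin n, x.val = 0 → y.val = 1 →
      T₀ * wordOp q A x y * T₀ * wordOp q A x y = wordOp q A x y * T₀ * wordOp q A x y * T₀)
    (hcyc : Polynomial.aeval T₀ (∏ k : Fin r, (Polynomial.X - Polynomial.C (u k))) = 0) :
    IsHeckeFamily r n u q (wordFamily q T₀) where
  comm i j h := by
    have hj : j.val ≠ 0 := by omega
    simp only [wordFamily, hj, if_false]
    split_ifs with hi
    · exact hcomm _ _ (by rw [prev_val]; omega) (by omega)
    · have e1 := prev_val i
      have e2 := prev_val j
      apply wordOp_comm <;> intro e <;> have e := congrArg Fin.val e <;> omega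
  braid i j hi hj := by
    have hi' : i.val ≠ 0 := by omega
    have hj' : j.val ≠ 0 := by omega
    have e : prev j = i := Fin.ext (by rw [prev_val]; omega)
    have e1 := prev_val i
    simp only [wordFamily, hi', hj', if_false, e]
    apply wordOp_braid <;> intro e <;> have e := congrArg Fin.val e <;> omega
  braid_four i j hi hj := by
    have hj' : j.val ≠ 0 := by omega
    have e : prev j = i := Fin.ext (by rw [prev_val]; omega)
    simp only [wordFamily, hi, hj', if_false, if_true, e]
    exact hfour i j hi hj
  cyclotomic i hi := by
    simp only [wordFamily, hi, if_true]
    exact hcyc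
  quadratic i hi := by
    have hi' : i.val ≠ 0 := by omega
    simp only [wordFamily, hi', if_false]
    exact wordOp_quadratic q _ _

/-- The number of pairs of positions whose letters are in increasing order. -/
def coinv (w : Fin n → A) : ℕ :=
  (Finset.univ.filter fun x : Fin n × Fin n => x.1 < x.2 ∧ w x.1 < w x.2).card

/-- An exchange of adjacent positions preserves the order of all pairs of positions except the pair
`(x, y)`, and this pair is counted only before the exchange. -/
theorem coinv_swap (w : Fin n → A) {x y : Fin n} (hxy : y.val = x.val + 1) (h : w x < w y) :
    coinv w = coinv (w ∘ Equiv.swap x y) + 1 := by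
  have hne : x ≠ y := fun e => by rw [e] at hxy; omega
  have lt_iff : ∀ i j : Fin n, ¬(i = x ∧ j = y) → ¬(i = y ∧ j = x) →
      (Equiv.swap x y i < Equiv.swap x y j ↔ i < j) := by
    intro i j h1 h2
    simp only [Equiv.swap_apply_def, Fin.lt_def]
    simp only [Fin.ext_iff] at h1 h2 ⊢
    split_ifs <;> omega
  have key : (Finset.univ.filter fun z : Fin n × Fin n => z.1 < z.2 ∧ w z.1 < w z.2) =
      insert (x, y) ((Finset.univ.filter fun z : Fin n × Fin n =>
        z.1 < z.2 ∧ (w ∘ Equiv.swap x y) z.1 < (w ∘ Equiv.swap x y) z.2).map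
        (Equiv.prodCongr (Equiv.swap x y) (Equiv.swap x y)).toEmbedding) := by
    ext ⟨i, j⟩
    simp only [Finset.mem_filter, Finset.mem_univ, true_and, Finset.mem_insert, Finset.mem_map_equiv,
      Equiv.prodCongr_symm, Equiv.symm_swap, Equiv.prodCongr_apply, Prod.map, Function.comp_apply,
      Equiv.swap_apply_self, Prod.mk.injEq]
    by_cases h1 : i = x ∧ j = y
    · obtain ⟨rfl, rfl⟩ := h1
      simp only [h, and_true, and_self, true_or, iff_true, Fin.lt_def]
      omega
    · by_cases h2 : i = y ∧ j = x
      · obtain ⟨rfl, rfl⟩ := h2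
        simp [h.not_gt, hne.symm]
      · rw [lt_iff i j h1 h2]
        simp [h1]
  rw [coinv, key, Finset.card_insert_of_notMem, Finset.card_map]
  · rfl
  · simp only [Finset.mem_map_equiv, Equiv.prodCongr_symm, Equiv.symm_swap, Equiv.prodCongr_apply,
      Prod.map, Equiv.swap_apply_left, Equiv.swap_apply_right, Finset.mem_filter, Fin.lt_def]
    omega

theorem coinv_cons (a : A) (w : Fin n → A) :
    coinv (Fin.cons a w : Fin (n + 1) → A) =
      (Finset.univ.filter fun i => a < w i).card + coinv w := by
  simp only [coinv, Finset.card_filter, Fintype.sum_prod_type, Fin.sum_univ_succ, Fin.cons_zero,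
    Fin.cons_succ, false_and, if_false, zero_add, Fin.succ_pos, true_and,
    Fin.not_lt_zero, Fin.succ_lt_succ_iff]

end WordModules

/-- Invariance under the exchange of adjacent letters implies invariance under permutations. -/
theorem apply_comp_perm {n : ℕ} {A B : Type*} (y : (Fin n → A) → B)
    (h : ∀ i : Fin n, 1 ≤ i.val → ∀ w, y (w ∘ Equiv.swap (prev i) i) = y w)
    (w : Fin n → A) (σ : Equiv.Perm (Fin n)) : y (w ∘ σ) = y w := by
  cases n with
  | zero => rw [Subsingleton.elim σ 1]; rfl
  | succ n =>
    have hσ : σ ∈ Submonoid.closure (Set.range fun i : Fin n => Equiv.swap i.castSucc i.succ) := by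
      rw [Equiv.Perm.mclosure_swap_castSucc_succ]; trivial
    induction hσ using Submonoid.closure_induction generalizing w with
    | mem x hx =>
      obtain ⟨i, rfl⟩ := hx
      have := h i.succ (by simp) w
      have e : prev i.succ = i.castSucc := Fin.ext (by simp [prev_val])
      rwa [e] at this
    | one => rfl
    | mul a b _ _ ha hb =>
      have : w ∘ ⇑(a * b) = (w ∘ a) ∘ b := rfl
      rw [this, hb, ha]

section WordModules

variable {n : ℕ} {A : Type} [LinearOrder A]

theorem apply_comp_swap_of_wordOp {q : ℂ} (hq : q ≠ 0) {x y : Fin n} {F : (Fin n → A) → ℂ}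
    (h : wordOp q A x y F = F) (w : Fin n → A) : F (w ∘ Equiv.swap x y) = F w := by
  have := congrFun h w
  rw [wordOp_apply] at this
  split_ifs at this
  · apply mul_left_cancel₀ hq
    linear_combination this
  · exact this

/-- A functional given by weights that are multiplied by `q` when an ascent is created is invariant
under the operators `wordOp`. -/
theorem sum_mul_wordOp [Fintype A] {q : ℂ} (Y : (Fin n → A) → ℂ) {x y : Fin n}
    (hY : ∀ w : Fin n → A, w x < w y → Y w = q * Y (w ∘ Equiv.swap x y)) (F : (Fin n → A) → ℂ) :
    ∑ w, Y w * wordOp q A x y F w = ∑ w, Y w * F w := by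
  classical
  have e : ∀ v : Fin n → A, (v ∘ Equiv.swap x y) ∘ Equiv.swap x y = v := fun v => by
    rw [Function.comp_assoc]; ext z; simp
  have h1 : ∀ w, Y w * wordOp q A x y F w = (if w y < w x then (1 - q) * Y w * F w else 0) +
      (if w y < w x then q * Y w else Y w) * F (w ∘ Equiv.swap x y) := by
    intro w
    rw [wordOp_apply]
    split_ifs <;> ring
  simp_rw [h1, Finset.sum_add_distrib]
  -- The substitution `w ↦ w ∘ Equiv.swap x y` moves the exchange from `F` to the weights; what
  -- remains is an identity for each word.
  have h2 := Equiv.sum_comp (Equiv.arrowCongr (Equiv.swap x y) (Equiv.refl A))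
    (fun w => (if w y < w x then q * Y w else Y w) * F (w ∘ Equiv.swap x y))
  rw [← h2, ← Finset.sum_add_distrib]
  refine Finset.sum_congr rfl fun w _ => ?_
  have h3 : (Equiv.arrowCongr (Equiv.swap x y) (Equiv.refl A)) w = w ∘ Equiv.swap x y := by
    ext z; simp [Equiv.arrowCongr]
  rw [h3, e]
  simp only [Function.comp_apply, Equiv.swap_apply_left, Equiv.swap_apply_right]
  rcases lt_trichotomy (w x) (w y) with h | h | h
  · rw [if_neg h.not_gt, if_pos h, zero_add, hY w h]
  · rw [comp_swap_of_eq w x y h]; simp [h]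
  · have := hY (w ∘ Equiv.swap x y) (by simpa using h)
    rw [e] at this
    rw [if_pos h, if_neg h.not_gt, this]
    ring

end WordModules

end

section

/-! ### Nonvanishing of the quantum factorial -/

section TypeA

open Classical in
/-- The Poincaré polynomial of the symmetric group. -/
theorem sum_pow_coinv (q : ℂ) (n : ℕ) :
    ∑ w : Fin n → Fin n, (if Function.Injective w then q ^ coinv w else 0) =
      ∏ m ∈ Finset.range n, ∑ i ∈ Finset.range (m + 1), q ^ i := by
  induction n with
  | zero =>
    rw [Fintype.sum_unique]
    simp [Function.injective_of_subsingleton, coinv]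
  | succ n ih =>
    rw [← (Fin.consEquiv fun _ => Fin (n + 1)).sum_comp, Fintype.sum_prod_type,
      Finset.prod_range_succ, ← ih]
    -- Without its first letter `p`, a permutation is a word in the other letters, renumbered by
    -- `p.succAbove`; exactly `n - p` of them exceed `p`.
    have key : ∀ p : Fin (n + 1), ∑ w : Fin n → Fin (n + 1),
        (if Function.Injective (Fin.cons p w : Fin (n + 1) → Fin (n + 1)) then
          q ^ coinv (Fin.cons p w : Fin (n + 1) → Fin (n + 1)) else 0) =
        q ^ (n - p.val) * ∑ v : Fin n → Fin n, (if Function.Injective v then q ^ coinv v else 0) := by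
      intro p
      rw [Finset.mul_sum]
      symm
      refine Finset.sum_of_injOn (fun v => p.succAbove ∘ v) ?_ (by simp) ?_ ?_
      · intro v _ v' _ h
        funext i
        exact Fin.succAbove_right_injective (congrFun h i)
      · intro w _ hw
        rw [if_neg]
        intro hinj
        apply hw
        have : ∀ i, ∃ j, p.succAbove j = w i := fun i => by
          apply Fin.exists_succAbove_eq
          intro e
          have := @hinj i.succ 0 (by simpa using e)
          exact Fin.succ_ne_zero _ this
        choose v hv using this
        exact ⟨v, by simp, funext hv⟩
      · intro v _
        have hinj : Function.Injective (Fin.cons p (p.succAbove ∘ v) : Fin (n + 1) → Fin (n + 1)) ↔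
            Function.Injective v := by
          rw [Fin.cons_injective_iff]
          constructor
          · exact fun h => h.2.of_comp
          · intro h
            refine ⟨?_, Fin.succAbove_right_injective.comp h⟩
            rintro ⟨i, hi⟩
            exact Fin.succAbove_ne _ _ hi
        simp only [hinj]
        split_ifs with h
        · rw [coinv_cons, pow_add]
          congr 2
          · have hb : Function.Bijective v := Finite.injective_iff_bijective.1 h
            rw [Finset.card_filter]
            simp only [Function.comp_apply, Fin.lt_succAbove_iff_le_castSucc]
            have e1 : ∑ i, (if p ≤ (v i).castSucc then 1 else 0) =
                ∑ j : Fin n, (if p ≤ j.castSucc then 1 else 0) :=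
              (Equiv.ofBijective v hb).sum_comp (fun j => if p ≤ j.castSucc then 1 else 0)
            have e2 : ∀ j : Fin n, p ≤ j.castSucc ↔ p.val ≤ j.val := fun j => Iff.rfl
            simp only [e2] at e1 ⊢
            rw [e1, Fin.sum_univ_eq_sum_range (fun j => if p.val ≤ j then 1 else 0) n,
              ← Finset.card_filter, ← Nat.card_Ico]
            congr 1
            ext; simp [and_comm]
          · simp [coinv, Fin.succAbove_lt_succAbove_iff]
        · simp
    refine (Finset.sum_congr rfl fun p _ => key p).trans ?_
    rw [← Finset.sum_mul, mul_comm]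
    congr 1
    rw [Fin.sum_univ_eq_sum_range (fun j => q ^ (n - j)) (n + 1),
      ← Finset.sum_range_reflect]
    refine Finset.sum_congr rfl fun j hj => ?_
    rw [Finset.mem_range] at hj
    congr 1
    omega

/-- If the Hecke algebra is semisimple, the quantum factorial of `n` does not vanish. -/
theorem qFactorial_ne_zero {r n : ℕ} {u : Fin r → ℂ} {q : ℂ} (hq : q ≠ 0) (k : Fin r)
    (hss : IsSemisimpleRing (HeckeAlg r n u q)) :
    ∏ m ∈ Finset.range n, ∑ i ∈ Finset.range (m + 1), q ^ i ≠ 0 := by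
  classical
  -- The first generator acts by the scalar `u k`, the others on words in `n` letters. The weights
  -- `Y` give a functional on which the latter have eigenvalue `1`.
  set Y : (Fin n → Fin n) → ℂ := fun w => if Function.Injective w then q ^ coinv w else 0 with hY
  have hX : IsHeckeFamily r n u q
      (wordFamily q (u k • (1 : Module.End ℂ ((Fin n → Fin n) → ℂ)))) := by
    apply isHeckeFamily_wordFamily
    · intro x y _ _
      simp
    · intro x y _ _
      simp
    · rw [← Finset.mul_prod_erase _ _ (Finset.mem_univ k), map_mul]
      simp [Algebra.algebraMap_eq_smul_one]
  let f : ((Fin n → Fin n) → ℂ) →ₗ[ℂ] ℂ := ∑ w, Y w • LinearMap.proj w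
  have hf : ∀ F, f F = ∑ w, Y w * F w := fun F => by simp [f]
  have hYs : ∀ x y : Fin n, y.val = x.val + 1 → ∀ w : Fin n → Fin n, w x < w y →
      Y w = q * Y (w ∘ Equiv.swap x y) := by
    intro x y hxy w h
    have : Function.Injective (w ∘ Equiv.swap x y) ↔ Function.Injective w :=
      (Equiv.swap x y).injective_comp _
    simp only [hY, this]
    split_ifs
    · rw [coinv_swap w hxy h, pow_succ']
    · simp
  obtain ⟨y, hy0, hy⟩ := exists_eigenvector_of_functional hX.rep
    (fun i => if i.val = 0 then u k else 1) f (by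
      intro i F
      rw [hX.rep_gen, wordFamily]
      split_ifs with hi
      · simp
      · rw [hf, hf, one_mul]
        exact sum_mul_wordOp Y (hYs _ _ (by rw [prev_val]; omega)) F) (by
      refine ⟨Pi.single id 1, ?_⟩
      rw [hf, Finset.sum_eq_single id]
      · simp [hY, Function.injective_id, hq]
      · intro b _ hb
        simp [hb]
      · simp)
  have hsym : ∀ (w : Fin n → Fin n) (σ : Equiv.Perm (Fin n)), y (w ∘ σ) = y w := by
    refine apply_comp_perm y fun i hi w => apply_comp_swap_of_wordOp hq ?_ w
    have := hy i
    rwa [hX.rep_gen, wordFamily, if_neg (by omega), if_neg (by omega), one_smul] at this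
  intro h0
  apply hy0
  -- Injective words are the rearrangements of `id`, so the nonzero number `f y` is the Poincaré
  -- polynomial times `y id`.
  have : ∀ w, Y w * y w = Y w * y id := by
    intro w
    by_cases hw : Function.Injective w
    · congr 1
      exact hsym id (Equiv.ofBijective w (Finite.injective_iff_bijective.1 hw))
    · simp [hY, hw]
  rw [hf, Finset.sum_congr rfl fun w _ => this w, ← Finset.sum_mul, sum_pow_coinv, h0, zero_mul]

end TypeA

end

section

/-! ### Nonvanishing of the differences between a parameter and small `q`-multiples of another -/

section TypeB

variable {n : ℕ}

/-- The action of the first generator of the Hecke algebra of type `B` with parameters `a, b` on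
functions of words in two letters: it changes the letter in the position `z`. -/
def flipOp (a b : ℂ) (z : Fin n) : Module.End ℂ ((Fin n → Bool) → ℂ) where
  toFun F w := if w z then F (Function.update w z false) else
    (a + b) * F (Function.update w z false) - a * b * F (Function.update w z true)
  map_add' F G := by
    funext w
    simp only [Pi.add_apply]
    split_ifs <;> ring
  map_smul' c F := by
    funext w
    simp only [Pi.smul_apply, smul_eq_mul, RingHom.id_apply]
    split_ifs <;> ring

theorem flipOp_apply (a b : ℂ) (z : Fin n) (F : (Fin n → Bool) → ℂ) (w : Fin n → Bool) :
    flipOp a b z F w = if w z then F (Function.update w z false) else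
      (a + b) * F (Function.update w z false) - a * b * F (Function.update w z true) := rfl

theorem flipOp_quadratic (a b : ℂ) (z : Fin n) :
    flipOp a b z * flipOp a b z = (a + b) • flipOp a b z - (a * b) • 1 := by
  refine LinearMap.ext fun F => funext fun w => ?_
  simp only [Module.End.mul_apply, flipOp_apply, LinearMap.sub_apply, LinearMap.smul_apply,
    Pi.sub_apply, Pi.smul_apply, smul_eq_mul, Module.End.one_apply, Function.update_self,
    Function.update_idem]
  rcases h : w z with _ | _
  · have : Function.update w z false = w := by rw [← h, Function.update_eq_self]
    simp [this]
  · have : Function.update w z true = w := by rw [← h, Function.update_eq_self]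
    simp [this]

theorem flipOp_wordOp_comm (a b q : ℂ) {x y z : Fin n} (hx : x ≠ z) (hy : y ≠ z) :
    flipOp a b z * wordOp q Bool x y = wordOp q Bool x y * flipOp a b z := by
  refine LinearMap.ext fun F => funext fun w => ?_
  have hz : Equiv.swap x y z = z := Equiv.swap_apply_of_ne_of_ne hx.symm hy.symm
  have e : ∀ c, Function.update w z c ∘ Equiv.swap x y =
      Function.update (w ∘ Equiv.swap x y) z c := by
    intro c
    funext t
    simp only [Function.comp_apply, Function.update_apply, Equiv.swap_apply_eq_iff, hz]
  simp only [Module.End.mul_apply, flipOp_apply, wordOp_apply, e, Function.comp_apply, hz,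
    Function.update_of_ne hx, Function.update_of_ne hy]
  split_ifs <;> ring

/-- All other letters stay fixed, so this is an identity on the four words obtained by varying the
letters at `x` and `y`. -/
theorem flipOp_wordOp_braid (a b q : ℂ) {x y : Fin n} (h : x ≠ y) :
    flipOp a b x * wordOp q Bool x y * flipOp a b x * wordOp q Bool x y =
      wordOp q Bool x y * flipOp a b x * wordOp q Bool x y * flipOp a b x := by
  refine LinearMap.ext fun F => funext fun w => ?_
  let v : Bool → Bool → Fin n → Bool := fun c e => Function.update (Function.update w x c) y e
  have hw : w = v (w x) (w y) := by simp [v]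
  have hx : ∀ c e, v c e x = c := fun c e => by simp [v, h]
  have hy : ∀ c e, v c e y = e := fun c e => by simp [v]
  have hu : ∀ c e k, Function.update (v c e) x k = v k e := fun c e k => by
    simp only [v]
    rw [Function.update_comm h.symm, Function.update_idem]
  have hs : ∀ c e, v c e ∘ Equiv.swap x y = v e c := fun c e => by
    funext t
    rcases eq_or_ne t x with rfl | ht
    · simp [v, h]
    rcases eq_or_ne t y with rfl | ht'
    · simp [v, h]
    simp [v, Equiv.swap_apply_of_ne_of_ne ht ht', ht, ht']
  rw [hw]
  simp only [Module.End.mul_apply, flipOp_apply, wordOp_apply, hx, hy, hu, hs]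
  rcases w x with _ | _ <;> rcases w y with _ | _ <;>
    simp [show ¬(true < false) by decide] <;> ring

/-- The weights of the functional on words in two letters. -/
def signWeight (q b : ℂ) : ∀ {n : ℕ}, (Fin n → Bool) → ℂ
  | 0, _ => 1
  | _ + 1, w => (if w 0 then -b else 1) *
      q ^ (Finset.univ.filter fun i => Fin.tail w i = true).card * signWeight q b (Fin.tail w)

/-- Each letter contributes a factor `q` for every later `true`: pairs of two `true` give the
binomial coefficient, pairs `false`, `true` give `coinv`. The closed form shows how the weight
changes under exchanges and under rescaling of `b`. -/
theorem signWeight_eq (q b : ℂ) (w : Fin n → Bool) :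
    signWeight q b w = (-b) ^ (Finset.univ.filter fun i => w i = true).card *
      q ^ ((Finset.univ.filter fun i => w i = true).card.choose 2 + coinv w) := by
  induction n with
  | zero => simp [signWeight, coinv]
  | succ n ih =>
    rw [signWeight, ih]
    obtain ⟨c, v, rfl⟩ : ∃ c v, w = Fin.cons c v := ⟨w 0, Fin.tail w, (Fin.cons_self_tail w).symm⟩
    simp only [Fin.cons_zero, Fin.tail_cons, coinv_cons]
    have : (Finset.univ.filter fun i => (Fin.cons c v : Fin (n + 1) → Bool) i = true).card =
        (if c then 1 else 0) + (Finset.univ.filter fun i => v i = true).card := by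
      simp only [Finset.card_filter, Fin.sum_univ_succ, Fin.cons_zero, Fin.cons_succ]
    rw [this]
    have hf : ∀ e : Bool, false < e ↔ e = true := by decide
    have ht : ∀ e : Bool, ¬(true < e) := by decide
    cases c
    · simp only [Bool.false_eq_true, if_false, zero_add, one_mul, hf]
      ring
    · simp only [if_true, ht]
      rw [Nat.add_comm 1, Nat.choose_succ_succ' _ 1, Nat.choose_one_right, pow_succ]
      simp
      ring

theorem sum_cons_bool (g : (Fin (n + 1) → Bool) → ℂ) :
    ∑ w, g w = ∑ v : Fin n → Bool, (g (Fin.cons true v) + g (Fin.cons false v)) := by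
  rw [← (Fin.consEquiv fun _ => Bool).sum_comp, Fintype.sum_prod_type, Fintype.sum_bool,
    ← Finset.sum_add_distrib]
  rfl

/-- A form of the `q`-binomial theorem. When the first letter is split off, its factor `q` for every
later `true` is absorbed by replacing `b` with `q * b`; hence the induction over all `b`. -/
theorem sum_signWeight (q a b : ℂ) (n : ℕ) :
    ∑ w : Fin n → Bool, signWeight q b w * a ^ (Finset.univ.filter fun i => w i = false).card =
      ∏ i ∈ Finset.range n, (a - q ^ i * b) := by
  induction n generalizing b with
  | zero => simp [signWeight]
  | succ n ih =>
    have hw : ∀ (b : ℂ) (n : ℕ) (v : Fin n → Bool),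
        q ^ (Finset.univ.filter fun i => v i = true).card * signWeight q b v =
          signWeight q (q * b) v := by
      intro b n v
      rw [signWeight_eq, signWeight_eq, neg_mul_eq_mul_neg, mul_pow]
      ring
    rw [sum_cons_bool, Finset.prod_range_succ']
    have h1 : ∀ (c : Bool) (v : Fin n → Bool),
        signWeight q b (Fin.cons c v : Fin (n + 1) → Bool) *
          a ^ (Finset.univ.filter fun i => (Fin.cons c v : Fin (n + 1) → Bool) i = false).card =
        (if c then -b else a) * (signWeight q (q * b) v *
          a ^ (Finset.univ.filter fun i => v i = false).card) := by
      intro c v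
      have : (Finset.univ.filter fun i => (Fin.cons c v : Fin (n + 1) → Bool) i = false).card =
        (if c then 0 else 1) + (Finset.univ.filter fun i => v i = false).card := by
        simp only [Finset.card_filter, Fin.sum_univ_succ, Fin.cons_zero, Fin.cons_succ]
        cases c <;> simp
      rw [signWeight, this, ← hw]
      simp only [Fin.cons_zero, Fin.tail_cons]
      cases c
      · simp; ring
      · simp; ring
    rw [Finset.sum_congr rfl fun v _ => by rw [h1 true v, h1 false v, ← add_mul],
      ← Finset.mul_sum, ih]
    simp only [pow_succ, mul_assoc, pow_zero, one_mul, if_true, Bool.false_eq_true, if_false]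
    ring

theorem signWeight_swap (q b : ℂ) {x y : Fin n} (hxy : y.val = x.val + 1) (w : Fin n → Bool)
    (h : w x < w y) : signWeight q b w = q * signWeight q b (w ∘ Equiv.swap x y) := by
  have hc : (Finset.univ.filter fun i => (w ∘ Equiv.swap x y) i = true).card =
      (Finset.univ.filter fun i => w i = true).card := by
    rw [Finset.card_filter, Finset.card_filter]
    exact Equiv.sum_comp (Equiv.swap x y) (fun i => if w i = true then 1 else 0)
  rw [signWeight_eq, signWeight_eq, hc, coinv_swap w hxy h]
  ring

/-- Any `false` can be moved to the position `z` by symmetry, and there it is turned into `true` at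
the cost of a factor `a`. -/
theorem apply_eq_pow_mul {a : ℂ} {z : Fin n} {y : (Fin n → Bool) → ℂ}
    (hs : ∀ (w : Fin n → Bool) (σ : Equiv.Perm (Fin n)), y (w ∘ σ) = y w)
    (hz : ∀ w : Fin n → Bool, w z = false → y w = a * y (Function.update w z true))
    (w : Fin n → Bool) :
    y w = a ^ (Finset.univ.filter fun i => w i = false).card * y fun _ => true := by
  generalize hm : (Finset.univ.filter fun i => w i = false).card = m
  induction m generalizing w with
  | zero =>
    rw [Finset.card_eq_zero, Finset.filter_eq_empty_iff] at hm
    have : w = fun _ => true := funext fun i => by simpa using hm (Finset.mem_univ i)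
    rw [this, pow_zero, one_mul]
  | succ m ih =>
    obtain ⟨i, hi⟩ : (Finset.univ.filter fun i => w i = false).Nonempty := by
      rw [← Finset.card_pos, hm]; omega
    have hi' : w i = false := by simpa using hi
    have e : Function.update (w ∘ Equiv.swap z i) z true =
        Function.update w i true ∘ Equiv.swap z i := by
      funext t
      simp only [Function.comp_apply, Function.update_apply, Equiv.swap_apply_eq_iff,
        Equiv.swap_apply_right]
    rw [← hs w (Equiv.swap z i), hz _ (by simp [hi']), e, hs, ih, pow_succ']
    · ring
    · have : (Finset.univ.filter fun j => Function.update w i true j = false) =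
          (Finset.univ.filter fun j => w j = false).erase i := by
        ext j
        rcases eq_or_ne j i with rfl | hj
        · simp
        · simp [hj]
      rw [this, Finset.card_erase_of_mem hi, hm]
      rfl

/-- If the Hecke algebra is semisimple, two parameters cannot differ by a small power of `q`. -/
theorem prod_sub_pow_mul_ne_zero {r n : ℕ} {u : Fin r → ℂ} {q : ℂ} (hq : q ≠ 0) {k l : Fin r}
    (hkl : k ≠ l) (hss : IsSemisimpleRing (HeckeAlg r n u q)) :
    ∏ i ∈ Finset.range n, (u k - q ^ i * u l) ≠ 0 := by
  classical
  rcases Nat.eq_zero_or_pos n with rfl | hn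
  · simp
  let z : Fin n := ⟨0, hn⟩
  have hz : ∀ x : Fin n, x.val = 0 → x = z := fun x h => Fin.ext h
  have hX : IsHeckeFamily r n u q (wordFamily q (flipOp (u k) (u l) z)) := by
    apply isHeckeFamily_wordFamily
    · intro x y hx hy
      apply flipOp_wordOp_comm <;> intro e <;> have e := congrArg Fin.val e <;> simp only [z] at e <;> omega
    · intro x y hx hy
      obtain rfl := hz x hx
      apply flipOp_wordOp_braid
      intro e
      rw [← e] at hy
      omega
    · rw [← Finset.mul_prod_erase _ _ (Finset.mem_univ k),
        ← Finset.mul_prod_erase _ _ (Finset.mem_erase.2 ⟨hkl.symm, Finset.mem_univ l⟩),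
        ← mul_assoc, map_mul, map_mul, map_sub, map_sub, Polynomial.aeval_X, Polynomial.aeval_C,
        Polynomial.aeval_C, Algebra.algebraMap_eq_smul_one, Algebra.algebraMap_eq_smul_one]
      have : (flipOp (u k) (u l) z - u k • 1) * (flipOp (u k) (u l) z - u l • 1) = 0 := by
        rw [sub_mul, mul_sub, flipOp_quadratic, mul_smul_comm, smul_mul_assoc, mul_one, one_mul]
        module
      rw [this, zero_mul]
  -- In the first position the weights are `1` and `-u l` up to factors that do not depend on the
  -- first letter. This makes the functional an eigenvector of the flip for the other root `u k`.
  let f : ((Fin n → Bool) → ℂ) →ₗ[ℂ] ℂ := ∑ w, signWeight q (u l) w • LinearMap.proj w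
  have hf : ∀ F, f F = ∑ w, signWeight q (u l) w * F w := fun F => by simp [f]
  have hflip : ∀ F, f (flipOp (u k) (u l) z F) = u k * f F := by
    intro F
    obtain ⟨m, rfl⟩ : ∃ m, n = m + 1 := ⟨n - 1, by omega⟩
    have hz0 : z = 0 := rfl
    rw [hf, hf, sum_cons_bool, sum_cons_bool, Finset.mul_sum]
    refine Finset.sum_congr rfl fun v _ => ?_
    simp only [signWeight, flipOp_apply, hz0, Fin.cons_zero, Fin.tail_cons,
      Fin.update_cons_zero, if_true, Bool.false_eq_true, if_false]
    ring
  obtain ⟨y, hy0, hy⟩ := exists_eigenvector_of_functional hX.rep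
    (fun i => if i.val = 0 then u k else 1) f (by
      intro i F
      rw [hX.rep_gen, wordFamily]
      split_ifs with hi
      · exact hflip F
      · rw [hf, hf, one_mul]
        exact sum_mul_wordOp _ (signWeight_swap q _ (by rw [prev_val]; omega)) F) (by
      refine ⟨Pi.single (fun _ => false) 1, ?_⟩
      rw [hf, Finset.sum_eq_single (fun _ => false)]
      · simp [signWeight_eq, hq]
      · intro b _ hb
        simp [hb]
      · simp)
  have hsym : ∀ (w : Fin n → Bool) (σ : Equiv.Perm (Fin n)), y (w ∘ σ) = y w := by
    refine apply_comp_perm y fun i hi w => apply_comp_swap_of_wordOp hq ?_ w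
    have := hy i
    rwa [hX.rep_gen, wordFamily, if_neg (by omega), if_neg (by omega), one_smul] at this
  have hyz : ∀ w : Fin n → Bool, w z = false → y w = u k * y (Function.update w z true) := by
    intro w hw
    have h1 := hy z
    rw [hX.rep_gen, wordFamily, if_pos rfl, if_pos rfl] at h1
    have h2 := congrFun h1 (Function.update w z true)
    simp only [flipOp_apply, Function.update_self, if_true, Function.update_idem, Pi.smul_apply,
      smul_eq_mul] at h2
    rwa [← hw, Function.update_eq_self] at h2
  -- The eigenvector is determined by its value at the constant word `true`, and the `q`-binomial
  -- sum identifies `f y` with the product times this value.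
  intro h0
  apply hy0
  rw [hf, Finset.sum_congr rfl fun w _ => by rw [apply_eq_pow_mul hsym hyz w, ← mul_assoc],
    ← Finset.sum_mul, sum_signWeight, h0, zero_mul]

end TypeB

end

section

/-! ### Quantum integers and seminormal coefficients -/

section QInt

variable {q : ℂ}

theorem qInt_one : qInt q 1 = 1 := by
  rw [qInt]
  split_ifs with h
  · simp
  · rw [zpow_one, div_self (sub_ne_zero.2 (Ne.symm h))]

theorem one_sub_mul_qInt (m : ℤ) : (1 - q) * qInt q m = 1 - q ^ m := by
  rw [qInt]
  split_ifs with h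
  · simp [h]
  · rw [mul_div_cancel₀ _ (sub_ne_zero.2 (Ne.symm h))]

theorem qInt_add (hq : q ≠ 0) (k l : ℤ) :
    qInt q (k + l) = qInt q k + qInt q l - (1 - q) * qInt q k * qInt q l := by
  rw [one_sub_mul_qInt]
  by_cases h : q = 1
  · simp [qInt, h]
  · have h' := sub_ne_zero.2 (Ne.symm h)
    simp only [qInt, if_neg h]
    rw [zpow_add₀ hq]
    field_simp
    ring

theorem qInt_add_one (hq : q ≠ 0) (m : ℤ) : qInt q (m + 1) = 1 + q * qInt q m := by
  rw [qInt_add hq, qInt_one]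
  ring

theorem qInt_neg (hq : q ≠ 0) (m : ℤ) : qInt q (-m) = -q ^ (-m) * qInt q m := by
  by_cases h : q = 1
  · simp [qInt, h]
  · simp only [qInt, if_neg h]
    have : q ^ m ≠ 0 := zpow_ne_zero _ hq
    rw [zpow_neg]
    field_simp
    ring

theorem qInt_natCast (m : ℕ) : qInt q m = ∑ i ∈ Finset.range m, q ^ i := by
  rw [qInt]
  split_ifs with h
  · simp [h]
  · rw [geom_sum_eq h, zpow_natCast, ← neg_sub, ← neg_sub q 1, neg_div_neg_eq]

end QInt

variable {p d n : ℕ}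

/-- The parameter of a component. -/
def Params.weight (P : Params p d) (κ : ZMod p × Fin d) : ℂ := P.ξ ^ κ.1.val * P.v κ.2

/-- The content of a cell. -/
def cont (c : (ZMod p × Fin d) × (ℕ × ℕ)) : ℤ := (c.2.2 : ℤ) - (c.2.1 : ℤ)

/-- The residue of a cell. -/
def Params.res (P : Params p d) (c : (ZMod p × Fin d) × (ℕ × ℕ)) : ℂ :=
  P.weight c.1 * P.q ^ (-cont c)

/-- The seminormal coefficient as a function of the cells. -/
def Params.coeff (P : Params p d) (c c' : (ZMod p × Fin d) × (ℕ × ℕ)) : ℂ :=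
  if c.1 = c'.1 then 1 / qInt P.q (cont c' - cont c)
  else (1 - P.q) * P.res c' / (P.res c' - P.res c)

/-- The off-diagonal seminormal coefficient, set to `0` where cells cannot be exchanged. -/
def Params.offCoeff (P : Params p d) (c c' : (ZMod p × Fin d) × (ℕ × ℕ)) : ℂ :=
  open Classical in
  if P.coeff c c' = 1 ∨ P.coeff c c' = -P.q then 0 else 1 - P.coeff c c'

/-- The denominator of the seminormal coefficient does not vanish. -/
def Params.Good (P : Params p d) (c c' : (ZMod p × Fin d) × (ℕ × ℕ)) : Prop :=
  (c.1 = c'.1 → qInt P.q (cont c' - cont c) ≠ 0) ∧ (c.1 ≠ c'.1 → P.res c' - P.res c ≠ 0)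

theorem Params.Good.symm {P : Params p d} {c c' : (ZMod p × Fin d) × (ℕ × ℕ)} (h : P.Good c c') :
    P.Good c' c := by
  refine ⟨fun e => ?_, fun e => ?_⟩
  · rw [← neg_sub, qInt_neg P.q_ne_zero]
    exact mul_ne_zero (neg_ne_zero.2 (zpow_ne_zero _ P.q_ne_zero)) (h.1 e.symm)
  · rw [← neg_sub]
    exact neg_ne_zero.2 (h.2 (Ne.symm e))

/-- The sum is the trace of the block of `T_i` on two tableaux exchanged by `s_i`, whose eigenvalues
have to be `1` and `-q`. -/
theorem Params.coeff_add {P : Params p d} {c c' : (ZMod p × Fin d) × (ℕ × ℕ)} (h : P.Good c c') :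
    P.coeff c c' + P.coeff c' c = 1 - P.q := by
  have h' := h.symm
  simp only [coeff, eq_comm (a := c'.1)]
  split_ifs with e
  · have h1 := h.1 e
    have h2 := h'.1 e.symm
    have h3 : P.q ^ (cont c' - cont c) ≠ 0 := zpow_ne_zero _ P.q_ne_zero
    have h4 := one_sub_mul_qInt (q := P.q) (cont c' - cont c)
    rw [← neg_sub (cont c'), qInt_neg P.q_ne_zero, zpow_neg]
    field_simp
    linear_combination -h4
  · have h1 := h.2 e
    have h2 := h'.2 (Ne.symm e)
    rw [div_add_div _ _ h1 h2, div_eq_iff (mul_ne_zero h1 h2)]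
    ring

/-- In one component the ratio of residues is a power of `q`. Written through the quantum integer,
it links the two forms of the coefficient without a division by `1 - q`, which may vanish. -/
theorem Params.res_eq (P : Params p d) {c c' : (ZMod p × Fin d) × (ℕ × ℕ)} (h : c.1 = c'.1) :
    P.res c = (1 - (1 - P.q) * qInt P.q (cont c' - cont c)) * P.res c' := by
  rw [one_sub_mul_qInt, sub_sub_cancel, res, res, h, mul_left_comm, ← zpow_add₀ P.q_ne_zero]
  congr 2
  ring

/-- For `q ≠ 1` and nonzero residues, `1 - (1 - q) / A` is the ratio of the two residues, which is
multiplicative along `x, y, z`; clearing denominators gives the identity. The cases by components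
also cover the degenerate parameters. This is the content of the braid relation. -/
theorem Params.coeff_mul {P : Params p d} {x y z : (ZMod p × Fin d) × (ℕ × ℕ)}
    (hxy : P.Good x y) (hyz : P.Good y z) (hxz : P.Good x z) :
    P.coeff x y * P.coeff y z = P.coeff x z * (P.coeff x y + P.coeff y z - (1 - P.q)) := by
  by_cases e1 : x.1 = y.1
  · have r1 := P.res_eq e1
    have g1 := hxy.1 e1
    by_cases e2 : y.1 = z.1
    · have e3 := e1.trans e2
      have g2 := hyz.1 e2
      have g3 := hxz.1 e3
      simp only [coeff, if_pos e1, if_pos e2, if_pos e3]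
      have h := qInt_add P.q_ne_zero (cont y - cont x) (cont z - cont y)
      rw [show (cont y - cont x) + (cont z - cont y) = cont z - cont x by ring] at h
      field_simp
      linear_combination h
    · have e3 : x.1 ≠ z.1 := fun h => e2 (e1.symm.trans h)
      have g2 := hyz.2 e2
      have g3 := hxz.2 e3
      simp only [coeff, if_pos e1, if_neg e2, if_neg e3]
      rw [div_mul_div_comm, div_add_div _ _ g1 g2, div_sub' (mul_ne_zero g1 g2), div_mul_div_comm,
        div_eq_div_iff (mul_ne_zero g1 g2) (mul_ne_zero g3 (mul_ne_zero g1 g2))]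
      rw [r1]
      ring
  · by_cases e2 : y.1 = z.1
    · have e3 : x.1 ≠ z.1 := fun h => e1 (h.trans e2.symm)
      have r2 := P.res_eq e2
      have g1 := hxy.2 e1
      have g2 := hyz.1 e2
      have g3 := hxz.2 e3
      simp only [coeff, if_neg e1, if_pos e2, if_neg e3]
      rw [div_mul_div_comm, div_add_div _ _ g1 g2, div_sub' (mul_ne_zero g1 g2), div_mul_div_comm,
        div_eq_div_iff (mul_ne_zero g1 g2) (mul_ne_zero g3 (mul_ne_zero g1 g2))]
      rw [r2]
      ring
    · have g1 := hxy.2 e1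
      have g2 := hyz.2 e2
      by_cases e3 : x.1 = z.1
      · have r3 := P.res_eq e3
        have g3 := hxz.1 e3
        simp only [coeff, if_neg e1, if_neg e2, if_pos e3]
        rw [div_mul_div_comm, div_add_div _ _ g1 g2, div_sub' (mul_ne_zero g1 g2), div_mul_div_comm,
          div_eq_div_iff (mul_ne_zero g1 g2) (mul_ne_zero g3 (mul_ne_zero g1 g2))]
        rw [r3]
        ring
      · have g3 := hxz.2 e3
        simp only [coeff, if_neg e1, if_neg e2, if_neg e3]
        rw [div_mul_div_comm, div_add_div _ _ g1 g2, div_sub' (mul_ne_zero g1 g2), div_mul_div_comm,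
          div_eq_div_iff (mul_ne_zero g1 g2) (mul_ne_zero g3 (mul_ne_zero g1 g2))]
        ring

/-- With `A' = 1 - q - A` the product `(1 - A) (1 - A')` vanishes exactly for `A = 1` and `A = -q`,
so the cut-off in `offCoeff` does not change it. -/
theorem Params.offCoeff_mul {P : Params p d} {c c' : (ZMod p × Fin d) × (ℕ × ℕ)}
    (h : P.Good c c') :
    P.offCoeff c c' * P.offCoeff c' c = (1 - P.coeff c c') * (1 - P.coeff c' c) := by
  have h1 := P.coeff_add h
  have h2 : P.coeff c' c = 1 - P.q - P.coeff c c' := by linear_combination h1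
  have e1 : P.coeff c' c = 1 ↔ P.coeff c c' = -P.q := by
    rw [h2]
    constructor <;> intro h <;> linear_combination -h
  have e2 : P.coeff c' c = -P.q ↔ P.coeff c c' = 1 := by
    rw [h2]
    constructor <;> intro h <;> linear_combination -h
  have h3 : P.coeff c' c = 1 ∨ P.coeff c' c = -P.q ↔ P.coeff c c' = 1 ∨ P.coeff c c' = -P.q := by
    rw [e1, e2, or_comm]
  rw [offCoeff, offCoeff]
  by_cases h4 : P.coeff c c' = 1 ∨ P.coeff c c' = -P.q
  · rw [if_pos h4, zero_mul]
    rcases h4 with h4 | h4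
    · rw [h4]; ring
    · rw [e1.2 h4]; ring
  · rw [if_neg h4, if_neg (mt h3.1 h4)]

end

section

/-! ### The seminormal operators on functions of words of cells -/

section SeminormalOp

variable {p d n : ℕ} (P : Params p d)

/-- The operator of exchange of the entries `x, y` on functions of words of cells. -/
def semOp (x y : Fin n) (F : (Fin n → (ZMod p × Fin d) × (ℕ × ℕ)) → ℂ)
    (w : Fin n → (ZMod p × Fin d) × (ℕ × ℕ)) : ℂ :=
  P.coeff (w x) (w y) * F w + P.offCoeff (w x) (w y) * F (w ∘ Equiv.swap x y)

/-- The operator that multiplies by the parameter of the cell of the entry `x`. -/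
def weightOp (x : Fin n) (F : (Fin n → (ZMod p × Fin d) × (ℕ × ℕ)) → ℂ)
    (w : Fin n → (ZMod p × Fin d) × (ℕ × ℕ)) : ℂ := P.weight (w x).1 * F w

variable {P}
variable (F : (Fin n → (ZMod p × Fin d) × (ℕ × ℕ)) → ℂ) (w : Fin n → (ZMod p × Fin d) × (ℕ × ℕ))

/-- Standardness plays no role for functions of arbitrary words: only the denominator at `w` has to
be nonzero, and the block at `w` has the right trace and determinant. -/
theorem semOp_quadratic {x y : Fin n} (h : P.Good (w x) (w y)) :
    semOp P x y (semOp P x y F) w = (1 - P.q) * semOp P x y F w + P.q * F w := by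
  have e : (w ∘ Equiv.swap x y) ∘ Equiv.swap x y = w := by
    rw [Function.comp_assoc]; ext z : 1; simp
  simp only [semOp, e, Function.comp_apply, Equiv.swap_apply_left, Equiv.swap_apply_right]
  have h1 := P.coeff_add h
  have h2 := P.offCoeff_mul h
  have h3 : P.coeff (w y) (w x) = 1 - P.q - P.coeff (w x) (w y) := by linear_combination h1
  rw [h3] at h2 ⊢
  linear_combination F w * h2

theorem semOp_comm {x y z t : Fin n} (h5 : x ≠ y) (h6 : z ≠ t) (h1 : x ≠ z) (h2 : x ≠ t)
    (h3 : y ≠ z) (h4 : y ≠ t) :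
    semOp P x y (semOp P z t F) w = semOp P z t (semOp P x y F) w := by
  have e : (w ∘ Equiv.swap x y) ∘ Equiv.swap z t = (w ∘ Equiv.swap z t) ∘ Equiv.swap x y := by
    rw [Function.comp_assoc, Function.comp_assoc]
    have : Equiv.swap x y * Equiv.swap z t = Equiv.swap z t * Equiv.swap x y :=
      (Equiv.Perm.disjoint_swap_swap (by simp_all)).commute
    rw [← Equiv.Perm.coe_mul, ← Equiv.Perm.coe_mul, this]
  simp only [semOp, e, Function.comp_apply,
    Equiv.swap_apply_of_ne_of_ne h1 h2, Equiv.swap_apply_of_ne_of_ne h3 h4,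
    Equiv.swap_apply_of_ne_of_ne h1.symm h3.symm, Equiv.swap_apply_of_ne_of_ne h2.symm h4.symm]
  ring

theorem weightOp_semOp_comm {x y z : Fin n} (hx : x ≠ z) (hy : y ≠ z) :
    weightOp P z (semOp P x y F) w = semOp P x y (weightOp P z F) w := by
  simp only [semOp, weightOp, Function.comp_apply, Equiv.swap_apply_of_ne_of_ne hx.symm hy.symm]
  ring

theorem semOp_braid {x y z : Fin n} (h1 : x ≠ y) (h2 : y ≠ z) (h3 : x ≠ z)
    (hxy : P.Good (w x) (w y)) (hyz : P.Good (w y) (w z)) (hxz : P.Good (w x) (w z)) :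
    semOp P x y (semOp P y z (semOp P x y F)) w = semOp P y z (semOp P x y (semOp P y z F)) w := by
  have i1 : ∀ v : Fin n → (ZMod p × Fin d) × (ℕ × ℕ),
      (v ∘ Equiv.swap x y) ∘ Equiv.swap x y = v := fun v => by
    rw [Function.comp_assoc]; ext z : 1; simp
  have i2 : ∀ v : Fin n → (ZMod p × Fin d) × (ℕ × ℕ),
      (v ∘ Equiv.swap y z) ∘ Equiv.swap y z = v := fun v => by
    rw [Function.comp_assoc]; ext z : 1; simp
  have i3 : ((w ∘ Equiv.swap y z) ∘ Equiv.swap x y) ∘ Equiv.swap y z =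
      ((w ∘ Equiv.swap x y) ∘ Equiv.swap y z) ∘ Equiv.swap x y := by
    have := Equiv.swap_mul_swap_mul_swap h1 h3
    have h := Equiv.swap_mul_swap_mul_swap h2.symm h3.symm
    rw [Equiv.swap_comm z y, Equiv.swap_comm y x] at h
    rw [Equiv.swap_comm z x, ← h] at this
    simp only [Function.comp_assoc, ← Equiv.Perm.coe_mul]
    rw [this]
  have s1 : Equiv.swap x y z = z := Equiv.swap_apply_of_ne_of_ne h3.symm h2.symm
  have s2 : Equiv.swap y z x = x := Equiv.swap_apply_of_ne_of_ne h1 h3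
  simp only [semOp, i1, i2, i3, Function.comp_apply, Equiv.swap_apply_left,
    Equiv.swap_apply_right, s1, s2]
  have m1 := P.offCoeff_mul hxy
  have m2 := P.offCoeff_mul hyz
  have t := P.coeff_mul hxy hyz hxz
  have a1 : P.coeff (w y) (w x) = 1 - P.q - P.coeff (w x) (w y) := by
    linear_combination P.coeff_add hxy
  have a2 : P.coeff (w z) (w y) = 1 - P.q - P.coeff (w y) (w z) := by
    linear_combination P.coeff_add hyz
  rw [a1] at m1
  rw [a2] at m2
  rw [a1, a2]
  -- The coefficients are compared word by word. Words reached by two or three exchanges have equal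
  -- coefficients on both sides; the identity `t` handles a single exchange, and `w` itself needs
  -- the determinants `m1`, `m2` as well.
  linear_combination F w * (P.coeff (w x) (w z) * m1 - P.coeff (w x) (w z) * m2 +
    (P.coeff (w x) (w y) - P.coeff (w y) (w z)) * t) +
    F (w ∘ Equiv.swap x y) * P.offCoeff (w x) (w y) * t -
    F (w ∘ Equiv.swap y z) * P.offCoeff (w y) (w z) * t

theorem semOp_braid_four {x y : Fin n} (hxy : P.Good (w x) (w y))
    (hc : (w x).1 ≠ (w y).1 → cont (w x) = 0 ∧ cont (w y) = 0) :
    weightOp P x (semOp P x y (weightOp P x (semOp P x y F))) w =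
      semOp P x y (weightOp P x (semOp P x y (weightOp P x F))) w := by
  have i1 : (w ∘ Equiv.swap x y) ∘ Equiv.swap x y = w := by
    rw [Function.comp_assoc]; ext z : 1; simp
  simp only [semOp, weightOp, i1, Function.comp_apply, Equiv.swap_apply_left,
    Equiv.swap_apply_right]
  -- In one component the first factor vanishes. In different components the contents are zero, so
  -- the residues are the weights and the two terms of the second factor cancel.
  have key : (P.weight (w x).1 - P.weight (w y).1) * (P.weight (w x).1 * P.coeff (w x) (w y) +
      P.weight (w y).1 * P.coeff (w y) (w x)) = 0 := by
    by_cases h : (w x).1 = (w y).1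
    · rw [h]; ring
    · obtain ⟨c1, c2⟩ := hc h
      have g1 := hxy.2 h
      have g2 := hxy.symm.2 (Ne.symm h)
      rw [Params.coeff, Params.coeff, if_neg h, if_neg (Ne.symm h)]
      simp only [Params.res, c1, c2, neg_zero, zpow_zero, mul_one] at *
      rw [mul_div_assoc', mul_div_assoc', div_add_div _ _ g1 g2, mul_div_assoc', div_eq_zero_iff]
      left
      ring
  linear_combination F (w ∘ Equiv.swap x y) * P.offCoeff (w x) (w y) * key

end SeminormalOp

end

section

/-! ### Combinatorics of standard tableaux -/

/-- The parts of the first column and first row up to these cells form a hook inside the diagram. -/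
theorem hook_le_card {μ : YoungDiagram} {i j : ℕ} (hi : (i, 0) ∈ μ) (hj : (0, j) ∈ μ) :
    i + j + 1 ≤ μ.card := by
  have h1 : ((Finset.range (i + 1)).image fun k => ((k, 0) : ℕ × ℕ)) ∪
      ((Finset.Icc 1 j).image fun k => ((0, k) : ℕ × ℕ)) ⊆ μ.cells := by
    intro c hc
    rw [Finset.mem_union, Finset.mem_image, Finset.mem_image] at hc
    rw [YoungDiagram.mem_cells]
    rcases hc with ⟨k, hk, rfl⟩ | ⟨k, hk, rfl⟩
    · exact μ.up_left_mem (by simpa [Nat.lt_succ_iff] using hk) le_rfl hi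
    · exact μ.up_left_mem le_rfl (Finset.mem_Icc.1 hk).2 hj
  have h2 := Finset.card_le_card h1
  rw [Finset.card_union_of_disjoint, Finset.card_image_of_injective, Finset.card_image_of_injective,
    Finset.card_range, Nat.card_Icc] at h2
  · change _ ≤ μ.cells.card
    omega
  · intro a b h; simpa using h
  · intro a b h; simpa using h
  · rw [Finset.disjoint_left]
    intro c hc hc'
    rw [Finset.mem_image] at hc hc'
    obtain ⟨k, -, rfl⟩ := hc
    obtain ⟨l, hl, e⟩ := hc'
    rw [Finset.mem_Icc] at hl
    simp only [Prod.mk.injEq] at e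
    omega

variable {p d n : ℕ} [NeZero p] {lam : MultiPart p d n}

theorem card_diag_le (lam : MultiPart p d n) (κ : ZMod p × Fin d) :
    (lam.diag κ.1 κ.2).card ≤ n := by
  have h := lam.sum_card
  rw [← Fintype.sum_prod_type' (fun i j => (lam.diag i j).card)] at h
  refine le_trans ?_ h.le
  exact Finset.single_le_sum (f := fun κ : ZMod p × Fin d => (lam.diag κ.1 κ.2).card)
    (fun _ _ => Nat.zero_le _) (Finset.mem_univ κ)

theorem card_diag_add_le (lam : MultiPart p d n) {κ κ' : ZMod p × Fin d} (h : κ ≠ κ') :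
    (lam.diag κ.1 κ.2).card + (lam.diag κ'.1 κ'.2).card ≤ n := by
  have h' := lam.sum_card
  rw [← Fintype.sum_prod_type' (fun i j => (lam.diag i j).card)] at h'
  refine le_trans ?_ h'.le
  exact Finset.add_le_sum (f := fun κ : ZMod p × Fin d => (lam.diag κ.1 κ.2).card)
    (fun _ _ => Nat.zero_le _) (Finset.mem_univ κ) (Finset.mem_univ κ') h

/-- The difference of contents is at most the row of one cell plus the column of the other, and
these two numbers span a hook in the diagram. -/
theorem cont_sub_lt {c c' : (ZMod p × Fin d) × (ℕ × ℕ)} (hc : c.2 ∈ lam.diag c.1.1 c.1.2)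
    (hc' : c'.2 ∈ lam.diag c'.1.1 c'.1.2) (e : c.1 = c'.1) : (cont c' - cont c).natAbs < n := by
  obtain ⟨κ, i, j⟩ := c
  obtain ⟨κ', i', j'⟩ := c'
  obtain rfl : κ = κ' := e
  have h1 := card_diag_le lam κ
  have h2 := hook_le_card ((lam.diag κ.1 κ.2).up_left_mem le_rfl (Nat.zero_le _) hc)
    ((lam.diag κ.1 κ.2).up_left_mem (Nat.zero_le _) le_rfl hc')
  have h3 := hook_le_card ((lam.diag κ.1 κ.2).up_left_mem le_rfl (Nat.zero_le _) hc')
    ((lam.diag κ.1 κ.2).up_left_mem (Nat.zero_le _) le_rfl hc)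
  simp only [cont] at *
  omega

/-- Each content is smaller in absolute value than the size of its own diagram, and the two diagrams
share `n` cells. The extra `1` is needed to exclude the coefficients `1` and `-q`. -/
theorem cont_sub_lt_of_ne {c c' : (ZMod p × Fin d) × (ℕ × ℕ)}
    (hc : c.2 ∈ lam.diag c.1.1 c.1.2) (hc' : c'.2 ∈ lam.diag c'.1.1 c'.1.2) (e : c.1 ≠ c'.1) :
    (cont c' - cont c).natAbs + 1 < n := by
  obtain ⟨κ, i, j⟩ := c
  obtain ⟨κ', i', j'⟩ := c'
  have h1 := card_diag_add_le lam e
  have h2 := hook_le_card ((lam.diag κ.1 κ.2).up_left_mem le_rfl (Nat.zero_le _) hc)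
    ((lam.diag κ.1 κ.2).up_left_mem (Nat.zero_le _) le_rfl hc)
  have h3 := hook_le_card ((lam.diag κ'.1 κ'.2).up_left_mem le_rfl (Nat.zero_le _) hc')
    ((lam.diag κ'.1 κ'.2).up_left_mem (Nat.zero_le _) le_rfl hc')
  simp only [cont] at *
  omega

/-- The word of cells of a filling. -/
def word (t : Fin n ≃ Cell lam) (i : Fin n) : (ZMod p × Fin d) × (ℕ × ℕ) := (t i).1

theorem word_swap (t : Fin n ≃ Cell lam) (x y : Fin n) :
    word ((Equiv.swap x y).trans t) = word t ∘ Equiv.swap x y := rfl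

theorem word_mem (t : Fin n ≃ Cell lam) (x : Fin n) :
    (word t x).2 ∈ lam.diag (word t x).1.1 (word t x).1.2 := (t x).2

theorem word_injective (t : Fin n ≃ Cell lam) : Function.Injective (word t) :=
  Subtype.val_injective.comp t.injective

theorem exists_word_eq (t : Fin n ≃ Cell lam) {c : (ZMod p × Fin d) × (ℕ × ℕ)}
    (hc : c.2 ∈ lam.diag c.1.1 c.1.2) : ∃ x, word t x = c :=
  ⟨t.symm ⟨c, hc⟩, congrArg Subtype.val (t.apply_symm_apply ⟨c, hc⟩)⟩

/-- In a standard tableau there are at least two entries between those of two cells on the same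
diagonal. -/
theorem IsStandard.add_three_le {t : Fin n ≃ Cell lam} (ht : IsStandard lam t) {x y : Fin n}
    (hxy : x < y) (hc : (word t x).1 = (word t y).1) (hd : cont (word t x) = cont (word t y)) :
    x.val + 3 ≤ y.val := by
  have hm := word_mem t y
  have hx := ht y x hc.symm
  have hne : word t x ≠ word t y := fun h => hxy.ne (word_injective t h)
  have key : ∀ c : (ZMod p × Fin d) × (ℕ × ℕ), c.1 = (word t x).1 → (word t x).2 ≤ c.2 →
      c.2 ≤ (word t y).2 → ∃ z, word t z = c ∧ x ≤ z ∧ z ≤ y := by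
    intro c h1 h2 h3
    obtain ⟨z, rfl⟩ := exists_word_eq t (c := c) (by
      rw [h1, hc]
      exact (lam.diag _ _).isLowerSet h3 hm)
    exact ⟨z, rfl, ht x z h1.symm h2, ht z y (h1.trans hc) h3⟩
  have hle : (word t x).2.1 < (word t y).2.1 := by
    by_contra h
    have : y ≤ x := hx (by
      change (word t y).2 ≤ (word t x).2
      rw [Prod.le_def]
      simp only [cont] at hd
      omega)
    exact absurd hxy this.not_gt
  simp only [cont] at hd
  -- The cells directly below and directly to the right of the first cell lie between the two given
  -- cells; their entries are distinct and strictly between `x` and `y`.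
  obtain ⟨z, hz, z1, z2⟩ := key ((word t x).1, ((word t x).2.1 + 1, (word t x).2.2)) rfl
    (by rw [Prod.le_def]; simp) (by rw [Prod.le_def]; simp only; omega)
  obtain ⟨z', hz', z1', z2'⟩ := key ((word t x).1, ((word t x).2.1, (word t x).2.2 + 1)) rfl
    (by rw [Prod.le_def]; simp) (by rw [Prod.le_def]; simp only; omega)
  have n1 : x ≠ z := fun h => by
    have := congrArg (fun c => c.2.1) hz
    rw [← h] at this
    simp at this
  have n2 : x ≠ z' := fun h => by
    have := congrArg (fun c => c.2.2) hz'
    rw [← h] at this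
    simp at this
  have n3 : y ≠ z := fun h => by
    have h1 := congrArg (fun c => c.2.1) hz
    have h2 := congrArg (fun c => c.2.2) hz
    rw [← h] at h1 h2
    simp only at h1 h2
    omega
  have n4 : y ≠ z' := fun h => by
    have h1 := congrArg (fun c => c.2.1) hz'
    have h2 := congrArg (fun c => c.2.2) hz'
    rw [← h] at h1 h2
    simp only at h1 h2
    omega
  have n5 : z ≠ z' := fun h => by
    have := congrArg (fun c => c.2.1) (hz.symm.trans ((congrArg _ h).trans hz'))
    simp at this
  simp only [Fin.le_def, ne_eq, Fin.ext_iff] at *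
  omega

/-- The exchange of adjacent entries makes a standard tableau non-standard only if their cells are
adjacent. -/
theorem IsStandard.eq_of_not_swap {t : Fin n ≃ Cell lam} (ht : IsStandard lam t) {x y : Fin n}
    (hxy : y.val = x.val + 1) (h : ¬IsStandard lam ((Equiv.swap x y).trans t)) :
    word t y = ((word t x).1, ((word t x).2.1, (word t x).2.2 + 1)) ∨
      word t y = ((word t x).1, ((word t x).2.1 + 1, (word t x).2.2)) := by
  have hle : (word t x).1 = (word t y).1 ∧ (word t x).2 ≤ (word t y).2 := by
    simp only [IsStandard, not_forall] at h
    obtain ⟨i, j, h1, h2, h3⟩ := h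
    have h4 := ht _ _ h1 h2
    have : i = y ∧ j = x := by
      simp only [Equiv.swap_apply_def] at h4
      split_ifs at h4 <;> simp only [Fin.le_def, Fin.ext_iff] at * <;> omega
    obtain ⟨rfl, rfl⟩ := this
    simp only [Equiv.trans_apply, Equiv.swap_apply_left, Equiv.swap_apply_right] at h1 h2
    exact ⟨h1, h2⟩
  obtain ⟨hc, hle⟩ := hle
  have hne : word t x ≠ word t y := fun h => by
    have := word_injective t h
    rw [this] at hxy
    omega
  -- A cell between the two would carry an entry between the consecutive numbers `x` and `y`.
  have key : ∀ c : (ZMod p × Fin d) × (ℕ × ℕ), c.1 = (word t x).1 → (word t x).2 ≤ c.2 →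
      c.2 ≤ (word t y).2 → c = word t x ∨ c = word t y := by
    intro c h1 h2 h3
    obtain ⟨z, rfl⟩ := exists_word_eq t (c := c) (by
      rw [h1, hc]
      exact (lam.diag _ _).isLowerSet h3 (word_mem t y))
    have z1 : x ≤ z := ht x z h1.symm h2
    have z2 : z ≤ y := ht z y (h1.trans hc) h3
    have : z = x ∨ z = y := by
      simp only [Fin.le_def, Fin.ext_iff] at *
      omega
    rcases this with rfl | rfl
    · exact Or.inl rfl
    · exact Or.inr rfl
  rw [Prod.le_def] at hle
  by_cases h1 : (word t x).2.1 < (word t y).2.1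
  · rcases key ((word t x).1, ((word t x).2.1 + 1, (word t x).2.2)) rfl
      (by rw [Prod.le_def]; simp) (by rw [Prod.le_def]; simp only; omega) with e | e
    · have := congrArg (fun c => c.2.1) e
      simp at this
    · exact Or.inr e.symm
  · have h2 : (word t x).2.2 < (word t y).2.2 := by
      by_contra h2
      apply hne
      refine Prod.ext hc (Prod.ext ?_ ?_) <;> omega
    rcases key ((word t x).1, ((word t x).2.1, (word t x).2.2 + 1)) rfl
      (by rw [Prod.le_def]; simp) (by rw [Prod.le_def]; simp only; omega) with e | e
    · have := congrArg (fun c => c.2.2) e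
      simp at this
    · exact Or.inl e.symm

/-- Both orders of the entries are allowed, so the cells are incomparable: one is strictly lower and
strictly further left, and each coordinate adds at least one to the difference of contents. -/
theorem IsStandard.cont_of_swap {t : Fin n ≃ Cell lam} (ht : IsStandard lam t) {x y : Fin n}
    (hxy : y.val = x.val + 1) (h : IsStandard lam ((Equiv.swap x y).trans t))
    (hc : (word t x).1 = (word t y).1) : 2 ≤ (cont (word t y) - cont (word t x)).natAbs := by
  have h1 : ¬(word t x).2 ≤ (word t y).2 := fun h1 => by
    have := h y x (by simpa [word] using hc) (by simpa [word] using h1)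
    rw [Fin.le_def] at this
    omega
  have h2 : ¬(word t y).2 ≤ (word t x).2 := fun h1 => by
    have := ht y x hc.symm h1
    rw [Fin.le_def] at this
    omega
  rw [Prod.le_def] at h1 h2
  simp only [cont]
  omega

/-- The corner precedes all cells of the component, so its entry is at most `x`, while no smaller
entry lies in this component. -/
theorem IsStandard.cont_zero {t : Fin n ≃ Cell lam} (ht : IsStandard lam t) {x : Fin n}
    (h : ∀ z, z < x → (word t z).1 ≠ (word t x).1) : (word t x).2 = (0, 0) := by
  obtain ⟨z, hz⟩ := exists_word_eq t (c := ((word t x).1, (0, 0)))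
    ((lam.diag _ _).isLowerSet (Prod.mk_le_mk.2 ⟨Nat.zero_le _, Nat.zero_le _⟩) (word_mem t x))
  have h1 : z ≤ x := by
    apply ht
    · change (word t z).1 = _
      rw [hz]
      rfl
    · change (word t z).2 ≤ _
      rw [hz]
      exact Prod.mk_le_mk.2 ⟨Nat.zero_le _, Nat.zero_le _⟩
  rcases h1.lt_or_eq with h2 | rfl
  · exact absurd (congrArg Prod.fst hz) (h z h2)
  · rw [hz]

end

section

/-! ### Generic parameters -/

variable {p d n : ℕ}

/-- The numerical condition on the parameters that is equivalent to semisimplicity. -/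
structure Params.Generic (P : Params p d) (n : ℕ) : Prop where
  -- The component serves as a witness that there are parameters at all: for `d = 0` the factorial
  -- argument has no root to start from, and nothing is claimed about `q`.
  qInt_ne_zero : ∀ (_ : ZMod p × Fin d) (m : ℤ), m ≠ 0 → m.natAbs ≤ n → qInt P.q m ≠ 0
  weight_ne : ∀ κ κ' : ZMod p × Fin d, κ ≠ κ' → ∀ m : ℤ, m.natAbs < n →
    P.weight κ ≠ P.q ^ m * P.weight κ'


theorem Params.Generic.weight_injective {P : Params p d} (hg : P.Generic n) (hn : 0 < n) :
    Function.Injective P.weight := by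
  intro κ κ' h
  by_contra hne
  apply hg.weight_ne κ κ' hne 0 (by simpa using hn)
  rw [zpow_zero, one_mul, h]

theorem coeff_row (P : Params p d) {c c' : (ZMod p × Fin d) × (ℕ × ℕ)}
    (h : c' = (c.1, (c.2.1, c.2.2 + 1))) : P.coeff c c' = 1 := by
  have : cont c' - cont c = 1 := by
    rw [h]
    simp only [cont]
    push_cast
    ring
  rw [Params.coeff, if_pos (by rw [h]), this, qInt_one, div_one]

theorem coeff_column (P : Params p d) {c c' : (ZMod p × Fin d) × (ℕ × ℕ)}
    (h : c' = (c.1, (c.2.1 + 1, c.2.2))) : P.coeff c c' = -P.q := by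
  have : cont c' - cont c = -1 := by
    rw [h]
    simp only [cont]
    push_cast
    ring
  have := P.q_ne_zero
  rw [Params.coeff, if_pos (by rw [h]), ‹cont c' - cont c = -1›, qInt_neg P.q_ne_zero, qInt_one,
    zpow_neg_one]
  field_simp

variable [NeZero p]

theorem Params.exists_u_eq (P : Params p d) :
    ∃ f : ZMod p × Fin d → Fin (d * p), Function.Injective f ∧ ∀ κ, P.u (f κ) = P.weight κ := by
  refine ⟨fun κ => finProdFinEquiv (κ.2, ⟨κ.1.val, κ.1.val_lt⟩), ?_, ?_⟩
  · intro κ κ' h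
    have h' := finProdFinEquiv.injective h
    simp only [Prod.mk.injEq, Fin.mk.injEq] at h'
    exact Prod.ext (ZMod.val_injective p h'.2) h'.1
  · intro κ
    simp only [u, Equiv.symm_apply_apply, weight]

/-- The parameters of a semisimple Hecke algebra are generic. -/
theorem Params.generic_of_isSemisimpleRing (P : Params p d) (hss : IsSemisimpleRing (H P n)) :
    P.Generic n := by
  obtain ⟨f, hf, hu⟩ := P.exists_u_eq
  constructor
  · intro κ m hm hmn
    have h1 := qFactorial_ne_zero P.q_ne_zero (f κ) hss
    have h2 : qInt P.q (m.natAbs : ℤ) ≠ 0 := by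
      rw [qInt_natCast]
      have := Finset.prod_ne_zero_iff.1 h1 (m.natAbs - 1) (Finset.mem_range.2 (by omega))
      rwa [show m.natAbs - 1 + 1 = m.natAbs by omega] at this
    rcases Int.natAbs_eq m with e | e
    · rwa [← e] at h2
    · rw [e, qInt_neg P.q_ne_zero]
      exact mul_ne_zero (neg_ne_zero.2 (zpow_ne_zero _ P.q_ne_zero)) h2
  · intro κ κ' hκ m hm
    have key : ∀ κ κ' : ZMod p × Fin d, κ ≠ κ' →
        P.weight κ ≠ P.q ^ (m.natAbs : ℤ) * P.weight κ' := by
      intro κ κ' hκ e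
      have h1 := prod_sub_pow_mul_ne_zero P.q_ne_zero (hf.ne hκ) hss
      have := Finset.prod_ne_zero_iff.1 h1 m.natAbs (Finset.mem_range.2 hm)
      rw [hu, hu, e, zpow_natCast, sub_self] at this
      exact this rfl
    rcases Int.natAbs_eq m with e | e
    · rw [e]
      exact key κ κ' hκ
    · intro h
      apply key κ' κ hκ.symm
      rw [h, ← mul_assoc, ← zpow_add₀ P.q_ne_zero]
      rw [show (m.natAbs : ℤ) + m = 0 by omega, zpow_zero, one_mul]

variable {P : Params p d} {lam : MultiPart p d n}

/-- By `IsStandard.add_three_le`, entries at distance at most two never share a diagonal. Distance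
two occurs in the braid relation. -/
theorem Params.Generic.good (hg : P.Generic n) {t : Fin n ≃ Cell lam} (ht : IsStandard lam t)
    {x y : Fin n} (hxy : x.val < y.val) (hxy' : y.val ≤ x.val + 2) :
    P.Good (word t x) (word t y) := by
  refine ⟨fun e => ?_, fun e => ?_⟩
  · apply hg.qInt_ne_zero (word t x).1
    · intro h
      have := ht.add_three_le hxy e (by omega)
      omega
    · exact (cont_sub_lt (word_mem t x) (word_mem t y) e).le
  · intro h
    apply hg.weight_ne _ _ e (cont (word t x) - cont (word t y))
    · have := cont_sub_lt_of_ne (word_mem t x) (word_mem t y) e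
      omega
    · rw [res, res, sub_eq_zero] at h
      rw [sub_eq_add_neg, zpow_add₀ P.q_ne_zero, mul_assoc, mul_comm (P.q ^ (-_)), h,
        mul_left_comm, ← zpow_add₀ P.q_ne_zero, add_neg_cancel, zpow_zero, mul_one]

theorem coeff_of_not_swap {t : Fin n ≃ Cell lam} (ht : IsStandard lam t) {x y : Fin n}
    (hxy : y.val = x.val + 1) (h : ¬IsStandard lam ((Equiv.swap x y).trans t)) :
    P.coeff (word t x) (word t y) = 1 ∨ P.coeff (word t x) (word t y) = -P.q := by
  rcases ht.eq_of_not_swap hxy h with h1 | h1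
  · exact Or.inl (coeff_row P h1)
  · exact Or.inr (coeff_column P h1)

/-- In one component, at difference `m` of contents, the values `1` and `-q` would force `[m - 1]_q
= 0` or `[m + 1]_q = 0`, and `|m| ≥ 2` keeps these indices nonzero. In different components they
would force the residues to differ by a factor `q` or its inverse. -/
theorem Params.Generic.coeff_of_swap (hg : P.Generic n) {t : Fin n ≃ Cell lam}
    (ht : IsStandard lam t) {x y : Fin n} (hxy : y.val = x.val + 1)
    (h : IsStandard lam ((Equiv.swap x y).trans t)) :
    P.coeff (word t x) (word t y) ≠ 1 ∧ P.coeff (word t x) (word t y) ≠ -P.q := by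
  have hq := P.q_ne_zero
  have hgood := hg.good ht (x := x) (y := y) (by omega) (by omega)
  by_cases e : (word t x).1 = (word t y).1
  · have h2 := ht.cont_of_swap hxy h e
    have h3 := cont_sub_lt (word_mem t x) (word_mem t y) e
    have h4 := hgood.1 e
    rw [coeff, if_pos e]
    set m := cont (word t y) - cont (word t x) with hm
    constructor
    · intro h5
      rw [div_eq_one_iff_eq h4] at h5
      have h6 := qInt_add_one hq (m - 1)
      rw [sub_add_cancel, ← h5, left_eq_add, mul_eq_zero] at h6
      exact hg.qInt_ne_zero (word t x).1 (m - 1) (by omega) (by omega) (h6.resolve_left hq)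
    · intro h5
      rw [div_eq_iff h4] at h5
      apply hg.qInt_ne_zero (word t x).1 (m + 1) (by omega) (by omega)
      rw [qInt_add_one hq]
      linear_combination h5
  · have h2 := hgood.2 e
    have h3 := cont_sub_lt_of_ne (word_mem t x) (word_mem t y) e
    have key : ∀ k : ℤ, k.natAbs ≤ 1 → P.res (word t x) ≠ P.q ^ k * P.res (word t y) := by
      intro k hk h4
      apply hg.weight_ne _ _ e (k + (cont (word t x) - cont (word t y))) (by omega)
      have : P.weight (word t x).1 = P.q ^ (cont (word t x)) * P.res (word t x) := by
        rw [res, mul_left_comm, ← zpow_add₀ hq, add_neg_cancel, zpow_zero, mul_one]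
      rw [this, h4, res, zpow_add₀ hq, sub_eq_add_neg, zpow_add₀ hq]
      ring
    rw [coeff, if_neg e]
    constructor
    · intro h5
      rw [div_eq_one_iff_eq h2] at h5
      apply key 1 (by simp)
      rw [zpow_one]
      linear_combination h5
    · intro h5
      rw [div_eq_iff h2] at h5
      apply key (-1) (by simp)
      rw [zpow_neg_one, eq_inv_mul_iff_mul_eq₀ hq]
      linear_combination -h5

end

section

/-! ### The seminormal representation -/

theorem mem_of_T {p d n : ℕ} {P : Params p d} (S : Subalgebra ℂ (H P n)) (h : ∀ i, T P i ∈ S) (x : H P n) : x ∈ S :=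
  HeckeAlg.mem_of_gen S h x

section Seminormal

variable {p d n : ℕ} [NeZero p] {P : Params p d} {lam : MultiPart p d n}

/-- A standard filling as a standard tableau. -/
def StdTab.mk (t : Fin n ≃ Cell lam) (h : IsStandard lam t) : StdTab lam := ⟨t, h⟩

open Classical in
/-- The basis vector of a filling, read as `0` if the filling is not standard. -/
def basisOrZero (t : Fin n ≃ Cell lam) : StdTab lam →₀ ℂ :=
  if h : IsStandard lam t then Finsupp.single (StdTab.mk t h) 1 else 0

/-- The seminormal operators. -/
def seminormalOp (P : Params p d) (lam : MultiPart p d n) (i : Fin n) :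
    Module.End ℂ (StdTab lam →₀ ℂ) :=
  Finsupp.linearCombination ℂ fun t =>
    if i.val = 0 then P.weight (word t.1 i).1 • Finsupp.single t 1
    else P.coeff (word t.1 (prev i)) (word t.1 i) • Finsupp.single t 1 +
      (1 - P.coeff (word t.1 (prev i)) (word t.1 i)) •
        basisOrZero ((Equiv.swap (prev i) i).trans t.1)

/-- The functional on the seminormal representation given by a function of words of cells. -/
def wordFunctional (lam : MultiPart p d n) (F : (Fin n → (ZMod p × Fin d) × (ℕ × ℕ)) → ℂ) :
    (StdTab lam →₀ ℂ) →ₗ[ℂ] ℂ :=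
  Finsupp.linearCombination ℂ fun t => F (word t.1)

/-- The operators on functions of words of cells. -/
def cellOp (P : Params p d) (i : Fin n) (F : (Fin n → (ZMod p × Fin d) × (ℕ × ℕ)) → ℂ) :
    (Fin n → (ZMod p × Fin d) × (ℕ × ℕ)) → ℂ :=
  if i.val = 0 then weightOp P i F else semOp P (prev i) i F

theorem wordFunctional_single (F : (Fin n → (ZMod p × Fin d) × (ℕ × ℕ)) → ℂ) (t : StdTab lam) :
    wordFunctional lam F (Finsupp.single t 1) = F (word t.1) := by
  simp [wordFunctional]

/-- A tableau is determined by its word, so indicator functions of words already give all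
coordinates. -/
theorem end_ext_of_wordFunctional {A B : Module.End ℂ (StdTab lam →₀ ℂ)}
    (h : ∀ F (t : StdTab lam), wordFunctional lam F (A (Finsupp.single t 1)) =
      wordFunctional lam F (B (Finsupp.single t 1))) : A = B := by
  classical
  refine Finsupp.lhom_ext' fun t => LinearMap.ext_ring ?_
  ext s
  have key : ∀ a : StdTab lam →₀ ℂ,
      wordFunctional lam (fun w => if w = word s.1 then 1 else 0) a = a s := by
    intro a
    rw [wordFunctional, Finsupp.linearCombination_apply, Finsupp.sum]
    have : ∀ r : StdTab lam, word r.1 = word s.1 ↔ r = s := fun r => by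
      constructor
      · intro h
        exact Subtype.ext (Equiv.ext fun i => Subtype.ext (congrFun h i))
      · rintro rfl; rfl
    simp [this]
    exact fun h => h.symm
  have := h (fun w => if w = word s.1 then 1 else 0) t
  rw [key, key] at this
  simpa using this

/-- The operators on functions of words are the transposes of the seminormal ones. At a standard
tableau `offCoeff` vanishes exactly when the exchanged filling is not standard, so nonstandard words
never contribute and all relations can be checked on unrestricted words. -/
theorem wordFunctional_seminormalOp (hg : P.Generic n) (i : Fin n)
    (F : (Fin n → (ZMod p × Fin d) × (ℕ × ℕ)) → ℂ) (a : StdTab lam →₀ ℂ) :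
    wordFunctional lam F (seminormalOp P lam i a) = wordFunctional lam (cellOp P i F) a := by
  suffices h : wordFunctional lam F ∘ₗ seminormalOp P lam i = wordFunctional lam (cellOp P i F) from
    LinearMap.congr_fun h a
  refine Finsupp.lhom_ext' fun t => LinearMap.ext_ring ?_
  simp only [LinearMap.comp_apply, Finsupp.lsingle_apply, wordFunctional_single]
  rw [seminormalOp, Finsupp.linearCombination_single, one_smul, cellOp]
  split_ifs with hi
  · rw [map_smul, wordFunctional_single]
    rfl
  · have hi' : i.val = (prev i).val + 1 := by rw [prev_val]; omega
    rw [map_add, map_smul, map_smul, wordFunctional_single, semOp, basisOrZero]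
    split_ifs with hs
    · have := hg.coeff_of_swap t.2 hi' hs
      rw [wordFunctional_single, Params.offCoeff, if_neg (by tauto)]
      rfl
    · rw [Params.offCoeff, if_pos (coeff_of_not_swap t.2 hi' hs)]
      simp

theorem isHeckeFamily_seminormalOp (hg : P.Generic n) :
    IsHeckeFamily (d * p) n P.u P.q (seminormalOp P lam) where
  comm i j h := by
    refine end_ext_of_wordFunctional fun F t => ?_
    simp only [Module.End.mul_apply, wordFunctional_seminormalOp hg, wordFunctional_single]
    have hj : j.val ≠ 0 := by omega
    have e2 := prev_val j
    have e1 := prev_val i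
    simp only [cellOp, hj, if_false]
    split_ifs with hi
    · refine (weightOp_semOp_comm F _ ?_ ?_).symm <;> intro e <;> have e := congrArg Fin.val e <;>
        omega
    · apply semOp_comm <;> intro e <;> have e := congrArg Fin.val e <;> omega
  braid i j hi hj := by
    refine end_ext_of_wordFunctional fun F t => ?_
    simp only [Module.End.mul_apply, wordFunctional_seminormalOp hg, wordFunctional_single]
    have hi' : i.val ≠ 0 := by omega
    have hj' : j.val ≠ 0 := by omega
    have e : prev j = i := Fin.ext (by rw [prev_val]; omega)
    have e1 := prev_val i
    simp only [cellOp, hi', hj', if_false, e]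
    refine semOp_braid F _ ?_ ?_ ?_ (hg.good t.2 ?_ ?_) (hg.good t.2 ?_ ?_)
      (hg.good t.2 ?_ ?_) <;> omega
  braid_four i j hi hj := by
    refine end_ext_of_wordFunctional fun F t => ?_
    simp only [Module.End.mul_apply, wordFunctional_seminormalOp hg, wordFunctional_single]
    have hj' : j.val ≠ 0 := by omega
    have e : prev j = i := Fin.ext (by rw [prev_val]; omega)
    simp only [cellOp, hi, hj', if_true, if_false, e]
    -- Transposition reverses products, so the two sides appear exchanged. If the first two entries
    -- lie in different components, each occupies a corner, of content zero.
    refine (semOp_braid_four F _ (hg.good t.2 (by omega) (by omega)) fun hne => ?_).symm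
    have h1 : (word t.1 i).2 = (0, 0) := t.2.cont_zero fun z hz => by
      rw [Fin.lt_def] at hz
      omega
    have h2 : (word t.1 j).2 = (0, 0) := t.2.cont_zero fun z hz => by
      have : z = i := Fin.ext (by rw [Fin.lt_def] at hz; omega)
      rw [this]
      exact hne
    simp [cont, h1, h2]
  cyclotomic i hi := by
    refine Finsupp.lhom_ext' fun t => LinearMap.ext_ring ?_
    simp only [LinearMap.comp_apply, Finsupp.lsingle_apply, LinearMap.zero_apply]
    obtain ⟨f, -, hu⟩ := P.exists_u_eq
    -- Each basis vector is an eigenvector, and its eigenvalue is one of the roots of the cyclotomic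
    -- polynomial.
    rw [Module.End.aeval_apply_of_hasEigenvector (μ := P.weight (word t.1 i).1),
      Polynomial.eval_prod, Finset.prod_eq_zero (Finset.mem_univ (f (word t.1 i).1)), zero_smul]
    · rw [hu]
      simp
    · rw [Module.End.hasEigenvector_iff]
      refine ⟨Module.End.mem_eigenspace_iff.2 ?_, by simp⟩
      rw [seminormalOp, Finsupp.linearCombination_single, one_smul, if_pos hi]
  quadratic i hi := by
    refine end_ext_of_wordFunctional fun F t => ?_
    have hi' : i.val ≠ 0 := by omega
    have e1 := prev_val i
    simp only [Module.End.mul_apply, LinearMap.add_apply, LinearMap.smul_apply, map_add, map_smul,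
      wordFunctional_seminormalOp hg, wordFunctional_single, Module.End.one_apply]
    simp only [cellOp, hi', if_false, smul_eq_mul]
    exact semOp_quadratic F _ (hg.good t.2 (by omega) (by omega))

end Seminormal

/-! ### The basis of `V(λ)` -/

section Basis

variable {p d n : ℕ} [NeZero p] {P : Params p d} {lam : MultiPart p d n}

open Classical in
/-- The vector `v(𝕋)` of a filling, read as `0` if the filling is not standard. -/
def vecOrZero (P : Params p d) (t : Fin n ≃ Cell lam) : V P lam :=
  if h : IsStandard lam t then vec P (StdTab.mk t h) else 0

/-- The quotient map onto `V(λ)`. -/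
def V.mk (P : Params p d) (lam : MultiPart p d n) : FreeOnTab P lam →ₗ[H P n] V P lam :=
  Submodule.mkQ _

theorem V.mk_symOrZero (t : Fin n ≃ Cell lam) : V.mk P lam (symOrZero P t) = vecOrZero P t := by
  rw [symOrZero, vecOrZero]
  split_ifs
  · rfl
  · exact map_zero _

theorem V.mk_eq_zero {x : FreeOnTab P lam} (h : SeminormalRel P lam x) : V.mk P lam x = 0 :=
  (Submodule.Quotient.mk_eq_zero _).2 (Submodule.subset_span h)

theorem T_zero_smul_vec (t : StdTab lam) {i : Fin n} (hi : i.val = 0) :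
    T P i • vec P t = P.weight (word t.1 i).1 • vec P t := by
  have := V.mk_eq_zero (SeminormalRel.first (P := P) t i hi)
  rw [map_sub, map_smul, LinearMap.map_smul_of_tower, sub_eq_zero] at this
  exact this

theorem T_smul_vec (t : StdTab lam) {x y : Fin n} (h : y.val = x.val + 1) :
    T P y • vec P t = P.coeff (word t.1 x) (word t.1 y) • vec P t +
      (1 - P.coeff (word t.1 x) (word t.1 y)) • vecOrZero P ((Equiv.swap x y).trans t.1) := by
  have := V.mk_eq_zero (SeminormalRel.next (P := P) t x y h)
  rw [map_sub, map_add, map_smul, LinearMap.map_smul_of_tower, LinearMap.map_smul_of_tower,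
    V.mk_symOrZero, sub_eq_zero] at this
  exact this

/-- The complex span is stable under the generators, hence under the algebra, and it contains module
generators of `V(λ)`. -/
theorem span_vec : Submodule.span ℂ (Set.range (vec P : StdTab lam → V P lam)) = ⊤ := by
  set U := Submodule.span ℂ (Set.range (vec P : StdTab lam → V P lam)) with hU
  have hvec : ∀ t, vec P t ∈ U := fun t => Submodule.subset_span ⟨t, rfl⟩
  have hvz : ∀ t : Fin n ≃ Cell lam, vecOrZero P t ∈ U := by
    intro t
    rw [vecOrZero]
    split_ifs
    · exact hvec _
    · exact U.zero_mem
  let S : Subalgebra ℂ (H P n) :=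
    { carrier := {x | ∀ m ∈ U, x • m ∈ U}
      mul_mem' := fun {a b} ha hb m hm => by
        rw [mul_smul]
        exact ha _ (hb _ hm)
      add_mem' := fun {a b} ha hb m hm => by
        rw [add_smul]
        exact U.add_mem (ha _ hm) (hb _ hm)
      algebraMap_mem' := fun c m hm => by
        rw [algebraMap_smul]
        exact U.smul_mem _ hm }
  have hS : ∀ x, x ∈ S := by
    apply mem_of_T
    intro i m hm
    induction hm using Submodule.span_induction with
    | mem x hx =>
      obtain ⟨t, rfl⟩ := hx
      by_cases hi : i.val = 0
      · rw [T_zero_smul_vec t hi]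
        exact U.smul_mem _ (hvec t)
      · rw [T_smul_vec t (x := prev i) (by rw [prev_val]; omega)]
        exact U.add_mem (U.smul_mem _ (hvec t)) (U.smul_mem _ (hvz _))
    | zero => rw [smul_zero]; exact U.zero_mem
    | add a b _ _ ha hb => rw [smul_add]; exact U.add_mem ha hb
    | smul c a _ ha => rw [smul_comm]; exact U.smul_mem _ ha
  rw [eq_top_iff]
  rintro m -
  obtain ⟨f, rfl⟩ := Submodule.mkQ_surjective _ m
  induction f using Finsupp.induction_linear with
  | zero => rw [map_zero]; exact U.zero_mem
  | add a b ha hb => rw [map_add]; exact U.add_mem ha hb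
  | single t x =>
    have : (Finsupp.single t x : FreeOnTab P lam) = x • sym P t := by
      rw [sym, Finsupp.smul_single, smul_eq_mul, mul_one]
    rw [this, map_smul]
    exact hS x _ (hvec t)

/-- The defining relations of `V(λ)` hold in the seminormal representation, so `V(λ)` maps to it
with `v(𝕋)` going to the basis vectors. -/
theorem linearIndependent_vec (hg : P.Generic n) :
    LinearIndependent ℂ (vec P : StdTab lam → V P lam) := by
  have hX := isHeckeFamily_seminormalOp (lam := lam) hg
  let _ : Module (H P n) (StdTab lam →₀ ℂ) := Module.compHom _ hX.rep.toRingHom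
  have smul_def : ∀ (h : H P n) (m : StdTab lam →₀ ℂ), h • m = hX.rep h m := fun _ _ => rfl
  have T_smul : ∀ (i : Fin n) (m : StdTab lam →₀ ℂ), T P i • m = seminormalOp P lam i m :=
    fun i m => by
      rw [smul_def]
      exact LinearMap.congr_fun (hX.rep_gen i) m
  have : IsScalarTower ℂ (H P n) (StdTab lam →₀ ℂ) := ⟨fun c h m => by
    rw [smul_def, smul_def, map_smul, LinearMap.smul_apply]⟩
  let ψ₀ : FreeOnTab P lam →ₗ[H P n] (StdTab lam →₀ ℂ) :=
    Finsupp.lsum ℕ fun t => LinearMap.toSpanSingleton (H P n) _ (Finsupp.single t (1 : ℂ))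
  have hψ₀ : ∀ t, ψ₀ (sym P t) = Finsupp.single t (1 : ℂ) := fun t => by
    rw [sym, Finsupp.lsum_single, LinearMap.toSpanSingleton_apply, one_smul]
  have hψz : ∀ t : Fin n ≃ Cell lam, ψ₀ (symOrZero P t) = basisOrZero t := fun t => by
    rw [symOrZero, basisOrZero]
    split_ifs
    · exact hψ₀ _
    · exact map_zero _
  let ψ : V P lam →ₗ[H P n] (StdTab lam →₀ ℂ) := Submodule.liftQ _ ψ₀ (by
    rw [Submodule.span_le]
    rintro x (⟨t, i, hi⟩ | ⟨t, x, y, h⟩)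
    · change ψ₀ _ = 0
      rw [map_sub, map_smul, LinearMap.map_smul_of_tower, hψ₀, T_smul, seminormalOp,
        Finsupp.linearCombination_single, one_smul, if_pos hi, sub_eq_zero]
      rfl
    · change ψ₀ _ = 0
      have hx : x = prev y := Fin.ext (by rw [prev_val]; omega)
      rw [map_sub, map_add, map_smul, LinearMap.map_smul_of_tower, LinearMap.map_smul_of_tower,
        hψz, hψ₀, T_smul, seminormalOp, Finsupp.linearCombination_single, one_smul,
        if_neg (by omega), sub_eq_zero, hx]
      rfl)
  have hψ : ∀ t, ψ (vec P t) = Finsupp.single t (1 : ℂ) := hψ₀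
  apply LinearIndependent.of_comp (ψ.restrictScalars ℂ)
  have : (ψ.restrictScalars ℂ) ∘ (vec P : StdTab lam → V P lam) =
      fun t => Finsupp.single t (1 : ℂ) := funext hψ
  rw [this]
  exact Finsupp.linearIndependent_single_one ℂ (StdTab lam)

/-- The basis of `V(λ)` of the vectors `v(𝕋)`. -/
def vecBasis (hg : P.Generic n) (lam : MultiPart p d n) : Module.Basis (StdTab lam) ℂ (V P lam) :=
  Module.Basis.mk (linearIndependent_vec hg) span_vec.ge

theorem vecBasis_apply (hg : P.Generic n) (t : StdTab lam) : vecBasis hg lam t = vec P t := by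
  simp [vecBasis]

end Basis

end

section

/-! ### Homomorphisms between the modules `V(λ)` -/

section Connected

variable {p d n : ℕ} [NeZero p] {lam : MultiPart p d n}

theorem StdTab.ext_word {t t' : StdTab lam} (h : word t.1 = word t'.1) : t = t' :=
  Subtype.ext (Equiv.ext fun i => Subtype.ext (congrFun h i))

theorem eq_of_word_eq {mu : MultiPart p d n} (t : Fin n ≃ Cell lam) (t' : Fin n ≃ Cell mu)
    (h : word t = word t') : lam = mu := by
  have key : ∀ (lam mu : MultiPart p d n) (t : Fin n ≃ Cell lam) (t' : Fin n ≃ Cell mu),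
      word t = word t' → ∀ κ c, c ∈ lam.diag (Prod.fst κ) (Prod.snd κ) → c ∈ mu.diag κ.1 κ.2 := by
    intro lam mu t t' h κ c hc
    obtain ⟨i, hi⟩ := exists_word_eq t (c := (κ, c)) hc
    have := word_mem t' i
    rwa [← h, hi] at this
  ext i j : 3
  refine YoungDiagram.ext (Finset.ext fun c => ?_)
  exact ⟨key lam mu t t' h (i, j) c, key mu lam t' t h.symm (i, j) c⟩

/-- A permutation without descents is an order automorphism of `Fin n`, and the identity is the only
one. -/
theorem exists_descent {n : ℕ} (σ : Equiv.Perm (Fin n)) (h : σ ≠ 1) :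
    ∃ x y : Fin n, y.val = x.val + 1 ∧ σ y < σ x := by
  by_contra! hc
  apply h
  cases n with
  | zero => exact Subsingleton.elim _ _
  | succ n =>
    have hs : StrictMono σ := Fin.strictMono_iff_lt_succ.2 fun i =>
      lt_of_le_of_ne (hc i.castSucc i.succ (by simp)) (σ.injective.ne (by simp [Fin.ext_iff]))
    have : hs.orderIsoOfSurjective _ σ.surjective = OrderIso.refl _ := Subsingleton.elim _ _
    exact Equiv.ext fun i => congrArg (fun g => g i) this

/-- Any two standard tableaux of the same shape are connected by exchanges of adjacent entries. -/
theorem StdTab.constant_of_swap {B : Type*} (f : StdTab lam → B)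
    (h : ∀ (t : StdTab lam) (x y : Fin n), y.val = x.val + 1 →
      ∀ hs : IsStandard lam ((Equiv.swap x y).trans t.1), f (StdTab.mk _ hs) = f t)
    (t t₀ : StdTab lam) : f t = f t₀ := by
  -- The permutation from `t` to `t₀` measures the distance. At a descent, standardness of `t₀`
  -- shows that the two cells are not in the order that would block the exchange, and the exchange
  -- raises `coinv`, which is at most `n * n`.
  generalize hm : n * n - coinv (t.1.trans t₀.1.symm) = m
  induction m using Nat.strong_induction_on generalizing t with
  | _ m ih =>
    by_cases hσ : t.1.trans t₀.1.symm = 1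
    · have : t.1 = t₀.1 := by
        ext i : 1
        have := Equiv.congr_fun hσ i
        rwa [Equiv.trans_apply, Equiv.symm_apply_eq] at this
      rw [show t = t₀ from Subtype.ext this]
    · obtain ⟨x, y, hxy, hlt⟩ := exists_descent _ hσ
      have hnot : ¬((word t.1 x).1 = (word t.1 y).1 ∧ (word t.1 x).2 ≤ (word t.1 y).2) := by
        rintro ⟨h1, h2⟩
        refine hlt.not_ge (t₀.2 _ _ ?_ ?_)
        · simpa [word] using h1
        · simpa [word] using h2
      have hs : IsStandard lam ((Equiv.swap x y).trans t.1) := by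
        by_contra hs
        apply hnot
        rcases t.2.eq_of_not_swap hxy hs with e | e <;> rw [e] <;> simp [Prod.le_def]
      rw [← h t x y hxy hs]
      have hc := coinv_swap ((t.1.trans t₀.1.symm) ∘ Equiv.swap x y) hxy (by simpa using hlt)
      have e2 : ((t.1.trans t₀.1.symm) ∘ Equiv.swap x y) ∘ Equiv.swap x y =
          t.1.trans t₀.1.symm := by
        rw [Function.comp_assoc]
        funext z
        simp
      rw [e2] at hc
      have hb : coinv ((t.1.trans t₀.1.symm) ∘ Equiv.swap x y) ≤ n * n := by
        refine (Finset.card_filter_le _ _).trans ?_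
        simp
      refine ih _ ?_ _ rfl
      have e : ((StdTab.mk _ hs).1.trans t₀.1.symm : Fin n → Fin n) =
        (t.1.trans t₀.1.symm) ∘ Equiv.swap x y := rfl
      rw [e]
      omega

/-- The cells of a tuple of Young diagrams, component by component. -/
def cellEquiv (lam : MultiPart p d n) :
    Cell lam ≃ Σ κ : ZMod p × Fin d, (lam.diag κ.1 κ.2).cells where
  toFun c := ⟨c.1.1, c.1.2, c.2⟩
  invFun s := ⟨(s.1, s.2.1), s.2.2⟩
  left_inv _ := rfl
  right_inv _ := rfl

theorem natCard_cell (lam : MultiPart p d n) : Nat.card (Cell lam) = n := by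
  rw [Nat.card_congr (cellEquiv lam), Nat.card_sigma]
  have h := lam.sum_card
  rw [← Fintype.sum_prod_type' (fun i j => (lam.diag i j).card)] at h
  simpa only [Nat.card_eq_fintype_card, Fintype.card_coe] using h

instance (lam : MultiPart p d n) : Finite (Cell lam) := Finite.of_equiv _ (cellEquiv lam).symm

instance (lam : MultiPart p d n) : Finite (StdTab lam) :=
  inferInstanceAs (Finite {t : Fin n ≃ Cell lam // IsStandard lam t})

theorem nonempty_stdTab (lam : MultiPart p d n) : Nonempty (StdTab lam) := by
  obtain ⟨e, he⟩ := exists_injective_nat ((ZMod p × Fin d) × (ℕ × ℕ))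
  -- Cells are listed by row plus column, with ties broken by an arbitrary injection. Inside a
  -- component this refines the order of cells.
  let key : Cell lam → ℕ ×ₗ ℕ := fun c => toLex (c.1.2.1 + c.1.2.2, e c.1)
  have hkey : Function.Injective key := fun c c' h => by
    have := congrArg (fun z => (ofLex z).2) h
    exact Subtype.ext (he this)
  let _ : LinearOrder (Cell lam) := LinearOrder.lift' key hkey
  let _ := Fintype.ofFinite (Cell lam)
  let t := Fintype.orderIsoFinOfCardEq (Cell lam)
    (by rw [← Nat.card_eq_fintype_card, natCard_cell])
  refine ⟨⟨t.toEquiv, fun x y h1 h2 => ?_⟩⟩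
  rw [← t.le_iff_le]
  change key (t x) ≤ key (t y)
  have h1' : (t x).1.1 = (t y).1.1 := h1
  have h2' : (t x).1.2 ≤ (t y).1.2 := h2
  rw [Prod.le_def] at h2'
  rw [Prod.Lex.toLex_le_toLex]
  by_cases h : (t x).1.2.1 + (t x).1.2.2 < (t y).1.2.1 + (t y).1.2.2
  · exact Or.inl h
  · right
    have h3 : (t x).1 = (t y).1 := Prod.ext h1' (Prod.ext (by omega) (by omega))
    exact ⟨by omega, le_of_eq (congrArg e h3)⟩

end Connected

end

section

/-! ### Schur's lemma and simplicity -/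

section Hom

variable {p d n : ℕ} [NeZero p] {P : Params p d} {lam mu : MultiPart p d n}

theorem vecOrZero_mk (t : StdTab lam) : vecOrZero P t.1 = vec P t := by
  rw [vecOrZero]
  exact dif_pos t.2

theorem vecOrZero_of_not {t : Fin n ≃ Cell lam} (h : ¬IsStandard lam t) : vecOrZero P t = 0 := by
  rw [vecOrZero, dif_neg h]

open Classical in
/-- The coordinate of a filling in `V(λ)`, read as `0` if the filling is not standard. -/
def tabCoord (hg : P.Generic n) (t : Fin n ≃ Cell lam) : V P lam →ₗ[ℂ] ℂ :=
  if h : IsStandard lam t then (vecBasis hg lam).coord (StdTab.mk t h) else 0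

open Classical in
theorem tabCoord_vecOrZero (hg : P.Generic n) (r t : Fin n ≃ Cell lam) :
    tabCoord hg t (vecOrZero P r) = if r = t ∧ IsStandard lam r then 1 else 0 := by
  by_cases hr : IsStandard lam r
  · rw [show vecOrZero P r = vecBasis hg lam (StdTab.mk r hr) by
      rw [vecBasis_apply]; exact vecOrZero_mk (StdTab.mk r hr), tabCoord]
    split_ifs with h1 h2 h2
    · obtain ⟨rfl, -⟩ := h2
      simp
    · rw [Module.Basis.coord_apply, Module.Basis.repr_self, Finsupp.single_eq_of_ne]
      intro e
      exact h2 ⟨congrArg Subtype.val e.symm, hr⟩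
    · exact absurd (h2.1 ▸ hr) h1
    · rfl
  · rw [vecOrZero_of_not hr, map_zero, if_neg fun h => hr h.2]

theorem swap_trans_swap (t : Fin n ≃ Cell lam) (x y : Fin n) :
    (Equiv.swap x y).trans ((Equiv.swap x y).trans t) = t := by
  ext z : 1
  simp

/-- The transposed form of the action: the contribution to `t` from its exchange carries the
coefficient of that other tableau, in which the cells of `x` and `y` have changed places. -/
theorem tabCoord_T_smul (hg : P.Generic n) {t : Fin n ≃ Cell lam} (ht : IsStandard lam t)
    {x y : Fin n} (hxy : y.val = x.val + 1) (m : V P lam) :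
    tabCoord hg t (T P y • m) = P.coeff (word t x) (word t y) * tabCoord hg t m +
      (1 - P.coeff (word t y) (word t x)) * tabCoord hg ((Equiv.swap x y).trans t) m := by
  classical
  suffices h : tabCoord hg t ∘ₗ Algebra.lsmul ℂ ℂ (V P lam) (T P y) =
      P.coeff (word t x) (word t y) • tabCoord hg t +
        (1 - P.coeff (word t y) (word t x)) • tabCoord hg ((Equiv.swap x y).trans t) from
    LinearMap.congr_fun h m
  refine (vecBasis hg lam).ext fun s => ?_
  rw [vecBasis_apply]
  simp only [LinearMap.comp_apply, LinearMap.add_apply, LinearMap.smul_apply, smul_eq_mul,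
    Algebra.lsmul_coe]
  rw [T_smul_vec s hxy, map_add, map_smul, map_smul, ← vecOrZero_mk, tabCoord_vecOrZero,
    tabCoord_vecOrZero, tabCoord_vecOrZero, smul_eq_mul, smul_eq_mul]
  have hs : IsStandard lam s.1 := s.2
  congr 1
  · by_cases h : s.1 = t
    · rw [h]
    · simp [h]
  · by_cases h : (Equiv.swap x y).trans s.1 = t
    · have h2 : s.1 = (Equiv.swap x y).trans t := by rw [← h, swap_trans_swap]
      have e1 : word t y = word s.1 x := by rw [← h, word_swap]; simp
      have e2 : word t x = word s.1 y := by rw [← h, word_swap]; simp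
      rw [if_pos ⟨h, h ▸ ht⟩, if_pos ⟨h2, hs⟩, e1, e2]
    · rw [if_neg fun h' => h h'.1, if_neg, mul_zero, mul_zero]
      rintro ⟨h', -⟩
      apply h
      rw [h', swap_trans_swap]

theorem tabCoord_T_zero_smul (hg : P.Generic n) {t : Fin n ≃ Cell lam}
    {y : Fin n} (hy : y.val = 0) (m : V P lam) :
    tabCoord hg t (T P y • m) = P.weight (word t y).1 * tabCoord hg t m := by
  classical
  suffices h : tabCoord hg t ∘ₗ Algebra.lsmul ℂ ℂ (V P lam) (T P y) =
      P.weight (word t y).1 • tabCoord hg t from LinearMap.congr_fun h m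
  refine (vecBasis hg lam).ext fun s => ?_
  rw [vecBasis_apply]
  simp only [LinearMap.comp_apply, LinearMap.smul_apply, smul_eq_mul, Algebra.lsmul_coe]
  rw [T_zero_smul_vec s hy, map_smul, ← vecOrZero_mk, tabCoord_vecOrZero, smul_eq_mul]
  by_cases h : s.1 = t
  · rw [h]
  · simp [h]

/-- The matrix coefficients of a homomorphism vanish outside of equal tableaux. -/
theorem word_eq_of_tabCoord_ne_zero (hg : P.Generic n) (θ : V P lam →ₗ[ℂ] V P mu)
    (hθ : ∀ (i : Fin n) m, θ (T P i • m) = T P i • θ m) (t : Fin n ≃ Cell lam) (t' : Fin n ≃ Cell mu)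
    (h : tabCoord hg t' (θ (vecOrZero P t)) ≠ 0) : word t = word t' := by
  -- The cells of the entries are matched one after another, for all pairs of tableaux with a
  -- nonzero matrix entry at once.
  suffices key : ∀ k : ℕ, ∀ (t : Fin n ≃ Cell lam) (t' : Fin n ≃ Cell mu),
      tabCoord hg t' (θ (vecOrZero P t)) ≠ 0 → ∀ i : Fin n, i.val < k → word t i = word t' i from
    funext fun i => key n t t' h i i.2
  intro k
  induction k with
  | zero => intro _ _ _ i hi; omega
  | succ k ih =>
    intro t t' hM y hy
    rcases Nat.lt_succ_iff_lt_or_eq.1 hy with hy | hy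
    · exact ih t t' hM y hy
    have ht : IsStandard lam t := by
      by_contra hc
      rw [vecOrZero_of_not hc, map_zero, map_zero] at hM
      exact hM rfl
    have ht' : IsStandard mu t' := by
      by_contra hc
      rw [tabCoord, dif_neg hc] at hM
      exact hM rfl
    by_cases hk : k = 0
    · have hy0 : y.val = 0 := by omega
      have h1 := congrArg (tabCoord hg t') (hθ y (vecOrZero P t))
      rw [tabCoord_T_zero_smul hg hy0, ← show vec P (StdTab.mk t ht) = vecOrZero P t from
        (vecOrZero_mk (StdTab.mk t ht)).symm, T_zero_smul_vec _ hy0, map_smul, map_smul,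
        smul_eq_mul, show vec P (StdTab.mk t ht) = vecOrZero P t from
        (vecOrZero_mk (StdTab.mk t ht)).symm] at h1
      have h2 := hg.weight_injective y.pos (mul_right_cancel₀ hM h1)
      have c1 := ht.cont_zero (x := y) fun z hz => by rw [Fin.lt_def] at hz; omega
      have c2 := ht'.cont_zero (x := y) fun z hz => by rw [Fin.lt_def] at hz; omega
      exact Prod.ext h2 (c1.trans c2.symm)
    by_contra hne
    obtain ⟨x, hx⟩ : ∃ x : Fin n, x = prev y := ⟨_, rfl⟩
    have hxy : y.val = x.val + 1 := by rw [hx, prev_val]; omega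
    have hxk : x.val < k := by omega
    have hwx : word t x = word t' x := ih t t' hM x hxk
    have hxy' : x ≠ y := fun e => by rw [e] at hxy; omega
    have hT := hθ y (vecOrZero P t)
    rw [show vecOrZero P t = vec P (StdTab.mk t ht) from vecOrZero_mk (StdTab.mk t ht),
      T_smul_vec _ hxy, ← show vecOrZero P t = vec P (StdTab.mk t ht) from
        vecOrZero_mk (StdTab.mk t ht), map_add, map_smul, map_smul] at hT
    change P.coeff (word t x) (word t y) • θ (vecOrZero P t) +
      (1 - P.coeff (word t x) (word t y)) • θ (vecOrZero P ((Equiv.swap x y).trans t)) = _ at hT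
    -- The induction hypothesis requires equal cells at `x`. An exchange on one side destroys this
    -- equality, and an exchange on both sides would give equal cells at `y`; so the three
    -- neighbouring entries vanish.
    have z1 : tabCoord hg t' (θ (vecOrZero P ((Equiv.swap x y).trans t))) = 0 := by
      by_contra hc
      have := ih _ _ hc x hxk
      rw [word_swap, Function.comp_apply, Equiv.swap_apply_left, ← hwx] at this
      exact hxy' (word_injective t this).symm
    have z2 : tabCoord hg ((Equiv.swap x y).trans t') (θ (vecOrZero P t)) = 0 := by
      by_contra hc
      have := ih _ _ hc x hxk
      rw [word_swap, Function.comp_apply, Equiv.swap_apply_left, hwx] at this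
      exact hxy' (word_injective t' this)
    have z3 : tabCoord hg ((Equiv.swap x y).trans t')
        (θ (vecOrZero P ((Equiv.swap x y).trans t))) = 0 := by
      by_contra hc
      have := ih _ _ hc x hxk
      rw [word_swap, word_swap, Function.comp_apply, Function.comp_apply,
        Equiv.swap_apply_left] at this
      exact hne this
    have hA : P.coeff (word t x) (word t y) = P.coeff (word t' x) (word t' y) := by
      have h1 := congrArg (tabCoord hg t') hT
      rw [tabCoord_T_smul hg ht' hxy, map_add, map_smul, map_smul, z1, z2, smul_zero, mul_zero,
        add_zero, add_zero, smul_eq_mul] at h1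
      exact mul_right_cancel₀ hM h1
    -- The coordinate at the exchanged tableau leaves only an off-diagonal coefficient times the
    -- nonzero entry, so that coefficient would have to vanish. By the equality `hA`, the exchange
    -- of `t` cannot be standard either.
    have hs' : ¬IsStandard mu ((Equiv.swap x y).trans t') := by
      intro hs'
      have h1 := congrArg (tabCoord hg ((Equiv.swap x y).trans t')) hT
      rw [tabCoord_T_smul hg hs' hxy, map_add, map_smul, map_smul, z2, z3, swap_trans_swap,
        smul_zero, smul_zero, mul_zero, zero_add, zero_add, word_swap, Function.comp_apply,
        Function.comp_apply, Equiv.swap_apply_left, Equiv.swap_apply_right] at h1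
      have h2 := (mul_eq_zero.1 h1.symm).resolve_right hM
      exact (hg.coeff_of_swap ht' hxy hs').1 (sub_eq_zero.1 h2).symm
    have hs : ¬IsStandard lam ((Equiv.swap x y).trans t) := by
      intro hs
      have h1 := hg.coeff_of_swap ht hxy hs
      rw [hA] at h1
      have h2 := coeff_of_not_swap (P := P) ht' hxy hs'
      tauto
    -- Both cells of `y` are now adjacent to the common cell of `x`, with coefficient `1` to its
    -- right and `-q` below it. Since `[2]_q ≠ 0`, the coefficient tells the two positions apart.
    have hq : (1 : ℂ) ≠ -P.q := by
      intro e
      apply hg.qInt_ne_zero (word t x).1 2 (by norm_num) (by simp; omega)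
      rw [show (2 : ℤ) = 1 + 1 by norm_num, qInt_add_one P.q_ne_zero, qInt_one]
      linear_combination e
    rcases ht.eq_of_not_swap hxy hs with e | e <;> rcases ht'.eq_of_not_swap hxy hs' with e' | e'
    · rw [e, e', hwx] at hne
      exact hne rfl
    · rw [coeff_row P e, coeff_column P e'] at hA
      exact hq hA
    · rw [coeff_row P e', coeff_column P e] at hA
      exact hq hA.symm
    · rw [e, e', hwx] at hne
      exact hne rfl

theorem hom_eq_zero (hg : P.Generic n) (h : lam ≠ mu) (θ : V P lam →ₗ[ℂ] V P mu)
    (hθ : ∀ (i : Fin n) m, θ (T P i • m) = T P i • θ m) : θ = 0 := by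
  refine (vecBasis hg lam).ext fun t => (vecBasis hg mu).repr.injective (Finsupp.ext fun t' => ?_)
  by_contra hc
  apply h
  apply eq_of_word_eq t.1 t'.1
  apply word_eq_of_tabCoord_ne_zero hg θ hθ
  intro h0
  apply hc
  rw [tabCoord, dif_pos t'.2, vecOrZero_mk, ← vecBasis_apply hg] at h0
  rw [LinearMap.zero_apply, map_zero, Finsupp.zero_apply]
  exact h0

/-- The matrix is diagonal. Commutation with `T_y` equates the entries of two tableaux joined by an
exchange, since the coefficient between them is nonzero, and all tableaux of one shape are
connected. -/
theorem hom_eq_smul (hg : P.Generic n) (θ : V P lam →ₗ[ℂ] V P lam)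
    (hθ : ∀ (i : Fin n) m, θ (T P i • m) = T P i • θ m) : ∃ c : ℂ, ∀ m, θ m = c • m := by
  let a : StdTab lam → ℂ := fun t => (vecBasis hg lam).repr (θ (vec P t)) t
  have ha : ∀ t, θ (vec P t) = a t • vec P t := by
    intro t
    apply (vecBasis hg lam).repr.injective
    ext t'
    rw [← vecBasis_apply hg, map_smul, Module.Basis.repr_self, Finsupp.smul_single, smul_eq_mul,
      mul_one, vecBasis_apply]
    by_cases h : t = t'
    · subst h
      rw [Finsupp.single_eq_same]
    · rw [Finsupp.single_eq_of_ne (Ne.symm h)]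
      by_contra hc
      apply h
      apply StdTab.ext_word
      apply word_eq_of_tabCoord_ne_zero hg θ hθ
      rw [tabCoord, dif_pos t'.2, vecOrZero_mk]
      exact hc
  obtain ⟨t₀⟩ := nonempty_stdTab lam
  have hc : ∀ t, a t = a t₀ := by
    intro t
    refine StdTab.constant_of_swap a (fun t x y hxy hs => ?_) t t₀
    have h1 := hθ y (vec P t)
    have hv : vecOrZero P ((Equiv.swap x y).trans t.1) = vec P (StdTab.mk _ hs) :=
      vecOrZero_mk (StdTab.mk _ hs)
    rw [T_smul_vec t hxy, ha, smul_comm, T_smul_vec t hxy, map_add, map_smul, map_smul, hv, ha,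
      ha, smul_add, smul_comm (a t), add_right_inj, smul_comm (a t)] at h1
    have h2 : (1 - P.coeff (word t.1 x) (word t.1 y)) ≠ 0 := by
      rw [sub_ne_zero]
      exact (hg.coeff_of_swap t.2 hxy hs).1.symm
    have h3 := smul_right_injective _ h2 h1
    have h4 : vec P (StdTab.mk _ hs) ≠ 0 := (linearIndependent_vec hg).ne_zero _
    exact smul_left_injective ℂ h4 h3
  refine ⟨a t₀, fun m => ?_⟩
  suffices h : θ = a t₀ • LinearMap.id from LinearMap.congr_fun h m
  refine (vecBasis hg lam).ext fun t => ?_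
  rw [vecBasis_apply, ha, hc]
  rfl

/-- The projection onto a submodule along a complement is a scalar, so the submodule is zero or
everything. -/
theorem isSimpleModule_V (hss : IsSemisimpleRing (H P n)) (lam : MultiPart p d n) :
    IsSimpleModule (H P n) (V P lam) := by
  have hg := P.generic_of_isSemisimpleRing hss
  obtain ⟨t₀⟩ := nonempty_stdTab lam
  have : Nontrivial (V P lam) :=
    ⟨vec P t₀, 0, (linearIndependent_vec hg).ne_zero _⟩
  rw [isSimpleModule_iff]
  refine { exists_pair_ne := ⟨⊥, ⊤, bot_ne_top⟩, eq_bot_or_eq_top := fun U => ?_ }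
  obtain ⟨W, hW⟩ := exists_isCompl U
  obtain ⟨c, hc⟩ := hom_eq_smul hg
    ((U.subtype ∘ₗ Submodule.projectionOnto U W hW).restrictScalars ℂ) fun i m => by
      simp
  by_cases h0 : c = 0
  · left
    rw [eq_bot_iff]
    intro u hu
    have := hc u
    rw [h0, zero_smul] at this
    have h1 : U.subtype (Submodule.projectionOnto U W hW u) = 0 := this
    have h2 := Submodule.projectionOnto_apply_left hW ⟨u, hu⟩
    exact (congrArg U.subtype h2).symm.trans h1
  · right
    rw [eq_top_iff]
    rintro m -
    have : m = algebraMap ℂ (H P n) c⁻¹ • U.subtype (Submodule.projectionOnto U W hW m) := by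
      have h1 : U.subtype (Submodule.projectionOnto U W hW m) = c • m := hc m
      rw [h1, algebraMap_smul, smul_smul, inv_mul_cancel₀ h0, one_smul]
    rw [this]
    exact U.smul_mem _ (Submodule.coe_mem _)

end Hom

end

section

/-! ### An upper bound for the dimension of the Hecke algebra -/

section Exchange

variable {A : Type*} [Ring A] [Algebra ℂ A] {q : ℂ} {T L X : A} {W : Submodule ℂ A}

/-- The span of the elements `(T L T) ^ c X w` and `L ^ c T X w` with `c ≤ m`. -/
def exchangeSpan (T L X : A) (W : Submodule ℂ A) (m : ℕ) : Submodule ℂ A :=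
  Submodule.span ℂ {y | ∃ c ≤ m, ∃ w ∈ W,
    y = (T * L * T) ^ c * (X * w) ∨ y = L ^ c * (T * (X * w))}

theorem exchangeSpan_left {m c : ℕ} (hc : c ≤ m) {w : A} (hw : w ∈ W) :
    (T * L * T) ^ c * (X * w) ∈ exchangeSpan T L X W m :=
  Submodule.subset_span ⟨c, hc, w, hw, Or.inl rfl⟩

theorem exchangeSpan_right {m c : ℕ} (hc : c ≤ m) {w : A} (hw : w ∈ W) :
    L ^ c * (T * (X * w)) ∈ exchangeSpan T L X W m :=
  Submodule.subset_span ⟨c, hc, w, hw, Or.inr rfl⟩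

theorem mul_mem_exchangeSpan (hLL : Commute L (T * L * T)) (hLX : Commute L X)
    (hLW : ∀ w ∈ W, L * w ∈ W) {m : ℕ} {y : A} (hy : y ∈ exchangeSpan T L X W m) :
    L * y ∈ exchangeSpan T L X W (m + 1) := by
  suffices h : exchangeSpan T L X W m ≤
      (exchangeSpan T L X W (m + 1)).comap (LinearMap.mulLeft ℂ L) from h hy
  refine Submodule.span_le.2 ?_
  rintro y ⟨c, hc, w, hw, rfl | rfl⟩
  · change L * _ ∈ exchangeSpan T L X W (m + 1)
    rw [← mul_assoc, (hLL.pow_right c).eq, mul_assoc ((T * L * T) ^ c), ← mul_assoc L, hLX.eq,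
      mul_assoc X]
    exact exchangeSpan_left (hc.trans m.le_succ) (hLW w hw)
  · change L * _ ∈ exchangeSpan T L X W (m + 1)
    rw [← mul_assoc, ← pow_succ']
    exact exchangeSpan_right (Nat.succ_le_succ hc) hw

theorem pow_mul_mem {L : A} (hLW : ∀ w ∈ W, L * w ∈ W) (c : ℕ) {w : A} (hw : w ∈ W) :
    L ^ c * w ∈ W := by
  induction c with
  | zero => simpa using hw
  | succ c ih => rw [pow_succ', mul_assoc]; exact hLW _ ih

/-- On the first kind of generators the exponent grows. On the second, `T L T` passes `L ^ c`, the
relation `T L T T = (1 - q) T L T + q T L` applies, and the remaining factors `L` pass `X` into `W`.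
-/
theorem conj_mul_mem_exchangeSpan (hT : T * T = (1 - q) • T + q • 1)
    (hLL : Commute L (T * L * T)) (hLX : Commute L X)
    (hLW : ∀ w ∈ W, L * w ∈ W) {m : ℕ} {y : A} (hy : y ∈ exchangeSpan T L X W m) :
    T * L * T * y ∈ exchangeSpan T L X W (m + 1) := by
  suffices h : exchangeSpan T L X W m ≤
      (exchangeSpan T L X W (m + 1)).comap (LinearMap.mulLeft ℂ (T * L * T)) from h hy
  refine Submodule.span_le.2 ?_
  rintro y ⟨c, hc, w, hw, rfl | rfl⟩
  · change T * L * T * _ ∈ exchangeSpan T L X W (m + 1)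
    rw [← mul_assoc, ← pow_succ']
    exact exchangeSpan_left (Nat.succ_le_succ hc) hw
  · have e1 : T * L * T * (T * (X * w)) =
        (1 - q) • (T * L * T * (X * w)) + q • (T * (X * (L * w))) := by
      have : T * L * T * (T * (X * w)) = T * L * (T * T) * (X * w) := by noncomm_ring
      rw [this, hT, ← mul_assoc X, ← hLX.eq]
      simp only [mul_add, add_mul, mul_smul_comm, smul_mul_assoc, mul_one, mul_assoc]
    have e2 : T * L * T * (L ^ c * (T * (X * w))) =
        (1 - q) • ((T * L * T) ^ 1 * (X * (L ^ c * w))) +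
          q • (L ^ c * (T * (X * (L * w)))) := by
      rw [← mul_assoc, ← (hLL.pow_left c).eq, mul_assoc, e1, mul_add, mul_smul_comm,
        mul_smul_comm, ← mul_assoc (L ^ c) (T * L * T), (hLL.pow_left c).eq, mul_assoc,
        ← mul_assoc (L ^ c) X, (hLX.pow_left c).eq, pow_one, mul_assoc X]
    change T * L * T * _ ∈ exchangeSpan T L X W (m + 1)
    rw [e2]
    exact add_mem (Submodule.smul_mem _ _ (exchangeSpan_left (by omega) (pow_mul_mem hLW c hw)))
      (Submodule.smul_mem _ _ (exchangeSpan_right (by omega) (hLW w hw)))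

/-- From `T (T L T) = (1 - q) T L T + q L T`, by induction on the exponent; the exponent `a` is not
exceeded. -/
theorem mul_pow_conj_mem (hT : T * T = (1 - q) • T + q • 1)
    (hLL : Commute L (T * L * T)) (hLX : Commute L X)
    (hLW : ∀ w ∈ W, L * w ∈ W) (a : ℕ) {w : A} (hw : w ∈ W) :
    T * ((T * L * T) ^ a * (X * w)) ∈ exchangeSpan T L X W a := by
  induction a with
  | zero => simpa using exchangeSpan_right (c := 0) le_rfl hw
  | succ a ih =>
    have e : T * ((T * L * T) ^ (a + 1) * (X * w)) =
        (1 - q) • ((T * L * T) ^ (a + 1) * (X * w)) +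
          q • (L * (T * ((T * L * T) ^ a * (X * w)))) := by
      have : T * ((T * L * T) ^ (a + 1) * (X * w)) =
          T * T * L * T * ((T * L * T) ^ a * (X * w)) := by
        rw [pow_succ']; noncomm_ring
      rw [this, hT, pow_succ']
      simp only [add_mul, smul_mul_assoc, one_mul, mul_assoc]
    rw [e]
    exact add_mem (Submodule.smul_mem _ _ (exchangeSpan_left le_rfl hw))
      (Submodule.smul_mem _ _ (mul_mem_exchangeSpan hLL hLX hLW ih))

/-- Since `q` is invertible, `T L` equals `q⁻¹ (T L T T - (1 - q) T L T)`, which moves `T` past one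
factor `L` at a time. -/
theorem mul_pow_mem (hq : q ≠ 0) (hT : T * T = (1 - q) • T + q • 1)
    (hLL : Commute L (T * L * T)) (hLX : Commute L X)
    (hLW : ∀ w ∈ W, L * w ∈ W) (a : ℕ) {w : A} (hw : w ∈ W) :
    T * (L ^ a * (T * (X * w))) ∈ exchangeSpan T L X W a := by
  induction a with
  | zero =>
    rw [pow_zero, one_mul, ← mul_assoc, hT, add_mul, smul_mul_assoc, smul_mul_assoc, one_mul]
    refine add_mem (Submodule.smul_mem _ _ ?_) (Submodule.smul_mem _ _ ?_)
    · simpa using exchangeSpan_right (c := 0) le_rfl hw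
    · simpa using exchangeSpan_left (c := 0) le_rfl hw
  | succ a ih =>
    have e0 : T * L = q⁻¹ • (T * L * T * T - (1 - q) • (T * L * T)) := by
      rw [mul_assoc (T * L), hT, mul_add, mul_smul_comm, mul_smul_comm, add_sub_cancel_left,
        smul_smul, inv_mul_cancel₀ hq, one_smul, mul_one]
    have e : T * (L ^ (a + 1) * (T * (X * w))) =
        q⁻¹ • (T * L * T * (T * (L ^ a * (T * (X * w)))) -
          (1 - q) • (T * L * T * (L ^ a * (T * (X * w))))) := by
      rw [pow_succ', mul_assoc L, ← mul_assoc T L]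
      refine (congrArg (· * (L ^ a * (T * (X * w)))) e0).trans ?_
      simp only [smul_mul_assoc, sub_mul, mul_assoc]
    rw [e]
    exact Submodule.smul_mem _ _ (sub_mem (conj_mul_mem_exchangeSpan hT hLL hLX hLW ih)
      (Submodule.smul_mem _ _
        (conj_mul_mem_exchangeSpan hT hLL hLX hLW (exchangeSpan_right le_rfl hw))))

end Exchange

end

section

/-! ### Jucys–Murphy elements -/

section JucysMurphy

variable {A : Type*} [Ring A]

/-- The Jucys–Murphy elements `L₀ = X₀`, `L_{j+1} = X_{j+1} L_j X_{j+1}`. -/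
def jucysMurphy (X : ℕ → A) : ℕ → A
  | 0 => X 0
  | j + 1 => X (j + 1) * jucysMurphy X j * X (j + 1)

/-- The product `X_{j+1} ⋯ X_{j+m}`. -/
def ascend (X : ℕ → A) : ℕ → ℕ → A
  | _, 0 => 1
  | j, m + 1 => X (j + 1) * ascend X (j + 1) m

/-- The braid relations of type `B` among `X₀, …, X_{n-1}`. -/
structure IsBraidFamily (n : ℕ) (X : ℕ → A) : Prop where
  comm : ∀ i j, i + 1 < j → j < n → Commute (X i) (X j)
  braid : ∀ i, 1 ≤ i → i + 1 < n → X i * X (i + 1) * X i = X (i + 1) * X i * X (i + 1)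
  braid_four : 1 < n → X 0 * X 1 * X 0 * X 1 = X 1 * X 0 * X 1 * X 0

variable {n : ℕ} {X : ℕ → A}

theorem commute_jucysMurphy_of_gt (hX : IsBraidFamily n X) {i j : ℕ} (h : j + 1 < i) (hi : i < n) :
    Commute (X i) (jucysMurphy X j) := by
  induction j with
  | zero => exact (hX.comm 0 i h hi).symm
  | succ j ih =>
    have h1 := (hX.comm (j + 1) i h hi).symm
    exact (h1.mul_right (ih (by omega))).mul_right h1

/-- Only `j = i + 1` is not immediate. For `i = 0` it is the braid relation of length four;
otherwise two braid moves suffice, since `X (i + 1)` commutes with the element of index `i - 1`. -/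
theorem commute_jucysMurphy_of_lt (hX : IsBraidFamily n X) {i j : ℕ} (h : i < j) (hj : j < n) :
    Commute (X i) (jucysMurphy X j) := by
  induction j with
  | zero => omega
  | succ j ih =>
    rcases Nat.lt_succ_iff_lt_or_eq.1 h with h' | rfl
    · have h1 := hX.comm i (j + 1) (by omega) hj
      exact (h1.mul_right (ih h' (by omega))).mul_right h1
    · cases i with
      | zero =>
        have := hX.braid_four (by omega)
        change X 0 * (X 1 * X 0 * X 1) = X 1 * X 0 * X 1 * X 0
        rw [← this]
        noncomm_ring
      | succ i =>
        have hb := hX.braid (i + 1) (by omega) hj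
        have hc := commute_jucysMurphy_of_gt hX (j := i) (i := i + 1 + 1) (by omega) hj
        change X (i + 1) * (X (i + 1 + 1) * (X (i + 1) * jucysMurphy X i * X (i + 1)) * X (i + 1 + 1)) =
          X (i + 1 + 1) * (X (i + 1) * jucysMurphy X i * X (i + 1)) * X (i + 1 + 1) * X (i + 1)
        generalize X (i + 1) = a at *
        generalize X (i + 1 + 1) = b at *
        generalize jucysMurphy X i = l at *
        calc a * (b * (a * l * a) * b) = (a * b * a) * l * a * b := by noncomm_ring
          _ = b * a * (b * l) * a * b := by rw [hb]; noncomm_ring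
          _ = b * a * l * (b * a * b) := by rw [hc.eq]; noncomm_ring
          _ = b * (a * l * a) * b * a := by rw [← hb]; noncomm_ring

theorem jucysMurphy_commute_of_forall {y : A} {j : ℕ} (h : ∀ i ≤ j, Commute (X i) y) :
    Commute (jucysMurphy X j) y := by
  induction j with
  | zero => exact h 0 le_rfl
  | succ j ih =>
    have h1 := h (j + 1) le_rfl
    exact (h1.mul_left (ih fun i hi => h i (by omega))).mul_left h1

theorem commute_jucysMurphy_succ (hX : IsBraidFamily n X) {j : ℕ} (hj : j + 1 < n) :
    Commute (jucysMurphy X j) (X (j + 1) * jucysMurphy X j * X (j + 1)) :=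
  jucysMurphy_commute_of_forall fun i hi =>
    commute_jucysMurphy_of_lt hX (j := j + 1) (by omega) hj

theorem commute_ascend (hX : IsBraidFamily n X) {i j m : ℕ} (h : i < j) (hm : j + m < n) :
    Commute (X i) (ascend X j m) := by
  induction m generalizing j with
  | zero => exact Commute.one_right _
  | succ m ih =>
    exact (hX.comm i (j + 1) (by omega) (by omega)).mul_right (ih (by omega) (by omega))

theorem commute_jucysMurphy_ascend (hX : IsBraidFamily n X) {i j m : ℕ} (h : i < j)
    (hm : j + m < n) : Commute (jucysMurphy X i) (ascend X j m) :=
  jucysMurphy_commute_of_forall fun k hk => commute_ascend hX (by omega) hm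

/-- A generator passes through an ascending product with its index lowered by one: it commutes with
the early factors, makes one braid move, and commutes with the rest. -/
theorem mul_ascend (hX : IsBraidFamily n X) {i j m : ℕ} (h : j < i) (hi : i < j + m)
    (hm : j + m < n) : X (i + 1) * ascend X j m = ascend X j m * X i := by
  induction m generalizing j with
  | zero => omega
  | succ m ih =>
    change X (i + 1) * (X (j + 1) * ascend X (j + 1) m) = X (j + 1) * ascend X (j + 1) m * X i
    rcases Nat.lt_or_eq_of_le (Nat.succ_le_of_lt h) with h' | h'
    · rw [← mul_assoc, ← (hX.comm (j + 1) (i + 1) (by omega) (by omega)).eq, mul_assoc,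
        ih h' (by omega) (by omega), mul_assoc]
    · have h' : i = j + 1 := by omega
      subst h'
      cases m with
      | zero => omega
      | succ m =>
        have hb := hX.braid (j + 1) (by omega) (by omega)
        have hc := commute_ascend hX (i := j + 1) (j := j + 1 + 1) (m := m) (by omega) (by omega)
        change X (j + 1 + 1) * (X (j + 1) * (X (j + 1 + 1) * ascend X (j + 1 + 1) m)) =
          X (j + 1) * (X (j + 1 + 1) * ascend X (j + 1 + 1) m) * X (j + 1)
        generalize X (j + 1) = a at *
        generalize X (j + 1 + 1) = b at *
        generalize ascend X (j + 1 + 1) m = l at *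
        calc b * (a * (b * l)) = (b * a * b) * l := by noncomm_ring
          _ = a * b * (a * l) := by rw [← hb]; noncomm_ring
          _ = a * (b * l) * a := by rw [hc.eq]; noncomm_ring

end JucysMurphy

/-! ### The inductive spanning argument -/

section Dimension

variable {A : Type*} [Ring A] [Algebra ℂ A] {n r : ℕ} {X : ℕ → A} {q : ℂ}

/-- The sum of the spaces `L_j ^ a X_{j+1} ⋯ X_k W` with `j ≤ k` and `a < r`. -/
def nextSpan (X : ℕ → A) (r k : ℕ) (W : Submodule ℂ A) : Submodule ℂ A :=
  ⨆ x : Fin (k + 1) × Fin r,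
    W.map (LinearMap.mulLeft ℂ (jucysMurphy X x.1 ^ x.2.val * ascend X x.1 (k - x.1)))

theorem mem_nextSpan {k j a : ℕ} {W : Submodule ℂ A} (hj : j ≤ k) (ha : a < r) {w : A}
    (hw : w ∈ W) : jucysMurphy X j ^ a * (ascend X j (k - j) * w) ∈ nextSpan X r k W := by
  refine Submodule.mem_iSup_of_mem (⟨⟨j, by omega⟩, ⟨a, ha⟩⟩ : Fin (k + 1) × Fin r) ?_
  exact ⟨w, hw, mul_assoc _ _ _⟩

theorem exchangeSpan_le_nextSpan {k j a : ℕ} {W : Submodule ℂ A} (hj : j + 1 ≤ k) (ha : a < r) :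
    exchangeSpan (X (j + 1)) (jucysMurphy X j) (ascend X (j + 1) (k - (j + 1))) W a ≤
      nextSpan X r k W := by
  refine Submodule.span_le.2 ?_
  rintro y ⟨c, hc, w, hw, rfl | rfl⟩
  · exact mem_nextSpan (j := j + 1) hj (by omega) hw
  · have := mem_nextSpan (X := X) (j := j) (k := k) (r := r) (a := c) (by omega) (by omega) hw
    have e : k - j = (k - (j + 1)) + 1 := by omega
    rw [e] at this
    rw [SetLike.mem_coe]
    simpa only [ascend, mul_assoc] using this

/-- The product of `X i` with a term of index `j` depends on the position of `i`. For `i < j` or `i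
> j + 1` the generator moves through to `W`; for `i = j > 0` or `i = j + 1` the exchange lemmas
apply; for `i = j = 0` powers of `X 0` are reduced by `f`. -/
theorem mul_mem_nextSpan (hX : IsBraidFamily n X) (hq : q ≠ 0)
    (hquad : ∀ i, 1 ≤ i → i < n → X i * X i = (1 - q) • X i + q • 1)
    {f : Polynomial ℂ} (hf : f.Monic) (hdeg : f.natDegree = r) (hf0 : Polynomial.aeval (X 0) f = 0)
    {k : ℕ} (hk : k < n) {W : Submodule ℂ A} (hW : ∀ i < k, ∀ w ∈ W, X i * w ∈ W)
    {i : ℕ} (hi : i ≤ k) {y : A} (hy : y ∈ nextSpan X r k W) : X i * y ∈ nextSpan X r k W := by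
  have hLW : ∀ j < k, ∀ w ∈ W, jucysMurphy X j * w ∈ W := by
    intro j hj
    induction j with
    | zero => exact hW 0 hj
    | succ j ih =>
      intro w hw
      change X (j + 1) * jucysMurphy X j * X (j + 1) * w ∈ W
      rw [mul_assoc, mul_assoc]
      exact hW _ hj _ (ih (by omega) _ (hW _ hj _ hw))
  suffices h : nextSpan X r k W ≤ (nextSpan X r k W).comap (LinearMap.mulLeft ℂ (X i)) from h hy
  refine iSup_le ?_
  rintro ⟨⟨j, hj⟩, ⟨a, ha⟩⟩ _ ⟨w, hw, rfl⟩
  change X i * (jucysMurphy X j ^ a * ascend X j (k - j) * w) ∈ nextSpan X r k W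
  rw [mul_assoc (jucysMurphy X j ^ a)]
  rcases lt_trichotomy i j with hij | rfl | hij
  · rw [← mul_assoc, ((commute_jucysMurphy_of_lt hX hij (by omega)).pow_right a).eq, mul_assoc,
      ← mul_assoc (X i), (commute_ascend hX hij (by omega)).eq, mul_assoc (ascend X j (k - j))]
    exact mem_nextSpan (by omega) ha (hW _ (by omega) _ hw)
  · cases i with
    | zero =>
      -- Division by the monic polynomial `f` of degree `r` keeps all exponents below `r`.
      have key : ∀ g : Polynomial ℂ,
          Polynomial.aeval (X 0) g * (ascend X 0 (k - 0) * w) ∈ nextSpan X r k W := by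
        intro g
        have e : Polynomial.aeval (X 0) g = Polynomial.aeval (X 0) (g %ₘ f) := by
          conv_lhs => rw [← Polynomial.modByMonic_add_div g f]
          rw [map_add, map_mul, hf0, zero_mul, add_zero]
        rcases Nat.eq_zero_or_pos r with rfl | hr
        · omega
        have hlt : (g %ₘ f).natDegree < r := by
          rw [← hdeg]
          refine Polynomial.natDegree_modByMonic_lt g hf ?_
          rintro rfl
          simp at hdeg
          omega
        rw [e, Polynomial.aeval_eq_sum_range' hlt, Finset.sum_mul]
        refine Submodule.sum_mem _ fun b hb => ?_
        rw [smul_mul_assoc]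
        exact Submodule.smul_mem _ _ (mem_nextSpan (j := 0) (by omega) (Finset.mem_range.1 hb) hw)
      have := key (Polynomial.X ^ (a + 1))
      rw [map_pow, Polynomial.aeval_X, pow_succ', mul_assoc] at this
      exact this
    | succ j =>
      exact exchangeSpan_le_nextSpan (by omega) ha
        (mul_pow_conj_mem (hquad _ (by omega) (by omega)) (commute_jucysMurphy_succ hX (by omega))
          (commute_jucysMurphy_ascend hX (by omega) (by omega)) (hLW j (by omega)) a hw)
  · rcases Nat.lt_or_eq_of_le (Nat.succ_le_of_lt hij) with h' | h'
    · obtain ⟨i, rfl⟩ : ∃ i', i = i' + 1 := ⟨i - 1, by omega⟩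
      rw [← mul_assoc, ((commute_jucysMurphy_of_gt hX h' (by omega)).pow_right a).eq, mul_assoc,
        ← mul_assoc (X (i + 1)), mul_ascend hX (by omega) (by omega) (by omega),
        mul_assoc (ascend X j (k - j))]
      exact mem_nextSpan (by omega) ha (hW _ (by omega) _ hw)
    · have h' : i = j + 1 := by omega
      subst h'
      have e : k - j = (k - (j + 1)) + 1 := by omega
      have := exchangeSpan_le_nextSpan (by omega) ha
        (mul_pow_mem hq (hquad _ (by omega) (by omega)) (commute_jucysMurphy_succ hX (by omega))
          (commute_jucysMurphy_ascend hX (m := k - (j + 1)) (by omega) (by omega))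
          (hLW j (by omega)) a hw)
      rw [e]
      simpa only [ascend, mul_assoc] using this

/-- For `r > 0` the term `j = k`, `a = 0` contains it. For `r = 0` the polynomial is `1`, and the
algebra is zero. -/
theorem one_mem_nextSpan {f : Polynomial ℂ} (hf : f.Monic) (hdeg : f.natDegree = r)
    (hf0 : Polynomial.aeval (X 0) f = 0) {k : ℕ} {W : Submodule ℂ A} (h1 : 1 ∈ W) :
    1 ∈ nextSpan X r k W := by
  rcases Nat.eq_zero_or_pos r with rfl | hr
  · rw [Polynomial.natDegree_eq_zero_iff_degree_le_zero, Polynomial.degree_le_zero_iff] at hdeg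
    have : f = 1 := hf.natDegree_eq_zero.1 (by rw [hdeg, Polynomial.natDegree_C])
    rw [this, map_one] at hf0
    rw [hf0]
    exact zero_mem _
  · have := mem_nextSpan (X := X) (le_refl k) hr h1
    rwa [Nat.sub_self, pow_zero, ascend, one_mul, one_mul] at this

theorem finrank_iSup_le {ι : Type*} [Fintype ι] (U : ι → Submodule ℂ A)
    [∀ i, FiniteDimensional ℂ (U i)] :
    Module.finrank ℂ (⨆ i, U i : Submodule ℂ A) ≤ ∑ i, Module.finrank ℂ (U i) := by
  classical
  rw [← Finset.sup_univ_eq_iSup]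
  induction (Finset.univ : Finset ι) using Finset.induction_on with
  | empty => simp
  | insert i s hi ih =>
    rw [Finset.sup_insert, Finset.sum_insert hi]
    exact (Submodule.finrank_add_le_finrank_add_finrank _ _).trans (Nat.add_le_add_left ih _)

theorem exists_submodule_finrank_le (hX : IsBraidFamily n X) (hq : q ≠ 0)
    (hquad : ∀ i, 1 ≤ i → i < n → X i * X i = (1 - q) • X i + q • 1)
    {f : Polynomial ℂ} (hf : f.Monic) (hdeg : f.natDegree = r)
    (hf0 : 0 < n → Polynomial.aeval (X 0) f = 0) {k : ℕ} (hk : k ≤ n) :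
    ∃ W : Submodule ℂ A, FiniteDimensional ℂ W ∧
      Module.finrank ℂ W ≤ r ^ k * k.factorial ∧ 1 ∈ W ∧ ∀ i < k, ∀ w ∈ W, X i * w ∈ W := by
  induction k with
  | zero =>
    refine ⟨Submodule.span ℂ {1}, inferInstance, ?_, Submodule.mem_span_singleton_self _, ?_⟩
    · simpa using finrank_span_le_card (R := ℂ) ({1} : Set A)
    · intro i hi; omega
  | succ k ih =>
    obtain ⟨W, hfd, hdim, h1, hW⟩ := ih (by omega)
    refine ⟨nextSpan X r k W, ?_, ?_, one_mem_nextSpan hf hdeg (hf0 (by omega)) h1, ?_⟩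
    · exact Submodule.finiteDimensional_iSup _
    · refine (finrank_iSup_le _).trans ?_
      refine (Finset.sum_le_sum fun x _ => (Submodule.finrank_map_le _ W).trans hdim).trans ?_
      rw [Finset.sum_const, Finset.card_univ, Fintype.card_prod, Fintype.card_fin,
        Fintype.card_fin, Nat.factorial_succ, pow_succ, smul_eq_mul]
      exact le_of_eq (by ring)
    · intro i hi w hw
      exact mul_mem_nextSpan hX hq hquad hf hdeg (hf0 (by omega)) (by omega) hW (by omega) hw

end Dimension

section HeckeDimension

variable {p d n : ℕ} (P : Params p d)

theorem exists_finrank_le : FiniteDimensional ℂ (H P n) ∧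
    Module.finrank ℂ (H P n) ≤ (d * p) ^ n * n.factorial := by
  have hT : IsHeckeFamily (d * p) n P.u P.q (T P (n := n)) := isHeckeFamily_gen
  let X : ℕ → H P n := fun i => if h : i < n then T P ⟨i, h⟩ else 0
  have hXT : ∀ i (h : i < n), X i = T P ⟨i, h⟩ := fun i h => dif_pos h
  have hX : IsBraidFamily n X := by
    refine ⟨fun i j hij hj => ?_, fun i hi hin => ?_, fun h1 => ?_⟩
    · rw [hXT i (by omega), hXT j hj]
      exact hT.comm _ _ hij
    · rw [hXT i (by omega), hXT (i + 1) hin]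
      exact hT.braid _ _ hi rfl
    · rw [hXT 0 (by omega), hXT 1 h1]
      exact hT.braid_four _ _ rfl rfl
  obtain ⟨W, hfd, hdim, h1, hW⟩ := exists_submodule_finrank_le (r := d * p) hX P.q_ne_zero
    (fun i hi hin => by rw [hXT i hin]; exact hT.quadratic _ hi)
    (f := ∏ k : Fin (d * p), (Polynomial.X - Polynomial.C (P.u k)))
    (Polynomial.monic_prod_of_monic _ _ fun k _ => Polynomial.monic_X_sub_C _)
    (by
      rw [Polynomial.natDegree_prod_of_monic _ _ fun k _ => Polynomial.monic_X_sub_C _]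
      simp)
    (fun h0 => by rw [hXT 0 h0]; exact hT.cyclotomic _ rfl) le_rfl
  -- A space that contains `1` and is stable under left multiplication by the generators is
  -- everything.
  have htop : W = ⊤ := by
    let S : Subalgebra ℂ (H P n) :=
      { carrier := {h | ∀ w ∈ W, h * w ∈ W}
        mul_mem' := fun {a b} ha hb w hw => by
          rw [mul_assoc]
          exact ha _ (hb _ hw)
        add_mem' := fun {a b} ha hb w hw => by
          rw [add_mul]
          exact add_mem (ha _ hw) (hb _ hw)
        algebraMap_mem' := fun c w hw => by
          rw [← Algebra.smul_def]
          exact W.smul_mem c hw }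
    rw [eq_top_iff]
    rintro x -
    have := mem_of_T S (fun i w hw => by
      have := hW i.1 i.2 w hw
      rwa [hXT i.1 i.2] at this) x 1 h1
    rwa [mul_one] at this
  subst htop
  exact ⟨Module.finite_def.2 ((Submodule.fg_top _).1 (Module.finite_def.1 hfd)),
    by rwa [finrank_top] at hdim⟩

end HeckeDimension

end

section

/-! ### The graph of multipartitions is a differential poset -/

section LowSets

variable {I : Type} [DecidableEq I]

/-- Finite sets of cells whose components are Young diagrams. -/
def IsLow (S : Finset (I × (ℕ × ℕ))) : Prop :=
  ∀ (c : I) (x y : ℕ × ℕ), x ≤ y → (c, y) ∈ S → (c, x) ∈ S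

theorem IsLow.union {S U : Finset (I × (ℕ × ℕ))} (hS : IsLow S) (hU : IsLow U) : IsLow (S ∪ U) := by
  intro c x y hxy hy
  rw [Finset.mem_union] at hy ⊢
  exact hy.imp (hS c x y hxy) (hU c x y hxy)

theorem IsLow.inter {S U : Finset (I × (ℕ × ℕ))} (hS : IsLow S) (hU : IsLow U) : IsLow (S ∩ U) := by
  intro c x y hxy hy
  rw [Finset.mem_inter] at hy ⊢
  exact hy.imp (hS c x y hxy) (hU c x y hxy)

theorem IsLow.lt_card {S : Finset (I × (ℕ × ℕ))} (hS : IsLow S) {c : I} {i j : ℕ}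
    (h : (c, (i, j)) ∈ S) : i < S.card ∧ j < S.card := by
  constructor
  · have : (Finset.range (i + 1)).image (fun k => (c, (k, j))) ⊆ S := by
      intro z hz
      obtain ⟨k, hk, rfl⟩ := Finset.mem_image.1 hz
      exact hS c (k, j) (i, j) ⟨Nat.lt_succ_iff.1 (Finset.mem_range.1 hk), le_rfl⟩ h
    have h1 := Finset.card_le_card this
    rw [Finset.card_image_of_injective _ (fun a b hab => by simpa using hab),
      Finset.card_range] at h1
    omega
  · have : (Finset.range (j + 1)).image (fun k => (c, (i, k))) ⊆ S := by
      intro z hz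
      obtain ⟨k, hk, rfl⟩ := Finset.mem_image.1 hz
      exact hS c (i, k) (i, j) ⟨le_rfl, Nat.lt_succ_iff.1 (Finset.mem_range.1 hk)⟩ h
    have h1 := Finset.card_le_card this
    rw [Finset.card_image_of_injective _ (fun a b hab => by simpa using hab),
      Finset.card_range] at h1
    omega

theorem IsLow.exists_rowLen {S : Finset (I × (ℕ × ℕ))} (hS : IsLow S) :
    ∃ len : I → ℕ → ℕ, (∀ c i j, (c, (i, j)) ∈ S ↔ j < len c i) ∧
      ∀ c i, len c (i + 1) ≤ len c i := by
  classical
  have hex : ∀ c i, ∃ j, (c, (i, j)) ∉ S := fun c i =>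
    ⟨S.card, fun h => absurd (hS.lt_card h).2 (lt_irrefl _)⟩
  have hiff : ∀ c i j, (c, (i, j)) ∈ S ↔ j < Nat.find (hex c i) := by
    intro c i j
    constructor
    · intro h
      by_contra hlt
      exact Nat.find_spec (hex c i) (hS c (i, _) (i, j) ⟨le_rfl, not_lt.1 hlt⟩ h)
    · intro h
      by_contra hn
      exact Nat.find_min (hex c i) h hn
  refine ⟨fun c i => Nat.find (hex c i), hiff, fun c i => ?_⟩
  by_contra h
  have h1 := (hiff c (i + 1) _).2 (not_le.1 h)
  have h2 := hS c (i, Nat.find (hex c i)) (i + 1, _) ⟨Nat.le_succ i, le_rfl⟩ h1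
  exact absurd ((hiff c i _).1 h2) (lt_irrefl _)

theorem isLow_insert_iff {S : Finset (I × (ℕ × ℕ))} {len : I → ℕ → ℕ}
    (hmem : ∀ c i j, (c, (i, j)) ∈ S ↔ j < len c i) (hanti : ∀ c i, len c (i + 1) ≤ len c i)
    (c : I) (i j : ℕ) : ((c, (i, j)) ∉ S ∧ IsLow (insert (c, (i, j)) S)) ↔
      j = len c i ∧ ∀ k, i = k + 1 → len c i < len c k := by
  have hlow : ∀ c i i', i' ≤ i → len c i ≤ len c i' := fun c i i' h =>
    antitone_nat_of_succ_le (hanti c) h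
  constructor
  · rintro ⟨hn, h⟩
    rw [hmem, not_lt] at hn
    have hj : j = len c i := by
      refine le_antisymm (not_lt.1 fun hlt => ?_) hn
      have := h c (i, len c i) (i, j) ⟨le_rfl, hlt.le⟩ (Finset.mem_insert_self _ _)
      rw [Finset.mem_insert, hmem] at this
      rcases this with h1 | h1
      · simp at h1; omega
      · omega
    refine ⟨hj, fun k hk => ?_⟩
    subst hk
    have := h c (k, j) (k + 1, j) ⟨Nat.le_succ k, le_rfl⟩ (Finset.mem_insert_self _ _)
    rw [Finset.mem_insert, hmem] at this
    rcases this with h1 | h1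
    · simp at h1
    · omega
  · rintro ⟨rfl, h⟩
    refine ⟨by rw [hmem]; exact lt_irrefl _, ?_⟩
    rintro c' ⟨a, b⟩ ⟨a', b'⟩ hab hy
    obtain ⟨ha, hb⟩ : a ≤ a' ∧ b ≤ b' := hab
    rw [Finset.mem_insert, hmem] at hy ⊢
    rcases hy with hy | hy
    · simp only [Prod.mk.injEq] at hy
      obtain ⟨rfl, rfl, rfl⟩ := hy
      rcases Nat.lt_or_eq_of_le ha with ha | rfl
      · right
        obtain ⟨k, rfl⟩ : ∃ k, a' = k + 1 := ⟨a' - 1, by omega⟩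
        have := h k rfl
        have := hlow c' k a (by omega)
        omega
      · rcases Nat.lt_or_eq_of_le hb with hb | rfl
        · exact Or.inr hb
        · exact Or.inl rfl
    · have := hlow c' a' a ha
      exact Or.inr (by omega)

theorem isLow_erase_iff {S : Finset (I × (ℕ × ℕ))} {len : I → ℕ → ℕ}
    (hmem : ∀ c i j, (c, (i, j)) ∈ S ↔ j < len c i) (hanti : ∀ c i, len c (i + 1) ≤ len c i)
    (c : I) (i j : ℕ) : ((c, (i, j)) ∈ S ∧ IsLow (S.erase (c, (i, j)))) ↔
      j + 1 = len c i ∧ len c (i + 1) < len c i := by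
  have hlow : ∀ c i i', i' ≤ i → len c i ≤ len c i' := fun c i i' h =>
    antitone_nat_of_succ_le (hanti c) h
  constructor
  · rintro ⟨hn, h⟩
    rw [hmem] at hn
    have h1 : ¬ j + 1 < len c i := fun hlt => by
      have := h c (i, j) (i, j + 1) ⟨le_rfl, Nat.le_succ j⟩
        (Finset.mem_erase.2 ⟨by simp, (hmem _ _ _).2 hlt⟩)
      simp at this
    have h2 : ¬ j < len c (i + 1) := fun hlt => by
      have := h c (i, j) (i + 1, j) ⟨Nat.le_succ i, le_rfl⟩
        (Finset.mem_erase.2 ⟨by simp, (hmem _ _ _).2 hlt⟩)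
      simp at this
    omega
  · rintro ⟨hj, hlt⟩
    refine ⟨(hmem _ _ _).2 (by omega), ?_⟩
    rintro c' ⟨a, b⟩ ⟨a', b'⟩ hab hy
    obtain ⟨ha, hb⟩ : a ≤ a' ∧ b ≤ b' := hab
    rw [Finset.mem_erase, hmem] at hy ⊢
    have := hlow c' a' a ha
    obtain ⟨hy1, hy2⟩ := hy
    refine ⟨fun he => hy1 ?_, by omega⟩
    simp only [Prod.mk.injEq] at he ⊢
    obtain ⟨rfl, rfl, rfl⟩ := he
    rcases Nat.lt_or_eq_of_le ha with ha | rfl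
    · have := hlow c' a' (a + 1) ha
      exfalso
      omega
    · exact ⟨rfl, rfl, by omega⟩

variable [Fintype I]

open Classical in
/-- The low sets with `n` elements. -/
def lowSets (I : Type) [Fintype I] [DecidableEq I] (n : ℕ) : Finset (Finset (I × (ℕ × ℕ))) :=
  ((Finset.univ ×ˢ (Finset.range n ×ˢ Finset.range n)).powersetCard n).filter fun S => IsLow S

theorem mem_lowSets {n : ℕ} {S : Finset (I × (ℕ × ℕ))} :
    S ∈ lowSets I n ↔ IsLow S ∧ S.card = n := by
  classical
  rw [lowSets, Finset.mem_filter, Finset.mem_powersetCard]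
  constructor
  · rintro ⟨⟨-, h⟩, h'⟩
    exact ⟨h', h⟩
  · rintro ⟨h, rfl⟩
    refine ⟨⟨?_, rfl⟩, h⟩
    rintro ⟨c, i, j⟩ hz
    have := h.lt_card hz
    simp [this.1, this.2]

theorem lowSets_zero : lowSets I 0 = {∅} := by
  ext S
  rw [mem_lowSets, Finset.card_eq_zero, Finset.mem_singleton]
  refine ⟨fun h => h.2, fun h => ⟨?_, h⟩⟩
  subst h
  intro c x y _ hy
  simp at hy

/-- A low set has `|I|` more upper than lower covers. -/
theorem card_insert_eq (S : Finset (I × (ℕ × ℕ))) (hS : IsLow S)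
    (U D : Finset (I × (ℕ × ℕ))) (hU : ∀ x, x ∈ U ↔ x ∉ S ∧ IsLow (insert x S))
    (hD : ∀ x, x ∈ D ↔ x ∈ S ∧ IsLow (S.erase x)) : U.card = D.card + Fintype.card I := by
  obtain ⟨len, hmem, hanti⟩ := hS.exists_rowLen
  have hU' : ∀ c i j, (c, (i, j)) ∈ U ↔ j = len c i ∧ ∀ k, i = k + 1 → len c i < len c k :=
    fun c i j => (hU _).trans (isLow_insert_iff hmem hanti c i j)
  have hD' : ∀ c i j, (c, (i, j)) ∈ D ↔ j + 1 = len c i ∧ len c (i + 1) < len c i :=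
    fun c i j => (hD _).trans (isLow_erase_iff hmem hanti c i j)
  -- A removable corner in row `i` corresponds to an addable corner in row `i + 1`; the remaining
  -- addable corners are those in row `0`, one in each component.
  have hUeq : U = D.image (fun x => (x.1, (x.2.1 + 1, len x.1 (x.2.1 + 1)))) ∪
      Finset.univ.image (fun c => (c, (0, len c 0))) := by
    ext ⟨c, i, j⟩
    rw [hU', Finset.mem_union, Finset.mem_image, Finset.mem_image]
    constructor
    · rintro ⟨rfl, h⟩
      cases i with
      | zero => exact Or.inr ⟨c, Finset.mem_univ _, rfl⟩
      | succ i =>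
        refine Or.inl ⟨(c, (i, len c i - 1)), ?_, rfl⟩
        have := h i rfl
        rw [hD']
        omega
    · rintro (⟨⟨c', i', j'⟩, h, he⟩ | ⟨c', -, he⟩)
      · simp only [Prod.mk.injEq] at he
        obtain ⟨rfl, rfl, rfl⟩ := he
        rw [hD'] at h
        refine ⟨rfl, fun k hk => ?_⟩
        obtain rfl : i' = k := by omega
        exact h.2
      · simp only [Prod.mk.injEq] at he
        obtain ⟨rfl, rfl, rfl⟩ := he
        exact ⟨rfl, fun k hk => by omega⟩
  rw [hUeq, Finset.card_union_of_disjoint, Finset.card_image_of_injOn,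
    Finset.card_image_of_injective, Finset.card_univ]
  · intro a b h
    simpa using congrArg Prod.fst h
  · rintro ⟨c, i, j⟩ h ⟨c', i', j'⟩ h' he
    simp only [Prod.mk.injEq] at he
    obtain ⟨rfl, he, -⟩ := he
    obtain rfl : i = i' := by omega
    have h1 := (hD' c i j).1 h
    have h2 := (hD' c i j').1 h'
    obtain rfl : j = j' := by omega
    rfl
  · rw [Finset.disjoint_left]
    intro x h1 h2
    obtain ⟨y, -, rfl⟩ := Finset.mem_image.1 h1
    obtain ⟨z, -, hz⟩ := Finset.mem_image.1 h2
    simp at hz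

/-- Upper covers correspond to addable cells, so `card_insert_eq` applies. For `n = 0` the truncated
`n - 1` is harmless, since `S` is empty. -/
theorem card_upper_self {n : ℕ} {S : Finset (I × (ℕ × ℕ))} (hS : S ∈ lowSets I n) :
    ((lowSets I (n + 1)).filter fun U => S ⊆ U).card =
      (S.filter fun x => S.erase x ∈ lowSets I (n - 1)).card + Fintype.card I := by
  obtain ⟨hlow, hcard⟩ := mem_lowSets.1 hS
  have hbij : ((lowSets I (n + 1)).filter fun U => S ⊆ U) =
      ((((lowSets I (n + 1)).filter fun U => S ⊆ U).biUnion fun U => U \ S).image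
        fun x => insert x S) := by
    ext U
    simp only [Finset.mem_image, Finset.mem_biUnion, Finset.mem_filter]
    constructor
    · rintro ⟨hU, hSU⟩
      have h1 : (U \ S).card = 1 := by
        rw [Finset.card_sdiff_of_subset hSU, (mem_lowSets.1 hU).2, hcard]; omega
      obtain ⟨x, hx⟩ := Finset.card_eq_one.1 h1
      refine ⟨x, ⟨U, ⟨hU, hSU⟩, by rw [hx]; exact Finset.mem_singleton_self x⟩, ?_⟩
      rw [Finset.insert_eq, ← hx, Finset.sdiff_union_of_subset hSU]
    · rintro ⟨x, ⟨U', ⟨hU', hSU'⟩, hx⟩, rfl⟩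
      rw [Finset.mem_sdiff] at hx
      have : insert x S = U' := by
        refine Finset.eq_of_subset_of_card_le (Finset.insert_subset hx.1 hSU') ?_
        rw [Finset.card_insert_of_notMem hx.2, hcard, (mem_lowSets.1 hU').2]
      rw [this]
      exact ⟨hU', hSU'⟩
  rw [hbij, Finset.card_image_of_injOn]
  · refine card_insert_eq S hlow _ _ (fun x => ?_) fun x => ?_
    · rw [Finset.mem_biUnion]
      constructor
      · rintro ⟨U, hU, hx⟩
        obtain ⟨hU, hSU⟩ := Finset.mem_filter.1 hU
        rw [Finset.mem_sdiff] at hx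
        refine ⟨hx.2, ?_⟩
        have : insert x S = U := by
          refine Finset.eq_of_subset_of_card_le (Finset.insert_subset hx.1 hSU) ?_
          rw [Finset.card_insert_of_notMem hx.2, hcard, (mem_lowSets.1 hU).2]
        rw [this]
        exact (mem_lowSets.1 hU).1
      · rintro ⟨hx, h⟩
        refine ⟨insert x S, Finset.mem_filter.2 ⟨mem_lowSets.2 ⟨h, ?_⟩, Finset.subset_insert _ _⟩,
          Finset.mem_sdiff.2 ⟨Finset.mem_insert_self _ _, hx⟩⟩
        rw [Finset.card_insert_of_notMem hx, hcard]
    · rw [Finset.mem_filter, mem_lowSets]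
      refine and_congr_right fun hx => ⟨fun h => h.1, fun h => ⟨h, ?_⟩⟩
      rw [Finset.card_erase_of_mem hx, hcard]
  · intro x hx y hy hxy
    obtain ⟨U, -, hx⟩ := Finset.mem_biUnion.1 (Finset.mem_coe.1 hx)
    have h1 : x ∈ insert y S := by
      rw [← show insert x S = insert y S from hxy]
      exact Finset.mem_insert_self _ _
    exact (Finset.mem_insert.1 h1).resolve_right (Finset.mem_sdiff.1 hx).2

theorem card_lower_self {n : ℕ} {S : Finset (I × (ℕ × ℕ))} (hS : S ∈ lowSets I (n + 1)) :
    (S.filter fun x => S.erase x ∈ lowSets I n).card =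
      ((lowSets I n).filter fun R => R ⊆ S).card := by
  obtain ⟨hlow, hcard⟩ := mem_lowSets.1 hS
  refine Finset.card_bij (fun x _ => S.erase x) ?_ ?_ ?_
  · intro x hx
    exact Finset.mem_filter.2 ⟨(Finset.mem_filter.1 hx).2, Finset.erase_subset _ _⟩
  · intro x hx y hy hxy
    by_contra hne
    have h1 : x ∈ S.erase y := Finset.mem_erase.2 ⟨hne, (Finset.mem_filter.1 hx).1⟩
    rw [← show S.erase x = S.erase y from hxy] at h1
    exact Finset.notMem_erase _ _ h1
  · intro R hR
    obtain ⟨hR, hRS⟩ := Finset.mem_filter.1 hR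
    have h1 : (S \ R).card = 1 := by
      rw [Finset.card_sdiff_of_subset hRS, (mem_lowSets.1 hR).2, hcard]; omega
    obtain ⟨x, hx⟩ := Finset.card_eq_one.1 h1
    have hxS : x ∈ S := by
      have : x ∈ S \ R := by rw [hx]; exact Finset.mem_singleton_self x
      exact (Finset.mem_sdiff.1 this).1
    have e : S.erase x = R := by
      rw [Finset.erase_eq, ← hx, Finset.sdiff_sdiff_eq_self hRS]
    exact ⟨x, Finset.mem_filter.2 ⟨hxS, by rw [e]; exact hR⟩, e⟩

/-- The commutation relation of a differential poset. For `S ≠ S'` the only possible common covers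
are the union and the intersection, and one has the right size exactly when the other has. -/
theorem card_upper_eq {n : ℕ} {S S' : Finset (I × (ℕ × ℕ))} (hS : S ∈ lowSets I (n + 1))
    (hS' : S' ∈ lowSets I (n + 1)) :
    ((lowSets I (n + 2)).filter fun U => S ⊆ U ∧ S' ⊆ U).card =
      ((lowSets I n).filter fun R => R ⊆ S ∧ R ⊆ S').card +
        if S = S' then Fintype.card I else 0 := by
  by_cases h : S = S'
  · subst h
    rw [if_pos rfl]
    simp only [and_self]
    rw [card_upper_self hS, Nat.add_sub_cancel, card_lower_self hS]
  · rw [if_neg h, add_zero]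
    obtain ⟨hl, hc⟩ := mem_lowSets.1 hS
    obtain ⟨hl', hc'⟩ := mem_lowSets.1 hS'
    have hlt : (S ∩ S').card < n + 1 := by
      rcases Nat.lt_or_ge (S ∩ S').card (n + 1) with h1 | h1
      · exact h1
      · exfalso
        apply h
        have e1 := Finset.eq_of_subset_of_card_le (Finset.inter_subset_left (s₁ := S) (s₂ := S'))
          (by omega)
        have e2 := Finset.eq_of_subset_of_card_le (Finset.inter_subset_right (s₁ := S) (s₂ := S'))
          (by omega)
        exact e1.symm.trans e2
    have hsum := Finset.card_union_add_card_inter S S'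
    have hU : ∀ U ∈ (lowSets I (n + 2)).filter (fun U => S ⊆ U ∧ S' ⊆ U), U = S ∪ S' := by
      intro U hU
      obtain ⟨hU, h1, h2⟩ := Finset.mem_filter.1 hU
      refine (Finset.eq_of_subset_of_card_le (Finset.union_subset h1 h2) ?_).symm
      rw [(mem_lowSets.1 hU).2]
      omega
    have hR : ∀ R ∈ (lowSets I n).filter (fun R => R ⊆ S ∧ R ⊆ S'), R = S ∩ S' := by
      intro R hR
      obtain ⟨hR, h1, h2⟩ := Finset.mem_filter.1 hR
      refine Finset.eq_of_subset_of_card_le (Finset.subset_inter h1 h2) ?_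
      rw [(mem_lowSets.1 hR).2]
      omega
    by_cases hi : (S ∩ S').card = n
    · have e1 : (lowSets I (n + 2)).filter (fun U => S ⊆ U ∧ S' ⊆ U) = {S ∪ S'} := by
        refine Finset.eq_singleton_iff_unique_mem.2 ⟨Finset.mem_filter.2
          ⟨mem_lowSets.2 ⟨hl.union hl', by omega⟩, Finset.subset_union_left,
            Finset.subset_union_right⟩, hU⟩
      have e2 : (lowSets I n).filter (fun R => R ⊆ S ∧ R ⊆ S') = {S ∩ S'} := by
        refine Finset.eq_singleton_iff_unique_mem.2 ⟨Finset.mem_filter.2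
          ⟨mem_lowSets.2 ⟨hl.inter hl', hi⟩, Finset.inter_subset_left,
            Finset.inter_subset_right⟩, hR⟩
      rw [e1, e2, Finset.card_singleton, Finset.card_singleton]
    · have e1 : (lowSets I (n + 2)).filter (fun U => S ⊆ U ∧ S' ⊆ U) = ∅ := by
        refine Finset.eq_empty_of_forall_notMem fun U h1 => ?_
        have h2 := hU U h1
        have h3 := (mem_lowSets.1 (Finset.mem_filter.1 h1).1).2
        rw [h2] at h3
        omega
      have e2 : (lowSets I n).filter (fun R => R ⊆ S ∧ R ⊆ S') = ∅ := by
        refine Finset.eq_empty_of_forall_notMem fun R h1 => ?_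
        have h2 := hR R h1
        have h3 := (mem_lowSets.1 (Finset.mem_filter.1 h1).1).2
        rw [h2] at h3
        exact hi h3
      rw [e1, e2]

/-- The number of chains of low sets from `∅` to `S`. -/
def chainCount : ℕ → Finset (I × (ℕ × ℕ)) → ℕ
  | 0, _ => 1
  | n + 1, S => ∑ R ∈ (lowSets I n).filter (fun R => R ⊆ S), chainCount n R

theorem chainCount_succ (n : ℕ) (S : Finset (I × (ℕ × ℕ))) : chainCount (n + 1) S =
    ∑ R ∈ (lowSets I n).filter (fun R => R ⊆ S), chainCount n R := rfl

/-- Going up and then down equals going down and then up plus `|I|` times the identity, so each rank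
adds `|I|` to the factor. -/
theorem sum_upper_chainCount {n : ℕ} {S : Finset (I × (ℕ × ℕ))} (hS : S ∈ lowSets I n) :
    ∑ U ∈ (lowSets I (n + 1)).filter (fun U => S ⊆ U), chainCount (n + 1) U =
      Fintype.card I * (n + 1) * chainCount n S := by
  induction n generalizing S with
  | zero =>
    have : ∀ U ∈ (lowSets I (0 + 1)).filter (fun U => S ⊆ U), chainCount (0 + 1) U = 1 := by
      intro U _
      rw [chainCount, lowSets_zero]
      simp [chainCount, Finset.filter_singleton]
    rw [Finset.sum_congr rfl this, Finset.sum_const, card_upper_self hS]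
    rw [lowSets_zero, Finset.mem_singleton] at hS
    subst hS
    simp [chainCount]
  | succ n ih =>
    have e1 : ∑ U ∈ (lowSets I (n + 2)).filter (fun U => S ⊆ U), chainCount (n + 2) U =
        ∑ S' ∈ lowSets I (n + 1),
          ((lowSets I (n + 2)).filter fun U => S ⊆ U ∧ S' ⊆ U).card * chainCount (n + 1) S' := by
      simp only [chainCount_succ (n + 1)]
      rw [Finset.sum_comm' (t' := lowSets I (n + 1))
        (s' := fun S' => (lowSets I (n + 2)).filter fun U => S ⊆ U ∧ S' ⊆ U)]
      · simp [Finset.sum_const]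
      · intro U S'
        simp only [Finset.mem_filter]
        tauto
    have e2 : ∑ R ∈ (lowSets I n).filter (fun R => R ⊆ S),
        ∑ S' ∈ (lowSets I (n + 1)).filter (fun S' => R ⊆ S'), chainCount (n + 1) S' =
        ∑ S' ∈ lowSets I (n + 1),
          ((lowSets I n).filter fun R => R ⊆ S ∧ R ⊆ S').card * chainCount (n + 1) S' := by
      rw [Finset.sum_comm' (t' := lowSets I (n + 1))
        (s' := fun S' => (lowSets I n).filter fun R => R ⊆ S ∧ R ⊆ S')]
      · simp [Finset.sum_const]
      · intro U S'
        simp only [Finset.mem_filter]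
        tauto
    have e3 : ∑ R ∈ (lowSets I n).filter (fun R => R ⊆ S),
        ∑ S' ∈ (lowSets I (n + 1)).filter (fun S' => R ⊆ S'), chainCount (n + 1) S' =
        Fintype.card I * (n + 1) * chainCount (n + 1) S := by
      rw [Finset.sum_congr rfl fun R hR => ih (Finset.mem_filter.1 hR).1, ← Finset.mul_sum,
        chainCount]
    rw [e1, Finset.sum_congr rfl fun S' hS' => by rw [card_upper_eq hS hS', add_mul],
      Finset.sum_add_distrib, ← e2, e3]
    simp only [ite_mul, zero_mul]
    rw [Finset.sum_ite_eq, if_pos hS]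
    ring

/-- One of the two factors is expanded over lower covers. After exchange of the sums,
`sum_upper_chainCount` lowers the rank by one and leaves the factor `|I| * (n + 1)`. -/
theorem sum_chainCount_sq (n : ℕ) :
    ∑ S ∈ lowSets I n, chainCount n S ^ 2 = Fintype.card I ^ n * n.factorial := by
  induction n with
  | zero => simp [lowSets_zero, chainCount]
  | succ n ih =>
    have e : ∑ S ∈ lowSets I (n + 1), chainCount (n + 1) S ^ 2 =
        ∑ R ∈ lowSets I n, chainCount n R *
          ∑ U ∈ (lowSets I (n + 1)).filter (fun U => R ⊆ U), chainCount (n + 1) U := by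
      have : ∀ S : Finset (I × (ℕ × ℕ)), chainCount (n + 1) S ^ 2 =
          ∑ R ∈ (lowSets I n).filter (fun R => R ⊆ S), chainCount n R * chainCount (n + 1) S :=
        fun S => by rw [← Finset.sum_mul, ← chainCount, sq]
      simp only [this, Finset.mul_sum]
      rw [Finset.sum_comm' (t' := lowSets I n)
        (s' := fun R => (lowSets I (n + 1)).filter fun U => R ⊆ U)]
      intro U R
      simp only [Finset.mem_filter]
      tauto
    rw [e, Finset.sum_congr rfl fun R hR => by
      rw [sum_upper_chainCount hR, show chainCount n R * (Fintype.card I * (n + 1) * chainCount n R) =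
        Fintype.card I * (n + 1) * chainCount n R ^ 2 by ring], ← Finset.mul_sum, ih,
      Nat.factorial_succ, pow_succ]
    ring

end LowSets

end

section

/-! ### Chains of low sets as standard enumerations -/

section Words

variable {I : Type}

/-- The enumerations of a set of cells that increase along rows and columns. -/
def GrowthWord (n : ℕ) (S : Finset (I × (ℕ × ℕ))) : Type :=
  {w : Fin n → I × (ℕ × ℕ) // Function.Injective w ∧ (∀ z, z ∈ S ↔ ∃ x, w x = z) ∧
    ∀ x y, (w x).1 = (w y).1 → (w x).2 ≤ (w y).2 → x ≤ y}

instance (n : ℕ) (S : Finset (I × (ℕ × ℕ))) : Finite (GrowthWord n S) := by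
  refine Finite.of_injective
    (fun w : GrowthWord n S => fun x : Fin n => (⟨w.1 x, (w.2.2.1 _).2 ⟨x, rfl⟩⟩ : S))
    fun w w' h => Subtype.ext (funext fun x => congrArg Subtype.val (congrFun h x))

variable [DecidableEq I] [Fintype I]

/-- The single new cell becomes the last letter. It lies below no cell of `R`, because `R` is low
and does not contain it. -/
theorem exists_snoc {n : ℕ} {R S : Finset (I × (ℕ × ℕ))} (hR : R ∈ lowSets I n)
    (hS : S ∈ lowSets I (n + 1)) (hRS : R ⊆ S) (w : GrowthWord n R) :
    ∃ w' : GrowthWord (n + 1) S, ∀ x : Fin n, w'.1 x.castSucc = w.1 x := by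
  obtain ⟨hRl, hRc⟩ := mem_lowSets.1 hR
  obtain ⟨w, hw, hm, hs⟩ := w
  have h1 : (S \ R).card = 1 := by
    rw [Finset.card_sdiff_of_subset hRS, (mem_lowSets.1 hS).2, hRc]; omega
  obtain ⟨z, hz⟩ := Finset.card_eq_one.1 h1
  have hz' : z ∈ S \ R := by rw [hz]; exact Finset.mem_singleton_self z
  have hzS := (Finset.mem_sdiff.1 hz').1
  have hzR := (Finset.mem_sdiff.1 hz').2
  refine ⟨⟨Fin.snoc (α := fun _ => I × (ℕ × ℕ)) w z, ?_, ?_, ?_⟩, fun x => by simp⟩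
  · rw [Fin.snoc_injective_iff]
    refine ⟨hw, ?_⟩
    rintro ⟨x, hx⟩
    exact hzR ((hm z).2 ⟨x, hx⟩)
  · intro y
    constructor
    · intro hy
      by_cases hyR : y ∈ R
      · obtain ⟨x, rfl⟩ := (hm y).1 hyR
        exact ⟨x.castSucc, by simp⟩
      · have : y ∈ S \ R := Finset.mem_sdiff.2 ⟨hy, hyR⟩
        rw [hz, Finset.mem_singleton] at this
        subst this
        exact ⟨Fin.last n, by simp⟩
    · rintro ⟨x, rfl⟩
      refine Fin.lastCases ?_ (fun x => ?_) x
      · simpa using hzS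
      · simpa using hRS ((hm _).2 ⟨x, rfl⟩)
  · intro x y
    refine Fin.lastCases ?_ (fun y => ?_) y
    · intro _ _
      exact Fin.le_last x
    · refine Fin.lastCases ?_ (fun x => ?_) x
      · intro h1 h2
        exfalso
        simp only [Fin.snoc_last, Fin.snoc_castSucc] at h1 h2
        apply hzR
        have := hRl z.1 z.2 (w y).2 h2 (by rw [h1]; exact (hm _).2 ⟨y, rfl⟩)
        exact this
      · intro h1 h2
        simp only [Fin.snoc_castSucc] at h1 h2
        exact hs x y h1 h2

theorem chainCount_le_natCard {n : ℕ} {S : Finset (I × (ℕ × ℕ))} (hS : S ∈ lowSets I n) :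
    chainCount n S ≤ Nat.card (GrowthWord n S) := by
  induction n generalizing S with
  | zero =>
    rw [lowSets_zero, Finset.mem_singleton] at hS
    subst hS
    have : Nonempty (GrowthWord 0 (∅ : Finset (I × (ℕ × ℕ)))) :=
      ⟨⟨Fin.elim0, fun x => x.elim0, fun z => by simp, fun x => x.elim0⟩⟩
    exact Nat.card_pos
  | succ n ih =>
    rw [chainCount_succ]
    refine (Finset.sum_le_sum fun R hR => ih (Finset.mem_filter.1 hR).1).trans ?_
    rw [← Finset.sum_coe_sort, ← Nat.card_sigma]
    choose F hF using fun (x : Σ R : {R // R ∈ (lowSets I n).filter (fun R => R ⊆ S)},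
      GrowthWord n R.1) => exists_snoc (Finset.mem_filter.1 x.1.2).1 hS
        (Finset.mem_filter.1 x.1.2).2 x.2
    -- The first `n` letters of an extended word determine the shorter word, and `R` is its set of
    -- letters.
    refine Nat.card_le_card_of_injective F ?_
    rintro ⟨⟨R, hR⟩, w⟩ ⟨⟨R', hR'⟩, w'⟩ h
    have hw : w.1 = w'.1 := funext fun x => by
      have h1 := hF ⟨⟨R, hR⟩, w⟩ x
      have h2 := hF ⟨⟨R', hR'⟩, w'⟩ x
      rw [h] at h1
      exact h1.symm.trans h2
    obtain rfl : R = R' := by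
      ext z
      rw [w.2.2.1, w'.2.2.1, hw]
    obtain rfl : w = w' := Subtype.ext hw
    rfl

end Words

/-! ### Sum of squares over multipartitions -/

section Count

variable {p d n : ℕ} [NeZero p]

/-- The multipartition with a given low set of cells. -/
def multiPartOfLow (S : Finset ((ZMod p × Fin d) × (ℕ × ℕ)))
    (hS : S ∈ lowSets (ZMod p × Fin d) n) : MultiPart p d n where
  diag i j :=
    { cells := (S.filter fun z => z.1 = (i, j)).image Prod.snd
      isLowerSet := by
        intro y x hxy hy
        simp only [Finset.coe_image, Set.mem_image, Finset.mem_coe, Finset.mem_filter] at hy ⊢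
        obtain ⟨⟨c, y⟩, ⟨hz, rfl⟩, rfl⟩ := hy
        exact ⟨((i, j), x), ⟨(mem_lowSets.1 hS).1 _ x y hxy hz, rfl⟩, rfl⟩ }
  sum_card := by
    obtain ⟨_, rfl⟩ := mem_lowSets.1 hS
    rw [← Fintype.sum_prod_type' (f := fun i j =>
      ((S.filter fun z => z.1 = ((i, j) : ZMod p × Fin d)).image Prod.snd).card),
      Finset.card_eq_sum_card_fiberwise (f := Prod.fst) (t := Finset.univ)
        (fun _ _ => Finset.mem_coe.2 (Finset.mem_univ _))]
    refine Finset.sum_congr rfl fun c _ => Finset.card_image_of_injOn ?_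
    rintro ⟨a, x⟩ hx ⟨b, y⟩ hy rfl
    have h1 := (Finset.mem_filter.1 (Finset.mem_coe.1 hx)).2
    have h2 := (Finset.mem_filter.1 (Finset.mem_coe.1 hy)).2
    exact Prod.ext (h1.trans h2.symm) rfl

theorem mem_multiPartOfLow {S : Finset ((ZMod p × Fin d) × (ℕ × ℕ))}
    (hS : S ∈ lowSets (ZMod p × Fin d) n) (z : (ZMod p × Fin d) × (ℕ × ℕ)) :
    z.2 ∈ (multiPartOfLow S hS).diag z.1.1 z.1.2 ↔ z ∈ S := by
  change z.2 ∈ (S.filter fun y => y.1 = (z.1.1, z.1.2)).image Prod.snd ↔ _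
  rw [Finset.mem_image]
  constructor
  · rintro ⟨y, hy, he⟩
    obtain ⟨hyS, h1⟩ := Finset.mem_filter.1 hy
    obtain rfl : y = z := Prod.ext h1 he
    exact hyS
  · intro hz
    exact ⟨z, Finset.mem_filter.2 ⟨hz, rfl⟩, rfl⟩

theorem natCard_growthWord_le {S : Finset ((ZMod p × Fin d) × (ℕ × ℕ))}
    (hS : S ∈ lowSets (ZMod p × Fin d) n) :
    Nat.card (GrowthWord n S) ≤ Nat.card (StdTab (multiPartOfLow S hS)) := by
  have hbij : ∀ w : GrowthWord n S, Function.Bijective fun x : Fin n =>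
      (⟨w.1 x, (mem_multiPartOfLow hS _).2 ((w.2.2.1 _).2 ⟨x, rfl⟩)⟩ :
        Cell (multiPartOfLow S hS)) := by
    intro w
    refine ⟨fun x y h => w.2.1 (congrArg Subtype.val h), ?_⟩
    rintro ⟨z, hz⟩
    obtain ⟨x, hx⟩ := (w.2.2.1 z).1 ((mem_multiPartOfLow hS z).1 hz)
    exact ⟨x, Subtype.ext hx⟩
  refine Nat.card_le_card_of_injective
    (fun w => StdTab.mk (Equiv.ofBijective _ (hbij w)) fun x y => w.2.2.2 x y) ?_
  intro w w' h
  refine Subtype.ext (funext fun x => ?_)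
  exact congrFun (congrArg (fun t => word t.1) h) x

/-- Only this inequality is needed, against the opposite bound for the dimension of the algebra, and
it only takes the finitely many shapes coming from low sets. -/
theorem exists_finset_sum_natCard_sq (p d n : ℕ) [NeZero p] :
    ∃ s : Finset (MultiPart p d n),
      (d * p) ^ n * n.factorial ≤ ∑ lam ∈ s, Nat.card (StdTab lam) ^ 2 := by
  classical
  let F : {S // S ∈ lowSets (ZMod p × Fin d) n} → MultiPart p d n := fun S =>
    multiPartOfLow S.1 S.2
  have hF : Function.Injective F := by
    intro S S' h
    refine Subtype.ext (Finset.ext fun z => ?_)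
    rw [← mem_multiPartOfLow S.2, ← mem_multiPartOfLow S'.2]
    have : multiPartOfLow S.1 S.2 = multiPartOfLow S'.1 S'.2 := h
    rw [this]
  refine ⟨Finset.univ.image F, ?_⟩
  rw [Finset.sum_image fun a _ b _ h => hF h]
  have h1 := sum_chainCount_sq (I := ZMod p × Fin d) n
  rw [Fintype.card_prod, ZMod.card, Fintype.card_fin, mul_comm p d] at h1
  rw [← h1, ← Finset.sum_coe_sort]
  exact Finset.sum_le_sum fun S _ => Nat.pow_le_pow_left
    ((chainCount_le_natCard S.2).trans (natCard_growthWord_le S.2)) 2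

end Count

end

section

/-! ### Every simple module of the Hecke algebra is one of the seminormal modules -/

section Exhaustion

variable {p d n : ℕ} [NeZero p] {P : Params p d}

theorem linearMap_eq_zero_of_ne (hg : P.Generic n) {lam mu : MultiPart p d n} (h : lam ≠ mu)
    (θ : V P lam →ₗ[H P n] V P mu) : θ = 0 := by
  ext m
  exact LinearMap.congr_fun (hom_eq_zero hg h (θ.restrictScalars ℂ) fun _ _ => θ.map_smul _ _) m

theorem linearMap_eq_smul (hg : P.Generic n) {lam : MultiPart p d n}
    (θ : V P lam →ₗ[H P n] V P lam) : ∃ c : ℂ, ∀ m, θ m = c • m :=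
  hom_eq_smul hg (θ.restrictScalars ℂ) fun _ _ => θ.map_smul _ _

/-- The product of the modules `V(λ)`, each taken as often as its dimension. -/
abbrev BlockProduct (P : Params p d) (s : Finset (MultiPart p d n)) : Type :=
  (x : Σ lam : s, StdTab lam.1) → V P x.1.1

/-- By Schur's lemma only the copies of `V(μ)` contribute, each by a scalar. The value at the
distinguished vector is the combination of the `v(𝕋)` with these scalars, so independence kills
them. -/
theorem linearMap_blockProduct_eq_zero (hg : P.Generic n) (s : Finset (MultiPart p d n))
    {mu : MultiPart p d n} (hmu : mu ∈ s) (g : BlockProduct P s →ₗ[H P n] V P mu)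
    (h0 : g (fun x => vec P x.2) = 0) : g = 0 := by
  classical
  let _ := fun lam : MultiPart p d n => Fintype.ofFinite (StdTab lam)
  have hsum : ∀ F : BlockProduct P s, g F = ∑ t, (g ∘ₗ LinearMap.single (H P n)
      (fun x : Σ lam : s, StdTab lam.1 => V P x.1.1) ⟨⟨mu, hmu⟩, t⟩) (F ⟨⟨mu, hmu⟩, t⟩) := by
    intro F
    conv_lhs => rw [← Finset.univ_sum_single F, map_sum, Fintype.sum_sigma]
    refine (Finset.sum_eq_single (⟨mu, hmu⟩ : s) (fun lam _ hne => ?_) fun h =>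
      absurd (Finset.mem_univ _) h)
    refine Finset.sum_eq_zero fun t _ => ?_
    have := linearMap_eq_zero_of_ne hg (fun h => hne (Subtype.ext h)) (g ∘ₗ LinearMap.single (H P n)
      (fun x : Σ lam : s, StdTab lam.1 => V P x.1.1) ⟨lam, t⟩)
    exact LinearMap.congr_fun this _
  choose c hc using fun t => linearMap_eq_smul hg (g ∘ₗ LinearMap.single (H P n)
      (fun x : Σ lam : s, StdTab lam.1 => V P x.1.1) ⟨⟨mu, hmu⟩, t⟩)
  rw [hsum] at h0
  have h1 := Fintype.linearIndependent_iff.1 (linearIndependent_vec (lam := mu) hg) c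
    ((Finset.sum_congr rfl fun t _ => (hc t _).symm).trans h0)
  refine LinearMap.ext fun F => ?_
  rw [hsum, LinearMap.zero_apply]
  exact Finset.sum_eq_zero fun t _ => by rw [hc, h1, zero_smul]

theorem exists_equiv_V (hss : IsSemisimpleRing (H P n)) (M : Type*) [AddCommGroup M]
    [Module (H P n) M] [IsSimpleModule (H P n) M] :
    ∃ lam : MultiPart p d n, Nonempty (V P lam ≃ₗ[H P n] M) := by
  classical
  have hg := P.generic_of_isSemisimpleRing hss
  obtain ⟨s, hs⟩ := exists_finset_sum_natCard_sq p d n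
  obtain ⟨hfd, hdim⟩ := exists_finrank_le (n := n) P
  let _ := fun lam : MultiPart p d n => Fintype.ofFinite (StdTab lam)
  -- A complement of the range receives a projection that kills the distinguished vector, so it is
  -- zero by the previous lemma and the map is onto. The two dimension bounds then make it
  -- injective.
  let ev := LinearMap.toSpanSingleton (H P n) (BlockProduct P s) fun x => vec P x.2
  have hsurj : Function.Surjective ev := by
    rw [← LinearMap.range_eq_top]
    obtain ⟨Q, hQ⟩ := exists_isCompl (LinearMap.range ev)
    have hQ0 : Q = ⊥ := by
      rw [eq_bot_iff]
      intro y hy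
      have hy' := Submodule.projectionOnto_apply_left hQ.symm ⟨y, hy⟩
      have h0 : Q.subtype ∘ₗ Submodule.projectionOnto Q (LinearMap.range ev) hQ.symm = 0 := by
        refine LinearMap.ext fun F => funext fun x => LinearMap.congr_fun
          (linearMap_blockProduct_eq_zero hg s x.1.2 (LinearMap.proj x ∘ₗ Q.subtype ∘ₗ
            Submodule.projectionOnto Q (LinearMap.range ev) hQ.symm) ?_) F
        have h1 := Submodule.projectionOnto_apply_right hQ.symm ⟨ev 1, ⟨1, rfl⟩⟩
        have h2 : ev 1 = fun x => vec P x.2 := by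
          rw [LinearMap.toSpanSingleton_apply, one_smul]
        rw [← h2]
        exact congrFun (congrArg Q.subtype h1) x
      have := LinearMap.congr_fun h0 y
      exact (congrArg Q.subtype hy').symm.trans this
    rw [hQ0] at hQ
    simpa using hQ.sup_eq_top
  have hfr : Module.finrank ℂ (BlockProduct P s) = ∑ lam ∈ s, Nat.card (StdTab lam) ^ 2 := by
    have (lam : MultiPart p d n) : Module.Finite ℂ (V P lam) := Module.Finite.of_basis (vecBasis hg lam)
    rw [Module.finrank_pi_fintype, Fintype.sum_sigma, ← Finset.sum_coe_sort s]
    refine Finset.sum_congr rfl fun lam _ => ?_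
    simp only [Module.finrank_eq_nat_card_basis (vecBasis hg lam.1)]
    rw [Finset.sum_const, Finset.card_univ, Nat.card_eq_fintype_card, smul_eq_mul, sq]
  have hinj : Function.Injective ev := by
    have (lam : MultiPart p d n) : Module.Finite ℂ (V P lam) := Module.Finite.of_basis (vecBasis hg lam)
    have h2 : Function.Surjective (ev.restrictScalars ℂ) := hsurj
    have h3 := LinearMap.finrank_range_add_finrank_ker (ev.restrictScalars ℂ)
    rw [LinearMap.range_eq_top.2 h2, finrank_top, hfr] at h3
    have h4 : Module.finrank ℂ (LinearMap.ker (ev.restrictScalars ℂ)) = 0 := by omega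
    rw [Submodule.finrank_eq_zero] at h4
    have h5 : Function.Injective (ev.restrictScalars ℂ) := LinearMap.ker_eq_bot.1 h4
    exact h5
  let e := LinearEquiv.ofBijective ev ⟨hinj, hsurj⟩
  have := IsSimpleModule.nontrivial (H P n) M
  obtain ⟨m, hm⟩ := exists_ne (0 : M)
  -- A simple module is a quotient of the regular module, so some factor `V(λ)` maps to it by a
  -- nonzero map.
  let f := LinearMap.toSpanSingleton (H P n) M m ∘ₗ e.symm.toLinearMap
  have hf : f ≠ 0 := by
    intro h
    have := LinearMap.congr_fun h (e 1)
    apply hm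
    simpa [f] using this
  have hex : ∃ x, f ∘ₗ LinearMap.single (H P n)
      (fun x : Σ lam : s, StdTab lam.1 => V P x.1.1) x ≠ 0 := by
    by_contra! h
    exact hf (LinearMap.pi_ext' fun x => by rw [h x, LinearMap.zero_comp])
  obtain ⟨x, hx⟩ := hex
  have := isSimpleModule_V hss x.1.1
  exact ⟨x.1.1, ⟨LinearEquiv.ofBijective _ (LinearMap.bijective_of_ne_zero hx)⟩⟩

end Exhaustion

end

section

/-! ### Twisted isomorphisms between the seminormal modules -/

/-- The component of a cell is moved by `-k`. -/
def shiftCell {p d : ℕ} (k : G p) (c : (ZMod p × Fin d) × (ℕ × ℕ)) : (ZMod p × Fin d) × (ℕ × ℕ) :=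
  -- The sign is forced: component `i` of `k • λ` is component `i + k` of `λ`.
  ((c.1.1 - Multiplicative.toAdd k, c.1.2), c.2)

theorem shiftCell_fst_eq_iff {p d : ℕ} (k : G p) (c c' : (ZMod p × Fin d) × (ℕ × ℕ)) :
    (shiftCell k c).1 = (shiftCell k c').1 ↔ c.1 = c'.1 := by
  simp [shiftCell, Prod.ext_iff]

section Action

variable {p d n : ℕ} [NeZero p] {P : Params p d}

theorem G_smul_def (k : G p) (x : H P n) :
    k • x = (tau P n ^ (Multiplicative.toAdd k).val) x := rfl

theorem G_smul_algebraMap (k : G p) (c : ℂ) :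
    k • (algebraMap ℂ (H P n) c) = algebraMap ℂ (H P n) c := by
  rw [G_smul_def, AlgHom.commutes]

theorem G_smul_T (k : G p) (i : Fin n) : k • T P i =
    if i.val = 0 then P.ξ ^ (Multiplicative.toAdd k).val • T P i else T P i := by
  have hgen : tau P n (T P i) = tauGen P i := by
    refine (HeckeAlg.lift_mk (FreeAlgebra.lift ℂ (tauGen P)) (tauGen_rel P) _).trans ?_
    simp
  rw [G_smul_def]
  induction (Multiplicative.toAdd k).val with
  | zero => simp
  | succ k ih =>
    rw [pow_succ', AlgHom.mul_apply, ih]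
    split_ifs with hi
    · rw [map_smul, hgen, tauGen, if_pos hi, smul_smul, pow_succ]
    · rw [hgen, tauGen, if_neg hi]

theorem smul_diag (k : G p) (lam : MultiPart p d n) (i : ZMod p) (j : Fin d) :
    (k • lam).diag i j = lam.diag (i + Multiplicative.toAdd k) j := by
  refine (shift_iterate_diag (Multiplicative.toAdd k).val lam i j).trans ?_
  rw [ZMod.natCast_zmod_val]

theorem cyclicEquiv_iff {lam mu : MultiPart p d n} :
    CyclicEquiv lam mu ↔ ∃ k : G p, k • lam = mu := by
  constructor
  · rintro ⟨k, rfl⟩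
    refine ⟨Multiplicative.ofAdd (k : ZMod p), ?_⟩
    ext i j : 3
    rw [smul_diag, shift_iterate_diag]
    rfl
  · rintro ⟨k, rfl⟩
    exact ⟨(Multiplicative.toAdd k).val, rfl⟩

theorem Params.weight_add (P : Params p d) (a k : ZMod p) (b : Fin d) :
    P.weight (a + k, b) = P.ξ ^ k.val * P.weight (a, b) := by
  rw [weight, weight, ZMod.val_add, ← mul_assoc, ← pow_add, add_comm k.val]
  congr 1
  exact (pow_eq_pow_mod _ P.isPrimitiveRoot.pow_eq_one).symm

end Action

section Shift

variable {p d n : ℕ} [NeZero p] {P : Params p d} {lam mu nu : MultiPart p d n} {k : G p}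

theorem Params.weight_shiftCell (P : Params p d) (k : G p) (c : (ZMod p × Fin d) × (ℕ × ℕ)) :
    P.weight c.1 = P.ξ ^ (Multiplicative.toAdd k).val * P.weight (shiftCell k c).1 := by
  rw [shiftCell, ← P.weight_add, sub_add_cancel]

/-- Contents do not change, all residues change by the same power of `ξ`, and the coefficient is
homogeneous of degree zero in the residues. -/
theorem Params.coeff_shiftCell (P : Params p d) (k : G p) (c c' : (ZMod p × Fin d) × (ℕ × ℕ)) :
    P.coeff (shiftCell k c) (shiftCell k c') = P.coeff c c' := by
  have h1 := shiftCell_fst_eq_iff k c c'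
  have h2 : ∀ c, P.res c = P.ξ ^ (Multiplicative.toAdd k).val * P.res (shiftCell k c) := fun c => by
    rw [res, res, P.weight_shiftCell k c, mul_assoc]
    rfl
  have h3 : P.ξ ^ (Multiplicative.toAdd k).val ≠ 0 :=
    pow_ne_zero _ (P.isPrimitiveRoot.ne_zero (NeZero.ne p))
  simp only [coeff, h1]
  congr 1
  rw [h2 c, h2 c', ← mul_sub, mul_left_comm, mul_div_mul_left _ _ h3]

/-- The bijection between the cells of `λ` and `k λ`. -/
def cellShift (h : k • lam = mu) : Cell lam ≃ Cell mu where
  toFun c := ⟨shiftCell k c.1, by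
    rw [← h, smul_diag, shiftCell, sub_add_cancel]
    exact c.2⟩
  invFun c := ⟨shiftCell k⁻¹ c.1, by
    have : c.1.2 ∈ (k • lam).diag c.1.1.1 c.1.1.2 := by
      rw [h]
      exact c.2
    rw [smul_diag] at this
    rw [shiftCell, toAdd_inv, sub_neg_eq_add]
    exact this⟩
  left_inv c := Subtype.ext (by simp [shiftCell])
  right_inv c := Subtype.ext (by simp [shiftCell])

theorem isStandard_shift (h : k • lam = mu) (t : Fin n ≃ Cell lam) :
    IsStandard mu (t.trans (cellShift h)) ↔ IsStandard lam t := by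
  refine forall_congr' fun x => forall_congr' fun y => ?_
  exact imp_congr (shiftCell_fst_eq_iff k (t x).1 (t y).1) Iff.rfl

/-- The bijection between the standard tableaux of shape `λ` and `k λ`. -/
def tabShift (h : k • lam = mu) : StdTab lam ≃ StdTab mu :=
  (Equiv.equivCongr (Equiv.refl (Fin n)) (cellShift h)).subtypeEquiv fun t =>
    (isStandard_shift h t).symm

theorem word_tabShift (h : k • lam = mu) (t : StdTab lam) (x : Fin n) :
    word (tabShift h t).1 x = shiftCell k (word t.1 x) := rfl

/-- The twisted isomorphism `V(λ) → V(k λ)` that relabels the components. -/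
def relabel (hg : P.Generic n) (h : k • lam = mu) : V P lam ≃ₗ[ℂ] V P mu :=
  (vecBasis hg lam).equiv (vecBasis hg mu) (tabShift h)

theorem relabel_vec (hg : P.Generic n) (h : k • lam = mu) (t : StdTab lam) :
    relabel hg h (vec P t) = vec P (tabShift h t) := by
  rw [relabel, ← vecBasis_apply hg, ← vecBasis_apply hg, Module.Basis.equiv_apply]

theorem relabel_vecOrZero (hg : P.Generic n) (h : k • lam = mu) (t : Fin n ≃ Cell lam) :
    relabel hg h (vecOrZero P t) = vecOrZero P (t.trans (cellShift h)) := by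
  by_cases ht : IsStandard lam t
  · exact (congrArg (relabel hg h) (vecOrZero_mk (StdTab.mk t ht))).trans
      ((relabel_vec hg h _).trans (vecOrZero_mk (tabShift h (StdTab.mk t ht))).symm)
  · rw [vecOrZero_of_not ht, vecOrZero_of_not (mt (isStandard_shift h t).1 ht), map_zero]

theorem relabel_smul (hg : P.Generic n) (h : k • lam = mu) (r : H P n) (m : V P lam) :
    relabel hg h (r • m) = (k • r) • relabel hg h m := by
  let S : Subalgebra ℂ (H P n) :=
    { carrier := {r | ∀ m, relabel hg h (r • m) = (k • r) • relabel hg h m}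
      mul_mem' := fun {a b} ha hb m => by rw [mul_smul, ha, hb, smul_mul', mul_smul]
      add_mem' := fun {a b} ha hb m => by rw [add_smul, map_add, ha, hb, smul_add, add_smul]
      algebraMap_mem' := fun c m => by
        rw [G_smul_algebraMap, algebraMap_smul, algebraMap_smul, map_smul] }
  refine mem_of_T S (fun i m => ?_) r m
  suffices hs : (relabel hg h).toLinearMap ∘ₗ Algebra.lsmul ℂ ℂ (V P lam) (T P i) =
      Algebra.lsmul ℂ ℂ (V P mu) (k • T P i) ∘ₗ (relabel hg h).toLinearMap from
    LinearMap.congr_fun hs m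
  refine (vecBasis hg lam).ext fun t => ?_
  rw [vecBasis_apply]
  change relabel hg h (T P i • vec P t) = (k • T P i) • relabel hg h (vec P t)
  rw [G_smul_T, relabel_vec]
  by_cases hi : i.val = 0
  · rw [if_pos hi, T_zero_smul_vec t hi, map_smul, relabel_vec, smul_assoc,
      T_zero_smul_vec _ hi, smul_smul, word_tabShift, ← P.weight_shiftCell]
  · have hp : i.val = (prev i).val + 1 := by rw [prev_val]; omega
    rw [if_neg hi, T_smul_vec t hp, T_smul_vec _ hp, map_add, map_smul, map_smul,
      relabel_vecOrZero, relabel_vec, word_tabShift, word_tabShift, P.coeff_shiftCell]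
    rfl

/-- Relabellings compose without scalars, so the intertwiners they provide have trivial factor set.
-/
theorem relabel_relabel (hg : P.Generic n) {l : G p} (h : k • lam = mu) (h' : l • mu = nu)
    (h'' : (l * k) • lam = nu) (m : V P lam) :
    relabel hg h' (relabel hg h m) = relabel hg h'' m := by
  suffices hs : (relabel hg h').toLinearMap ∘ₗ (relabel hg h).toLinearMap =
      (relabel hg h'').toLinearMap from LinearMap.congr_fun hs m
  refine (vecBasis hg lam).ext fun t => ?_
  rw [vecBasis_apply]
  change relabel hg h' (relabel hg h (vec P t)) = relabel hg h'' (vec P t)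
  rw [relabel_vec, relabel_vec, relabel_vec]
  congr 1
  refine StdTab.ext_word (funext fun x => ?_)
  rw [word_tabShift, word_tabShift, word_tabShift]
  simp only [shiftCell, toAdd_mul]
  congr 2
  ring

/-- A twisted linear map between the modules `V(λ)` and `V(μ)` vanishes unless `μ = k λ`. -/
theorem twisted_eq_zero (hg : P.Generic n) (h : k • lam ≠ mu) (θ : V P lam →ₗ[ℂ] V P mu)
    (hθ : ∀ (r : H P n) m, θ (r • m) = (k • r) • θ m) (m : V P lam) : θ m = 0 := by
  have h1 := hom_eq_zero hg h (θ ∘ₗ (relabel (lam := lam) hg (rfl : k • lam = _)).symm.toLinearMap)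
    fun i m => by
      obtain ⟨m, rfl⟩ := (relabel (lam := lam) hg (rfl : k • lam = _)).surjective m
      change θ ((relabel hg _).symm _) = _ • θ ((relabel hg _).symm _)
      rw [LinearEquiv.symm_apply_apply, ← smul_inv_smul k (T P i), ← relabel_smul,
        LinearEquiv.symm_apply_apply, hθ]
  have h2 := LinearMap.congr_fun h1 (relabel hg (rfl : k • lam = _) m)
  simpa using h2

/-- A twisted linear map between `V(λ)` and `V(k λ)` is a multiple of the relabelling. -/
theorem twisted_eq_smul (hg : P.Generic n) (h : k • lam = mu) (θ : V P lam →ₗ[ℂ] V P mu)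
    (hθ : ∀ (r : H P n) m, θ (r • m) = (k • r) • θ m) :
    ∃ c : ℂ, ∀ m : V P lam, θ m = c • relabel hg h m := by
  obtain ⟨c, hc⟩ := hom_eq_smul hg (θ ∘ₗ (relabel hg h).symm.toLinearMap)
    fun i m => by
      obtain ⟨m, rfl⟩ := (relabel hg h).surjective m
      change θ ((relabel hg _).symm _) = _ • θ ((relabel hg _).symm _)
      rw [LinearEquiv.symm_apply_apply, ← smul_inv_smul k (T P i), ← relabel_smul,
        LinearEquiv.symm_apply_apply, hθ]
  refine ⟨c, fun m => ?_⟩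
  have h2 := hc (relabel hg h m)
  simpa using h2

theorem nontrivial_V (hg : P.Generic n) (lam : MultiPart p d n) : Nontrivial (V P lam) := by
  obtain ⟨t₀⟩ := nonempty_stdTab lam
  exact ⟨vec P t₀, 0, (linearIndependent_vec hg).ne_zero _⟩

/-- The intertwiners given by relabelling. -/
def standardDatum (hg : P.Generic n) (lam : MultiPart p d n) : CliffordDatum P lam where
  φ h := relabel hg h.2
  φ_smul h r m := relabel_smul hg h.2 r m
  α _ _ := 1
  φ_mul g h m := by
    rw [Units.val_one, one_smul]
    exact relabel_relabel hg _ _ _ m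

/-- A twisted isomorphism is a scalar multiple of a relabelling, and relabellings commute because
`G` is abelian. -/
theorem compatible_standardDatum (hg : P.Generic n) :
    Compatible fun lam : MultiPart p d n => standardDatum hg lam := by
  intro lam mu k θ hθ h h₁ h₂ m
  have hk : k • lam = mu := by
    by_contra hne
    have := nontrivial_V hg lam
    obtain ⟨m, hm⟩ := exists_ne (0 : V P lam)
    have h1 := twisted_eq_zero hg hne θ.toLinearMap hθ m
    exact hm (θ.map_eq_zero_iff.1 h1)
  obtain ⟨c, hc⟩ := twisted_eq_smul hg hk θ.toLinearMap hθ
  have hc' : ∀ m, θ m = c • relabel hg hk m := hc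
  change relabel hg h₂ (θ m) = θ (relabel hg h₁ m)
  have e : (h * k) • lam = mu := by rw [mul_smul, hk]; exact h₂
  have e' : (k * h) • lam = mu := by rw [mul_comm]; exact e
  rw [hc', hc', map_smul, relabel_relabel hg hk h₂ e, relabel_relabel hg h₁ hk e']
  congr 2
  simp only [mul_comm h k]

/-- The composite `φ_g φ_h φ_{gh}⁻¹` commutes with the Hecke algebra and is a scalar by Schur's
lemma; this scalar is nonzero by bijectivity, and unique because `V(λ)` is nonzero. -/
theorem existsUnique_cliffordDatum (hg : P.Generic n) (lam : MultiPart p d n)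
    (I : Intertwiners P lam) : ∃! D : CliffordDatum P lam, D.toIntertwiners = I := by
  have := nontrivial_V hg lam
  obtain ⟨m₀, hm₀⟩ := exists_ne (0 : V P lam)
  have key : ∀ g h : Stab lam, ∃ c : ℂˣ, ∀ m, I.φ g (I.φ h m) = (c : ℂ) • I.φ (g * h) m := by
    intro g h
    obtain ⟨c, hc⟩ := hom_eq_smul hg ((I.φ g).toLinearMap ∘ₗ (I.φ h).toLinearMap ∘ₗ
      (I.φ (g * h)).symm.toLinearMap) fun i m => by
        obtain ⟨m, rfl⟩ := (I.φ (g * h)).surjective m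
        change I.φ g (I.φ h ((I.φ (g * h)).symm _)) = _ • I.φ g (I.φ h ((I.φ (g * h)).symm _))
        rw [LinearEquiv.symm_apply_apply, ← smul_inv_smul ((g * h : Stab lam) : G p) (T P i),
          ← I.φ_smul, LinearEquiv.symm_apply_apply, I.φ_smul, I.φ_smul, Subgroup.coe_mul, mul_smul]
    have hc' : ∀ m, I.φ g (I.φ h m) = c • I.φ (g * h) m := fun m => by
      have := hc (I.φ (g * h) m)
      simpa using this
    have hc0 : c ≠ 0 := by
      rintro rfl
      have := hc' m₀
      rw [zero_smul, LinearEquiv.map_eq_zero_iff, LinearEquiv.map_eq_zero_iff] at this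
      exact hm₀ this
    exact ⟨Units.mk0 c hc0, hc'⟩
  choose α hα using key
  refine ⟨⟨I, α, hα⟩, rfl, ?_⟩
  rintro ⟨J, β, hβ⟩ rfl
  congr 1
  funext g h
  have h1 := (hβ g h m₀).symm.trans (hα g h m₀)
  refine Units.ext (smul_left_injective ℂ ?_ h1)
  rw [Ne, LinearEquiv.map_eq_zero_iff]
  exact hm₀

end Shift

end

section

/-! ### Common eigenvectors of projective representations of cyclic groups -/

section Eigenvector

variable {E : Type*} [AddCommGroup E] [Module ℂ E]

/-- Linear factors are removed until the next one kills a nonzero vector. No finite dimension is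
assumed, so the lemma also serves for spaces of homomorphisms into arbitrary modules. -/
theorem exists_eigenvector_of_aeval (A : Module.End ℂ E) (m : ℕ) (f : Polynomial ℂ)
    (hm : f.natDegree = m) (hf : f ≠ 0) (v : E) (hv : v ≠ 0) (h : Polynomial.aeval A f v = 0) :
    ∃ (c : ℂ) (x : E), x ≠ 0 ∧ A x = c • x := by
  induction m generalizing f with
  | zero =>
    exfalso
    rw [Polynomial.natDegree_eq_zero] at hm
    obtain ⟨c, rfl⟩ := hm
    rw [Polynomial.aeval_C, Module.algebraMap_end_apply] at h
    have hc : c ≠ 0 := by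
      rintro rfl
      simp at hf
    exact hv ((smul_eq_zero.1 h).resolve_left hc)
  | succ m ih =>
    obtain ⟨c, hc⟩ := IsAlgClosed.exists_root f (by
      intro h0
      rw [Polynomial.degree_eq_natDegree hf, hm] at h0
      exact absurd h0 (by exact_mod_cast Nat.succ_ne_zero m))
    obtain ⟨g, rfl⟩ := Polynomial.dvd_iff_isRoot.2 hc
    have hg : g ≠ 0 := right_ne_zero_of_mul hf
    by_cases h0 : Polynomial.aeval A g v = 0
    · refine ih g ?_ hg h0
      rw [Polynomial.natDegree_mul (left_ne_zero_of_mul hf) hg, Polynomial.natDegree_X_sub_C] at hm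
      omega
    · refine ⟨c, _, h0, ?_⟩
      rw [map_mul, Module.End.mul_apply, map_sub, Polynomial.aeval_X, Polynomial.aeval_C,
        LinearMap.sub_apply, Module.algebraMap_end_apply] at h
      exact sub_eq_zero.1 h

/-- For a generator `g` the power `ρ g ^ |K|` is a scalar, so `ρ g` has an eigenvector. Every other
`ρ h` is a scalar multiple of a power of `ρ g`. -/
theorem exists_common_eigenvector {K : Type*} [Group K] [Finite K] [IsCyclic K] [Nontrivial E]
    (ρ : K → Module.End ℂ E) (β : K → K → ℂˣ) (hone : ρ 1 = (β 1 1 : ℂ) • 1)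
    (hmul : ∀ g h, ρ g * ρ h = (β g h : ℂ) • ρ (g * h)) :
    ∃ x : E, x ≠ 0 ∧ ∃ χ : K → ℂ, ∀ h, ρ h x = χ h • x := by
  obtain ⟨g, hg⟩ := IsCyclic.exists_generator (α := K)
  have hpow : ∀ j : ℕ, ∃ a : ℂˣ, ρ g ^ j = (a : ℂ) • ρ (g ^ j) := by
    intro j
    induction j with
    | zero =>
      refine ⟨(β 1 1)⁻¹, ?_⟩
      rw [pow_zero, pow_zero, hone, smul_smul, Units.inv_mul, one_smul]
    | succ j ih =>
      obtain ⟨a, ha⟩ := ih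
      refine ⟨a * β (g ^ j) g, ?_⟩
      rw [pow_succ, ha, smul_mul_assoc, hmul, smul_smul, ← pow_succ, Units.val_mul]
  obtain ⟨a, ha⟩ := hpow (Nat.card K)
  rw [pow_card_eq_one', hone, smul_smul] at ha
  obtain ⟨v, hv⟩ := exists_ne (0 : E)
  obtain ⟨c, x, hx, hc⟩ := exists_eigenvector_of_aeval (ρ g) _
    (Polynomial.X ^ Nat.card K - Polynomial.C ((a : ℂ) * (β 1 1 : ℂ))) rfl
    (Polynomial.X_pow_sub_C_ne_zero Nat.card_pos _) v hv (by
      rw [map_sub, map_pow, Polynomial.aeval_X, Polynomial.aeval_C, ha, LinearMap.sub_apply,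
        Module.algebraMap_end_apply, LinearMap.smul_apply, Module.End.one_apply, sub_self])
  refine ⟨x, hx, ?_⟩
  have key : ∀ h : K, ∃ χ : ℂ, ρ h x = χ • x := by
    intro h
    obtain ⟨j, rfl⟩ := (mem_powers_iff_mem_zpowers.2 (hg h))
    obtain ⟨b, hb⟩ := hpow j
    have hcj : ∀ i : ℕ, (ρ g ^ i) x = c ^ i • x := by
      intro i
      induction i with
      | zero => simp
      | succ i ih => rw [pow_succ, Module.End.mul_apply, hc, map_smul, ih, smul_smul, pow_succ']
    refine ⟨(b⁻¹ : ℂˣ) * c ^ j, ?_⟩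
    rw [mul_smul, ← hcj, hb, LinearMap.smul_apply, smul_smul, Units.inv_mul, one_smul]
  choose χ hχ using key
  exact ⟨χ, hχ⟩

end Eigenvector

/-! ### Modules over the crossed product -/

section Crossed

variable {p d n : ℕ} [NeZero p] {P : Params p d} {lam mu : MultiPart p d n}

/-- The inclusion of the Hecke algebra into the crossed product. -/
def heckeIncl (P : Params p d) (n : ℕ) : H P n →+* Cross P n := SkewMonoidAlgebra.singleOneRingHom

/-- The inclusion of the group into the crossed product. -/
def groupIncl (P : Params p d) (n : ℕ) : G p →* Cross P n := SkewMonoidAlgebra.of (H P n) (G p)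

theorem groupIncl_mul_heckeIncl (g : G p) (r : H P n) :
    groupIncl P n g * heckeIncl P n r = heckeIncl P n (g • r) * groupIncl P n g := by
  change SkewMonoidAlgebra.single g 1 * SkewMonoidAlgebra.single 1 r =
    SkewMonoidAlgebra.single 1 (g • r) * SkewMonoidAlgebra.single g 1
  rw [SkewMonoidAlgebra.single_mul_single, SkewMonoidAlgebra.single_mul_single]
  simp

theorem single_eq_mul (g : G p) (r : H P n) :
    SkewMonoidAlgebra.single g r = heckeIncl P n r * groupIncl P n g := by
  change _ = SkewMonoidAlgebra.single 1 r * SkewMonoidAlgebra.single g 1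
  rw [SkewMonoidAlgebra.single_mul_single]
  simp

variable {M : Type*} [AddCommGroup M] [Module (Cross P n) M]

theorem groupIncl_smul_heckeIncl_smul (g : G p) (r : H P n) (m : M) :
    groupIncl P n g • heckeIncl P n r • m = heckeIncl P n (g • r) • groupIncl P n g • m := by
  rw [smul_smul, groupIncl_mul_heckeIncl, mul_smul]

theorem groupIncl_smul_smul (g h : G p) (m : M) :
    groupIncl P n g • groupIncl P n h • m = groupIncl P n (g * h) • m := by
  rw [smul_smul, ← map_mul]

/-- An additive map from `V(λ)` to a module over the crossed product that commutes with the Hecke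
algebra. -/
def IsHeckeHom (f : V P lam →+ M) : Prop :=
  ∀ (r : H P n) (v : V P lam), f (r • v) = heckeIncl P n r • f v

/-- A map `V(λ) → M` that commutes with the Hecke algebra and transforms under `G_λ` by `χ`. -/
structure IsTypeMap (D : CliffordDatum P lam) (χ : Stab lam → ℂ) (f : V P lam →+ M) : Prop where
  hecke : IsHeckeHom f
  group : ∀ (h : Stab lam) (v : V P lam), groupIncl P n h • f v = f (χ h • D.φ h v)

/-- A map that commutes with the Hecke algebra, composed with a relabelling and a group element. -/
def pullback (hg : P.Generic n) {k : G p} (hk : k • lam = mu) (f : V P mu →+ M) : V P lam →+ M :=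
  ((DistribSMul.toAddMonoidHom M (groupIncl P n k⁻¹)).comp f).comp
    (relabel hg hk).toLinearMap.toAddMonoidHom

theorem pullback_apply (hg : P.Generic n) {k : G p} (hk : k • lam = mu) (f : V P mu →+ M)
    (v : V P lam) : pullback hg hk f v = groupIncl P n k⁻¹ • f (relabel hg hk v) := rfl

theorem IsHeckeHom.pullback {hg : P.Generic n} {k : G p} {hk : k • lam = mu} {f : V P mu →+ M}
    (hf : IsHeckeHom f) : IsHeckeHom (pullback hg hk f) := by
  intro r v
  rw [pullback_apply, relabel_smul, hf, groupIncl_smul_heckeIncl_smul, inv_smul_smul,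
    pullback_apply]

theorem pullback_eq_zero_iff {hg : P.Generic n} {k : G p} {hk : k • lam = mu} {f : V P mu →+ M} :
    pullback hg hk f = 0 ↔ f = 0 := by
  constructor
  · intro h
    ext v
    obtain ⟨v, rfl⟩ := (relabel hg hk).surjective v
    have := congrArg (groupIncl P n k • ·) (DFunLike.congr_fun h v)
    simp only [pullback_apply, groupIncl_smul_smul, mul_inv_cancel, map_one, one_smul,
      AddMonoidHom.zero_apply, smul_zero] at this
    exact this
  · rintro rfl
    ext v
    rw [pullback_apply]
    simp

theorem exists_isHeckeHom (hss : IsSemisimpleRing (H P n)) [Nontrivial M] :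
    ∃ (mu : MultiPart p d n) (f : V P mu →+ M), IsHeckeHom f ∧ f ≠ 0 := by
  let _ : Module (H P n) M := Module.compHom M (heckeIncl P n)
  obtain ⟨S, hS⟩ := IsSemisimpleModule.exists_simple_submodule (H P n) M
  obtain ⟨mu, ⟨e⟩⟩ := exists_equiv_V hss S
  refine ⟨mu, (S.subtype ∘ₗ e.toLinearMap).toAddMonoidHom, fun r v => ?_, fun h => ?_⟩
  · exact (S.subtype ∘ₗ e.toLinearMap).map_smul r v
  · have := nontrivial_V (P.generic_of_isSemisimpleRing hss) mu
    obtain ⟨v, hv⟩ := exists_ne (0 : V P mu)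
    have h1 : (e v : M) = 0 := DFunLike.congr_fun h v
    exact hv (e.map_eq_zero_iff.1 (Subtype.ext h1))

theorem IsHeckeHom.injective (hss : IsSemisimpleRing (H P n)) {f : V P lam →+ M}
    (hf : IsHeckeHom f) (h0 : f ≠ 0) : Function.Injective f := by
  let _ : Module (H P n) M := Module.compHom M (heckeIncl P n)
  have := isSimpleModule_V hss lam
  let F : V P lam →ₗ[H P n] M := { f with map_smul' := hf }
  have hF : F ≠ 0 := fun h => h0 (AddMonoidHom.ext fun v => LinearMap.congr_fun h v)
  exact LinearMap.injective_of_ne_zero hF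

/-- The `G`-translates of the image of `f` generate `M`. -/
def Generates (f : V P lam →+ M) : Prop :=
  AddSubgroup.closure {m : M | ∃ (g : G p) (v : V P lam), m = groupIncl P n g • f v} = ⊤

/-- The translate of `f` by `g` is a Hecke map from `V(g λ)`, and together these maps cover `M`.
Projectivity of `V(μ)` lifts `f'` to their sum. -/
theorem Generates.exists_components (hss : IsSemisimpleRing (H P n)) (hg : P.Generic n)
    {f : V P lam →+ M} (hf : IsHeckeHom f) (hgen : Generates f) {f' : V P mu →+ M}
    (hf' : IsHeckeHom f') : ∃ F : ∀ g : G p, V P mu →ₗ[H P n] V P (g • lam),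
      ∀ v, f' v = ∑ g : G p, groupIncl P n g • f ((relabel hg (rfl : g • lam = _)).symm (F g v)) := by
  let _ : Module (H P n) M := Module.compHom M (heckeIncl P n)
  let j : ∀ g : G p, V P (g • lam) →ₗ[H P n] M := fun g =>
    { toFun := fun w => groupIncl P n g • f ((relabel hg (rfl : g • lam = _)).symm w)
      map_add' := fun a b => by rw [map_add, map_add, smul_add]
      map_smul' := fun r w => by
        obtain ⟨w, rfl⟩ := (relabel hg (rfl : g • lam = _)).surjective w
        have h1 := relabel_smul hg (rfl : g • lam = _) (g⁻¹ • r) w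
        rw [smul_inv_smul] at h1
        rw [← h1, LinearEquiv.symm_apply_apply, LinearEquiv.symm_apply_apply, hf,
          groupIncl_smul_heckeIncl_smul, smul_inv_smul]
        rfl }
  let J : (∀ g : G p, V P (g • lam)) →ₗ[H P n] M := ∑ g, j g ∘ₗ LinearMap.proj g
  have hJ : ∀ w, J w = ∑ g, j g (w g) := fun w => by
    rw [LinearMap.sum_apply]
    rfl
  have hsurj : Function.Surjective J := by
    intro m
    have hm : m ∈ AddSubgroup.closure {m : M | ∃ (g : G p) (v : V P lam),
        m = groupIncl P n g • f v} := by
      rw [hgen]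
      trivial
    have hle : AddSubgroup.closure {m : M | ∃ (g : G p) (v : V P lam),
        m = groupIncl P n g • f v} ≤ (LinearMap.range J).toAddSubgroup := by
      rw [AddSubgroup.closure_le]
      rintro _ ⟨g, v, rfl⟩
      classical
      refine ⟨Pi.single g (relabel hg rfl v), ?_⟩
      rw [hJ, Finset.sum_eq_single g]
      · rw [Pi.single_eq_same]
        change groupIncl P n g • f ((relabel hg _).symm (relabel hg _ v)) = _
        rw [LinearEquiv.symm_apply_apply]
      · intro g' _ hne
        rw [Pi.single_eq_of_ne hne, map_zero]
      · intro h
        exact absurd (Finset.mem_univ g) h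
    exact hle hm
  have := Module.projective_of_isSemisimpleRing (H P n) (V P mu)
  let F' : V P mu →ₗ[H P n] M := { f' with map_smul' := hf' }
  obtain ⟨h, hh⟩ := Module.projective_lifting_property J F' hsurj
  refine ⟨fun g => LinearMap.proj g ∘ₗ h, fun v => ?_⟩
  have h1 : J (h v) = f' v := LinearMap.congr_fun hh v
  rw [← h1, hJ]
  rfl

theorem Generates.exists_smul_eq (hss : IsSemisimpleRing (H P n)) {f : V P lam →+ M}
    (hf : IsHeckeHom f) (hgen : Generates f) {f' : V P mu →+ M} (hf' : IsHeckeHom f')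
    (h0 : f' ≠ 0) : ∃ k : G p, k • lam = mu := by
  have hg := P.generic_of_isSemisimpleRing hss
  obtain ⟨F, hF⟩ := hgen.exists_components hss hg hf hf'
  by_contra! h
  apply h0
  ext v
  rw [hF, AddMonoidHom.zero_apply]
  refine Finset.sum_eq_zero fun g _ => ?_
  rw [linearMap_eq_zero_of_ne hg (h g).symm (F g), LinearMap.zero_apply, map_zero, map_zero,
    smul_zero]

/-- Components at `g` outside `G_λ` vanish, and for `g` in `G_λ` the type condition turns the
translate of `f` into a multiple of `f` itself. -/
theorem Generates.eq_smul (hss : IsSemisimpleRing (H P n)) {D : CliffordDatum P lam}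
    {χ : Stab lam → ℂ} {f : V P lam →+ M} (hf : IsTypeMap D χ f) (hgen : Generates f)
    {f' : V P lam →+ M} (hf' : IsHeckeHom f') : ∃ c : ℂ, ∀ v, f' v = f (c • v) := by
  have hg := P.generic_of_isSemisimpleRing hss
  obtain ⟨F, hF⟩ := hgen.exists_components hss hg hf.hecke hf'
  have key : ∀ g : G p, ∃ c : ℂ, ∀ v,
      groupIncl P n g • f ((relabel hg (rfl : g • lam = _)).symm (F g v)) = f (c • v) := by
    intro g
    by_cases h : g • lam = lam
    · obtain ⟨c, hc⟩ := hom_eq_smul hg ((D.φ ⟨g, h⟩).toLinearMap ∘ₗ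
        (relabel hg (rfl : g • lam = _)).symm.toLinearMap ∘ₗ (F g).restrictScalars ℂ) fun i m => by
          change D.φ ⟨g, h⟩ ((relabel hg _).symm (F g (T P i • m))) =
            T P i • D.φ ⟨g, h⟩ ((relabel hg _).symm (F g m))
          rw [map_smul]
          obtain ⟨w, hw⟩ := (relabel hg (rfl : g • lam = _)).surjective (F g m)
          have h1 := relabel_smul hg (rfl : g • lam = _) (g⁻¹ • T P i) w
          rw [smul_inv_smul] at h1
          rw [← hw, ← h1, LinearEquiv.symm_apply_apply, LinearEquiv.symm_apply_apply, D.φ_smul,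
            smul_inv_smul]
      refine ⟨χ ⟨g, h⟩ * c, fun v => ?_⟩
      have h1 := hf.group ⟨g, h⟩ ((relabel hg (rfl : g • lam = _)).symm (F g v))
      have h2 : D.φ ⟨g, h⟩ ((relabel hg (rfl : g • lam = _)).symm (F g v)) = c • v := hc v
      rw [h2, smul_smul] at h1
      exact h1
    · refine ⟨0, fun v => ?_⟩
      rw [linearMap_eq_zero_of_ne hg (Ne.symm h) (F g), LinearMap.zero_apply, map_zero, map_zero,
        smul_zero, zero_smul, map_zero]
  choose c hc using key
  refine ⟨∑ g, c g, fun v => ?_⟩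
  rw [hF, Finset.sum_smul, map_sum]
  exact Finset.sum_congr rfl fun g _ => hc g v

/-- A module generated by the image of a nonzero type map is simple. -/
theorem Generates.isSimpleModule (hss : IsSemisimpleRing (H P n)) {D : CliffordDatum P lam}
    {χ : Stab lam → ℂ} {f : V P lam →+ M} (hf : IsTypeMap D χ f) (hgen : Generates f)
    (h0 : f ≠ 0) : IsSimpleModule (Cross P n) M := by
  have hg := P.generic_of_isSemisimpleRing hss
  have hM : Nontrivial M := by
    by_contra h
    rw [not_nontrivial_iff_subsingleton] at h
    exact h0 (AddMonoidHom.ext fun v => Subsingleton.elim _ _)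
  rw [isSimpleModule_iff]
  refine { exists_pair_ne := ⟨⊥, ⊤, bot_ne_top⟩, eq_bot_or_eq_top := fun W => ?_ }
  rw [or_iff_not_imp_left]
  intro hW
  have : Nontrivial W := Submodule.nontrivial_iff_ne_bot.2 hW
  obtain ⟨mu, f₁, hf₁, hf₁0⟩ := exists_isHeckeHom (M := W) hss
  let f₂ : V P mu →+ M := W.subtype.toAddMonoidHom.comp f₁
  have hf₂ : IsHeckeHom f₂ := fun r v => congrArg W.subtype (hf₁ r v)
  have hf₂0 : f₂ ≠ 0 := fun h => hf₁0 (AddMonoidHom.ext fun v =>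
    Subtype.ext (DFunLike.congr_fun h v))
  -- A nonzero Hecke map into the submodule comes from a shift of `λ`. Pulled back to `V(λ)` it is a
  -- nonzero multiple of `f`, so the submodule contains the image of `f` and its translates.
  obtain ⟨k, hk⟩ := hgen.exists_smul_eq hss hf.hecke hf₂ hf₂0
  obtain ⟨c, hc⟩ := hgen.eq_smul hss hf (hf₂.pullback (hg := hg) (hk := hk))
  have hc0 : c ≠ 0 := by
    rintro rfl
    apply hf₂0
    rw [← pullback_eq_zero_iff (hg := hg) (hk := hk)]
    ext v
    rw [hc, zero_smul, map_zero, AddMonoidHom.zero_apply]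
  have hfW : ∀ v, f v ∈ W := fun v => by
    have h1 := hc (c⁻¹ • v)
    rw [smul_smul, mul_inv_cancel₀ hc0, one_smul, pullback_apply] at h1
    rw [← h1]
    exact W.smul_mem _ (f₁ _).2
  rw [eq_top_iff]
  intro m _
  have hle : AddSubgroup.closure {m : M | ∃ (g : G p) (v : V P lam), m = groupIncl P n g • f v} ≤
      W.toAddSubgroup := by
    rw [AddSubgroup.closure_le]
    rintro _ ⟨g, v, rfl⟩
    exact W.smul_mem _ (hfW v)
  rw [hgen] at hle
  exact hle (AddSubgroup.mem_top m)

end Crossed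

end

section

/-! ### The modules induced from stabilizers -/

section TypeMaps

variable {p d n : ℕ} [NeZero p] {P : Params p d} {lam mu : MultiPart p d n}
  {M : Type*} [AddCommGroup M] [Module (Cross P n) M]

/-- Every nonzero module over the crossed product admits a nonzero type map. -/
theorem exists_isTypeMap (hss : IsSemisimpleRing (H P n)) [Nontrivial M]
    (D : ∀ lam : MultiPart p d n, CliffordDatum P lam) :
    ∃ (lam : MultiPart p d n) (χ : Stab lam → ℂ) (f : V P lam →+ M),
      IsTypeMap (D lam) χ f ∧ f ≠ 0 := by
  obtain ⟨lam, f₀, hf₀, h0⟩ := exists_isHeckeHom (M := M) hss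
  let _ : Module (H P n) M := Module.compHom M (heckeIncl P n)
  let _ : Module ℂ M := Module.compHom M (algebraMap ℂ (H P n))
  have : IsScalarTower ℂ (H P n) M := ⟨fun c r m => by
    rw [Algebra.smul_def, mul_smul]
    rfl⟩
  have : SMulCommClass (H P n) ℂ M := ⟨fun r c m => by
    change r • (algebraMap ℂ (H P n) c) • m = (algebraMap ℂ (H P n) c) • r • m
    rw [smul_smul, smul_smul, Algebra.commutes]⟩
  have hcomm : ∀ (g : G p) (c : ℂ) (m : M), groupIncl P n g • c • m = c • groupIncl P n g • m := by
    intro g c m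
    refine (groupIncl_smul_heckeIncl_smul g (algebraMap ℂ (H P n) c) m).trans ?_
    rw [G_smul_algebraMap]
    rfl
  -- The stabilizer acts on Hecke maps by `f ↦ h f φ_h⁻¹`, projectively with factor set `α⁻¹`; a
  -- common eigenvector is a type map.
  let ρ : Stab lam → Module.End ℂ (V P lam →ₗ[H P n] M) := fun h =>
    { toFun := fun f =>
        { toFun := fun v => groupIncl P n h • f (((D lam).φ h).symm v)
          map_add' := fun a b => by rw [map_add, map_add, smul_add]
          map_smul' := fun r v => by
            obtain ⟨w, rfl⟩ := ((D lam).φ h).surjective v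
            have h1 := (D lam).φ_smul h ((h : G p)⁻¹ • r) w
            rw [smul_inv_smul] at h1
            rw [← h1, LinearEquiv.symm_apply_apply, LinearEquiv.symm_apply_apply, map_smul]
            refine (groupIncl_smul_heckeIncl_smul _ _ _).trans ?_
            rw [smul_inv_smul]
            rfl }
      map_add' := fun a b => LinearMap.ext fun v => smul_add _ _ _
      map_smul' := fun c a => LinearMap.ext fun v => hcomm _ c _ }
  have hρ : ∀ h f v, ρ h f v = groupIncl P n h • f (((D lam).φ h).symm v) := fun _ _ _ => rfl
  have hone : ρ 1 = ((((D lam).α 1 1)⁻¹ : ℂˣ) : ℂ) • 1 := by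
    refine LinearMap.ext fun f => LinearMap.ext fun v => ?_
    obtain ⟨w, rfl⟩ := ((D lam).φ 1).surjective v
    rw [hρ, LinearEquiv.symm_apply_apply, (D lam).φ_one, OneMemClass.coe_one, map_one, one_smul,
      LinearMap.smul_apply, LinearMap.smul_apply, Module.End.one_apply,
      LinearMap.map_smul_of_tower, smul_smul, Units.inv_mul, one_smul]
  have hmul : ∀ g h, ρ g * ρ h = ((((D lam).α g h)⁻¹ : ℂˣ) : ℂ) • ρ (g * h) := by
    intro g h
    refine LinearMap.ext fun f => LinearMap.ext fun v => ?_
    obtain ⟨v, rfl⟩ := ((D lam).φ g).surjective v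
    obtain ⟨v, rfl⟩ := ((D lam).φ h).surjective v
    rw [Module.End.mul_apply, hρ, hρ, LinearEquiv.symm_apply_apply, LinearEquiv.symm_apply_apply,
      groupIncl_smul_smul, LinearMap.smul_apply, LinearMap.smul_apply, (D lam).φ_mul, hρ, map_smul,
      LinearEquiv.symm_apply_apply, LinearMap.map_smul_of_tower, hcomm, smul_smul, Units.inv_mul,
      one_smul]
    rfl
  let F₀ : V P lam →ₗ[H P n] M := { f₀ with map_smul' := hf₀ }
  have : Nontrivial (V P lam →ₗ[H P n] M) :=
    ⟨F₀, 0, fun h => h0 (AddMonoidHom.ext fun v => LinearMap.congr_fun h v)⟩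
  obtain ⟨f, hf, χ, hχ⟩ := exists_common_eigenvector ρ (fun g h => ((D lam).α g h)⁻¹) hone hmul
  refine ⟨lam, χ, f.toAddMonoidHom, ⟨fun r v => f.map_smul r v, fun h v => ?_⟩, fun h => hf ?_⟩
  · have h1 := LinearMap.congr_fun (hχ h) ((D lam).φ h v)
    rw [hρ, LinearEquiv.symm_apply_apply] at h1
    refine h1.trans ?_
    exact (LinearMap.map_smul_of_tower f (χ h) _).symm
  · exact LinearMap.ext fun v => DFunLike.congr_fun h v

end TypeMaps

/-! ### Characters of the twisted group algebra -/

section Twisted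

variable {p d n : ℕ} [NeZero p] {P : Params p d} {lam mu : MultiPart p d n}
  (D : CliffordDatum P lam)

theorem CliffordDatum.mem_of_c (S : Subalgebra ℂ D.Tw) (h : ∀ g, D.c g ∈ S) (a : D.Tw) : a ∈ S := by
  obtain ⟨x, rfl⟩ := RingQuot.mkAlgHom_surjective ℂ
    (TwistedRel (Stab lam) fun g h => (D.α g h)⁻¹) a
  have hx : x ∈ Algebra.adjoin ℂ (Set.range (FreeAlgebra.ι ℂ (X := Stab lam))) := by
    rw [FreeAlgebra.adjoin_range_ι]
    trivial
  have : x ∈ S.comap (RingQuot.mkAlgHom ℂ (TwistedRel (Stab lam) fun g h => (D.α g h)⁻¹)) := by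
    refine Algebra.adjoin_le ?_ hx
    rintro _ ⟨g, rfl⟩
    exact h g
  exact this

/-- The character of the twisted group algebra given by values on the group. -/
def CliffordDatum.character (χ : Stab lam → ℂ) (hone : χ 1 = (((D.α 1 1)⁻¹ : ℂˣ) : ℂ))
    (hmul : ∀ g h, χ g * χ h = (((D.α g h)⁻¹ : ℂˣ) : ℂ) * χ (g * h)) : D.Tw →ₐ[ℂ] ℂ :=
  RingQuot.liftAlgHom ℂ ⟨FreeAlgebra.lift ℂ χ, by
    intro x y h
    cases h with
    | mul g h => simpa using hmul g h
    | one => simpa using hone⟩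

theorem CliffordDatum.character_c (χ : Stab lam → ℂ) (hone : χ 1 = (((D.α 1 1)⁻¹ : ℂˣ) : ℂ))
    (hmul : ∀ g h, χ g * χ h = (((D.α g h)⁻¹ : ℂˣ) : ℂ) * χ (g * h)) (h : Stab lam) :
    D.character χ hone hmul (D.c h) = χ h := by
  refine (RingQuot.liftAlgHom_mkAlgHom_apply ℂ _ _ _).trans ?_
  simp

variable {M : Type*} [AddCommGroup M] [Module (Cross P n) M]

theorem IsTypeMap.eq_of_apply_eq {D} (hss : IsSemisimpleRing (H P n)) {χ : Stab lam → ℂ}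
    {f : V P lam →+ M} (hf : IsTypeMap D χ f) (h0 : f ≠ 0) {a b : ℂ} {v : V P lam} (hv : v ≠ 0)
    (h : f (a • v) = f (b • v)) : a = b :=
  smul_left_injective ℂ hv (hf.hecke.injective hss h0 h)

theorem IsTypeMap.map_one {D : CliffordDatum P lam} (hss : IsSemisimpleRing (H P n))
    {χ : Stab lam → ℂ} {f : V P lam →+ M} (hf : IsTypeMap D χ f) (h0 : f ≠ 0) :
    χ 1 = (((D.α 1 1)⁻¹ : ℂˣ) : ℂ) := by
  have := nontrivial_V (P.generic_of_isSemisimpleRing hss) lam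
  obtain ⟨v, hv⟩ := exists_ne (0 : V P lam)
  have h1 := hf.group 1 v
  rw [OneMemClass.coe_one, _root_.map_one, one_smul, D.φ_one, smul_smul] at h1
  have h2 : f ((1 : ℂ) • v) = f ((χ 1 * (D.α 1 1 : ℂ)) • v) := by rw [one_smul]; exact h1
  have h3 := hf.eq_of_apply_eq hss h0 hv h2
  rw [Units.val_inv_eq_inv_val]
  exact eq_inv_of_mul_eq_one_left h3.symm

/-- The action of `g h` on the image of a vector is computed in two ways and compared through the
injectivity of `f`. -/
theorem IsTypeMap.map_mul {D : CliffordDatum P lam} (hss : IsSemisimpleRing (H P n))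
    {χ : Stab lam → ℂ} {f : V P lam →+ M} (hf : IsTypeMap D χ f) (h0 : f ≠ 0) (g h : Stab lam) :
    χ g * χ h = (((D.α g h)⁻¹ : ℂˣ) : ℂ) * χ (g * h) := by
  have := nontrivial_V (P.generic_of_isSemisimpleRing hss) lam
  obtain ⟨v, hv⟩ := exists_ne (0 : V P lam)
  have h1 := groupIncl_smul_smul (P := P) (n := n) (g : G p) (h : G p) (f v)
  rw [hf.group, hf.group, (D.φ g).map_smul, smul_smul, D.φ_mul, smul_smul, ← Subgroup.coe_mul,
    hf.group] at h1
  have h3 := hf.eq_of_apply_eq hss h0 (fun h => hv ((D.φ _).map_eq_zero_iff.1 h)) h1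
  rw [← h3, mul_comm (((D.α g h)⁻¹ : ℂˣ) : ℂ), mul_assoc, Units.mul_inv, mul_one]

end Twisted

section SpanningVec

variable {p d n : ℕ} [NeZero p] {P : Params p d} {lam : MultiPart p d n}
  {D : CliffordDatum P lam} {π : Type*} [AddCommGroup π] [Module ℂ π] [Module D.Tw π]

/-- `x` spans `π`, and the elements `c_h` act on it by `χ`. -/
structure IsSpanningVec (D : CliffordDatum P lam) {π : Type*} [AddCommGroup π] [Module ℂ π]
    [Module D.Tw π] (χ : Stab lam → ℂ) (x : π) : Prop where
  ne_zero : x ≠ 0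
  exists_smul : ∀ y : π, ∃ a : ℂ, a • x = y
  c_smul : ∀ h, D.c h • x = χ h • x

theorem IsSpanningVec.finrank {χ : Stab lam → ℂ} {x : π} (hx : IsSpanningVec D χ x) :
    Module.finrank ℂ π = 1 :=
  finrank_eq_one x hx.ne_zero hx.exists_smul

theorem IsSpanningVec.exists_functional {χ : Stab lam → ℂ} {x : π} (hx : IsSpanningVec D χ x) :
    ∃ ℓ : π →ₗ[ℂ] ℂ, ℓ x = 1 ∧ ∀ y, ℓ y • x = y := by
  choose a ha using hx.exists_smul
  have hinj := smul_left_injective ℂ hx.ne_zero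
  refine ⟨{ toFun := a, map_add' := fun y z => hinj ?_, map_smul' := fun c y => hinj ?_ },
    hinj ?_, ha⟩
  · change a (y + z) • x = (a y + a z) • x
    rw [add_smul, ha, ha, ha]
  · change a (c • y) • x = (c * a y) • x
    rw [mul_smul, ha, ha]
  · change a x • x = (1 : ℂ) • x
    rw [ha, one_smul]

end SpanningVec

/-! ### The canonical map into the induced module -/

section Induced

variable {p d n : ℕ} [NeZero p] {P : Params p d} {lam : MultiPart p d n}
  {D : CliffordDatum P lam} {π : Type*} [AddCommGroup π] [Module ℂ π] [Module D.Tw π]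
  [IsScalarTower ℂ D.Tw π]

/-- The stabilizer is cyclic, so there is a common eigenvector of the `c_h`. Its line is stable
under the twisted group algebra and fills the simple module. -/
theorem exists_isSpanningVec (hπ : IsSimpleModule D.Tw π) :
    ∃ (χ : Stab lam → ℂ) (x : π), IsSpanningVec D χ x := by
  have := IsSimpleModule.nontrivial D.Tw π
  obtain ⟨x, hx, χ, hχ⟩ := exists_common_eigenvector (fun h => D.cAct π h)
    (fun g h => (D.α g h)⁻¹)
    (LinearMap.ext fun x => by rw [D.cAct_one, Units.val_inv_eq_inv_val]; rfl)
    (fun g h => LinearMap.ext fun x => by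
      rw [Module.End.mul_apply, D.cAct_mul, Units.val_inv_eq_inv_val]; rfl)
  refine ⟨χ, x, hx, fun y => ?_, hχ⟩
  let S : Subalgebra ℂ D.Tw :=
    { carrier := {a | ∃ c : ℂ, a • x = c • x}
      mul_mem' := by
        rintro a b ⟨c, hc⟩ ⟨c', hc'⟩
        refine ⟨c' * c, ?_⟩
        rw [mul_smul, hc', smul_comm, hc, smul_smul]
      add_mem' := by
        rintro a b ⟨c, hc⟩ ⟨c', hc'⟩
        exact ⟨c + c', by rw [add_smul, hc, hc', add_smul]⟩
      algebraMap_mem' := fun c => ⟨c, by rw [algebraMap_smul]⟩ }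
  have hS : ∀ a, a ∈ S := D.mem_of_c S fun g => ⟨χ g, hχ g⟩
  obtain ⟨a, ha⟩ := IsSimpleModule.toSpanSingleton_surjective D.Tw hx y
  obtain ⟨c, hc⟩ := hS a
  exact ⟨c, hc.symm.trans ha⟩

/-- The element `a ⊗ z` of the induced module. -/
def indTmul (D : CliffordDatum P lam) (π : Type*) [AddCommGroup π] [Module ℂ π] [Module D.Tw π]
    [IsScalarTower ℂ D.Tw π] (a : Cross P n) (z : V P lam ⊗[ℂ] π) : RG D π :=
  Submodule.Quotient.mk (a ⊗ₜ[ℤ] (show VTensor D π from z))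

theorem indTmul_mul (a : Cross P n) (b : CrossStab P lam) (z : V P lam ⊗[ℂ] π) :
    indTmul D π (a * crossIncl P lam b) z = indTmul D π a (crossAct D π b z) :=
  (Submodule.Quotient.eq _).2 (Submodule.subset_span ⟨a, b, z, rfl⟩)

theorem smul_indTmul (a b : Cross P n) (z : V P lam ⊗[ℂ] π) :
    a • indTmul D π b z = indTmul D π (a * b) z := rfl

theorem crossAct_single (h : Stab lam) (r : H P n) (v : V P lam) (y : π) :
    crossAct D π (SkewMonoidAlgebra.single h r) (v ⊗ₜ y) = (r • D.φ h v) ⊗ₜ (D.c h • y) := by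
  have : crossAct D π (SkewMonoidAlgebra.single h r) = heckeAct P lam π r * groupAct D π h :=
    SkewMonoidAlgebra.liftNC_single _ _ _ _
  rw [this, Module.End.mul_apply, groupAct_tmul, heckeAct_tmul]

theorem crossIncl_single (h : Stab lam) (r : H P n) :
    crossIncl P lam (SkewMonoidAlgebra.single h r) = SkewMonoidAlgebra.single (h : G p) r :=
  SkewMonoidAlgebra.mapDomain_single

/-- The canonical type map into the induced module. -/
def indMap (D : CliffordDatum P lam) {π : Type*} [AddCommGroup π] [Module ℂ π] [Module D.Tw π]
    [IsScalarTower ℂ D.Tw π] (x : π) : V P lam →+ RG D π where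
  toFun v := indTmul D π 1 (v ⊗ₜ x)
  map_zero' := by
    rw [TensorProduct.zero_tmul]
    exact congrArg Submodule.Quotient.mk (TensorProduct.tmul_zero _ _)
  map_add' v w := by
    rw [TensorProduct.add_tmul]
    exact congrArg Submodule.Quotient.mk (TensorProduct.tmul_add _ _ _)

theorem indMap_apply (x : π) (v : V P lam) : indMap D x v = indTmul D π 1 (v ⊗ₜ x) := rfl

theorem isTypeMap_indMap {χ : Stab lam → ℂ} {x : π} (hx : IsSpanningVec D χ x) :
    IsTypeMap D χ (indMap D x) where
  hecke r v := by
    have h1 : heckeIncl P n r = SkewMonoidAlgebra.single ((1 : Stab lam) : G p) r := rfl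
    -- The unit of the group acts by `φ_1 ⊗ c_1`, where `φ_1` and `c_1` are the mutually inverse
    -- scalars `α(1, 1)` and `α(1, 1)⁻¹`, not necessarily `1`.
    have h2 : (r • v) ⊗ₜ[ℂ] x =
        crossAct D π (SkewMonoidAlgebra.single 1 r) (((D.φ 1).symm v) ⊗ₜ ((D.α 1 1 : ℂ) • x)) := by
      rw [crossAct_single, LinearEquiv.apply_symm_apply, smul_comm]
      have := D.cAct_one π x
      rw [D.cAct_apply] at this
      rw [this, smul_smul, mul_inv_cancel₀ (Units.ne_zero _), one_smul]
    have h3 : v ⊗ₜ[ℂ] x = ((D.φ 1).symm v) ⊗ₜ[ℂ] ((D.α 1 1 : ℂ) • x) := by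
      obtain ⟨w, rfl⟩ := (D.φ 1).surjective v
      rw [LinearEquiv.symm_apply_apply, D.φ_one, TensorProduct.smul_tmul]
    rw [indMap_apply, indMap_apply, h2, ← indTmul_mul, crossIncl_single, ← h1, ← h3, smul_indTmul,
      one_mul, mul_one]
  group h v := by
    rw [indMap_apply, smul_indTmul, mul_one, indMap_apply, TensorProduct.smul_tmul, ← hx.c_smul]
    have h1 : groupIncl P n (h : G p) = 1 * crossIncl P lam (SkewMonoidAlgebra.single h 1) := by
      rw [one_mul, crossIncl_single]
      rfl
    rw [h1, indTmul_mul, crossAct_single, one_smul]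

theorem induction_ind {C : RG D π → Prop} (hadd : ∀ a b, C a → C b → C (a + b))
    (hsingle : ∀ (g : G p) (r : H P n) (v : V P lam) (y : π),
      C (indTmul D π (SkewMonoidAlgebra.single g r) (v ⊗ₜ y))) (m : RG D π) : C m := by
  have h0 : C 0 := by
    have := hsingle 1 0 0 0
    rw [SkewMonoidAlgebra.single_zero] at this
    have h1 : indTmul D π (0 : Cross P n) ((0 : V P lam) ⊗ₜ (0 : π)) = 0 :=
      congrArg Submodule.Quotient.mk (TensorProduct.zero_tmul _ _)
    rwa [h1] at this
  obtain ⟨t, rfl⟩ := Submodule.Quotient.mk_surjective _ m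
  induction t using TensorProduct.induction_on with
  | zero => exact h0
  | add a b ha hb => exact hadd _ _ ha hb
  | tmul a z =>
    change C (indTmul D π a z)
    induction a using SkewMonoidAlgebra.induction_on with
    | zero =>
      have h1 : indTmul D π (0 : Cross P n) z = 0 :=
        congrArg Submodule.Quotient.mk (TensorProduct.zero_tmul _ _)
      rw [h1]
      exact h0
    | add a b ha hb =>
      have h1 : indTmul D π (a + b) z = indTmul D π a z + indTmul D π b z :=
        congrArg Submodule.Quotient.mk (TensorProduct.add_tmul _ _ _)
      rw [h1]
      exact hadd _ _ ha hb
    | single g r =>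
      induction (show V P lam ⊗[ℂ] π from z) using TensorProduct.induction_on with
      | zero =>
        have h1 : indTmul D π (SkewMonoidAlgebra.single g r) 0 = 0 :=
          congrArg Submodule.Quotient.mk (TensorProduct.tmul_zero _ _)
        rw [h1]
        exact h0
      | add a b ha hb =>
        have h1 : indTmul D π (SkewMonoidAlgebra.single g r) (a + b) =
            indTmul D π (SkewMonoidAlgebra.single g r) a +
              indTmul D π (SkewMonoidAlgebra.single g r) b :=
          congrArg Submodule.Quotient.mk (TensorProduct.tmul_add _ _ _)
        rw [h1]
        exact hadd _ _ ha hb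
      | tmul v y => exact hsingle g r v y

theorem generates_indMap {χ : Stab lam → ℂ} {x : π} (hx : IsSpanningVec D χ x) :
    Generates (indMap D x) := by
  rw [Generates, AddSubgroup.eq_top_iff']
  intro m
  refine induction_ind (fun a b ha hb => add_mem ha hb) (fun g r v y => ?_) m
  obtain ⟨a, rfl⟩ := hx.exists_smul y
  refine AddSubgroup.subset_closure ⟨g, (g⁻¹ • r) • a • v, ?_⟩
  rw [(isTypeMap_indMap hx).hecke, groupIncl_smul_heckeIncl_smul, smul_inv_smul, indMap_apply,
    smul_indTmul, smul_indTmul, mul_one, ← single_eq_mul, TensorProduct.smul_tmul]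

end Induced

end

section

/-! ### Nonvanishing and universal property of the induced module -/

section Universal

variable {p d n : ℕ} [NeZero p] {P : Params p d} {lam : MultiPart p d n}
  {D : CliffordDatum P lam} {π : Type*} [AddCommGroup π] [Module ℂ π] [Module D.Tw π]
  [IsScalarTower ℂ D.Tw π]

open Classical in
/-- The projection of the crossed product onto the part supported on the stabilizer. -/
def stabProj (P : Params p d) (lam : MultiPart p d n) : Cross P n →+ CrossStab P lam :=
  SkewMonoidAlgebra.liftNC
    ((SkewMonoidAlgebra.singleOneRingHom : H P n →+* CrossStab P lam) : H P n →+ CrossStab P lam)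
    fun g => if h : g ∈ Stab lam then SkewMonoidAlgebra.single ⟨g, h⟩ 1 else 0

theorem stabProj_single_of_mem {g : G p} (h : g ∈ Stab lam) (r : H P n) :
    stabProj P lam (SkewMonoidAlgebra.single g r) = SkewMonoidAlgebra.single ⟨g, h⟩ r := by
  rw [stabProj, SkewMonoidAlgebra.liftNC_single, dif_pos h]
  change SkewMonoidAlgebra.single 1 r * SkewMonoidAlgebra.single _ 1 = _
  rw [SkewMonoidAlgebra.single_mul_single]
  simp

theorem stabProj_single_of_notMem {g : G p} (h : g ∉ Stab lam) (r : H P n) :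
    stabProj P lam (SkewMonoidAlgebra.single g r) = 0 := by
  rw [stabProj, SkewMonoidAlgebra.liftNC_single, dif_neg h, mul_zero]

theorem stabProj_mul (a : Cross P n) (b : CrossStab P lam) :
    stabProj P lam (a * crossIncl P lam b) = stabProj P lam a * b := by
  induction b using SkewMonoidAlgebra.induction_on with
  | zero => simp
  | add b b' hb hb' => rw [map_add, mul_add, map_add, hb, hb', mul_add]
  | single h s =>
    rw [crossIncl_single]
    induction a using SkewMonoidAlgebra.induction_on with
    | zero => simp
    | add a a' ha ha' => rw [add_mul, map_add, ha, ha', map_add, add_mul]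
    | single g r =>
      rw [SkewMonoidAlgebra.single_mul_single]
      by_cases hg : g ∈ Stab lam
      · rw [stabProj_single_of_mem hg, stabProj_single_of_mem (mul_mem hg h.2),
          SkewMonoidAlgebra.single_mul_single]
        rfl
      · rw [stabProj_single_of_notMem hg, stabProj_single_of_notMem, zero_mul]
        intro h'
        exact hg ((Subgroup.mul_mem_cancel_right _ h.2).1 h')

/-- The projection of the crossed product to the part over `G_λ` is linear for right multiplication
by that part, so it gives an additive retraction of the induced module onto `V(λ) ⊗ π`. -/
theorem indTmul_one_injective : Function.Injective (indTmul D π 1) := by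
  let B : Cross P n →+ VTensor D π →+ V P lam ⊗[ℂ] π :=
    ((Module.toAddMonoidEnd (Module.End ℂ (V P lam ⊗[ℂ] π)) (V P lam ⊗[ℂ] π)).toAddMonoidHom.comp
      (crossAct D π).toAddMonoidHom).comp (stabProj P lam)
  let L : Cross P n ⊗[ℤ] VTensor D π →+ V P lam ⊗[ℂ] π := TensorProduct.liftAddHom B fun c a z => by
    rw [map_zsmul, map_zsmul]
    rfl
  have hL : ∀ a (z : VTensor D π), L (a ⊗ₜ z) = crossAct D π (stabProj P lam a) z :=
    fun _ _ => TensorProduct.liftAddHom_tmul _ _ _ _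
  -- The map `L` is only additive, so its kernel is replaced by the largest submodule inside it.
  let N : Submodule (Cross P n) (Cross P n ⊗[ℤ] VTensor D π) :=
    { carrier := {t | ∀ a : Cross P n, L (a • t) = 0}
      add_mem' := fun {s t} hs ht a => by rw [smul_add, map_add, hs a, ht a, add_zero]
      zero_mem' := fun a => by rw [smul_zero, map_zero]
      smul_mem' := fun b t ht a => by rw [smul_smul]; exact ht _ }
  have hN : Submodule.span (Cross P n) {t : Cross P n ⊗[ℤ] VTensor D π |
      ∃ (a : Cross P n) (b : CrossStab P lam) (x : VTensor D π),
        t = (a * crossIncl P lam b) ⊗ₜ[ℤ] x - a ⊗ₜ[ℤ] (b • x)} ≤ N := by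
    rw [Submodule.span_le]
    rintro _ ⟨a, b, x, rfl⟩ a'
    have h1 : L ((a' * (a * crossIncl P lam b)) ⊗ₜ x) - L ((a' * a) ⊗ₜ (b • x)) = 0 := by
      rw [hL, hL, ← mul_assoc, stabProj_mul, map_mul]
      exact sub_self _
    rw [smul_sub, map_sub]
    exact h1
  intro z w h
  have h1 := hN ((Submodule.Quotient.eq _).1 h) 1
  rw [one_smul, map_sub, sub_eq_zero, hL, hL] at h1
  have h2 : stabProj P lam 1 = 1 := stabProj_single_of_mem (one_mem _) 1
  rw [h2, map_one] at h1
  exact h1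

theorem indMap_ne_zero (hg : P.Generic n) {χ : Stab lam → ℂ} {x : π} (hx : IsSpanningVec D χ x) :
    indMap D x ≠ 0 := by
  intro h
  obtain ⟨ℓ, hℓ, -⟩ := hx.exists_functional
  have := nontrivial_V hg lam
  obtain ⟨v, hv⟩ := exists_ne (0 : V P lam)
  have h1 : indTmul D π 1 (v ⊗ₜ x) = indTmul D π 1 0 :=
    (DFunLike.congr_fun h v).trans (congrArg Submodule.Quotient.mk (TensorProduct.tmul_zero _ _)).symm
  have h2 := congrArg ((TensorProduct.rid ℂ (V P lam)).toLinearMap ∘ₗ LinearMap.lTensor (V P lam) ℓ)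
    (indTmul_one_injective h1)
  apply hv
  simpa [hℓ] using h2

theorem isSimpleModule_RG (hss : IsSemisimpleRing (H P n)) {χ : Stab lam → ℂ} {x : π}
    (hx : IsSpanningVec D χ x) : IsSimpleModule (Cross P n) (RG D π) :=
  (generates_indMap hx).isSimpleModule hss (isTypeMap_indMap hx)
    (indMap_ne_zero (P.generic_of_isSemisimpleRing hss) hx)

variable {M : Type*} [AddCommGroup M] [Module (Cross P n) M]

/-- The universal property of the induced module. -/
theorem IsTypeMap.exists_linearMap {χ : Stab lam → ℂ} {x : π} (hx : IsSpanningVec D χ x)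
    {f : V P lam →+ M} (hf : IsTypeMap D χ f) :
    ∃ F : RG D π →ₗ[Cross P n] M, ∀ v, F (indMap D x v) = f v := by
  obtain ⟨ℓ, hℓ, hℓx⟩ := hx.exists_functional
  let ev : VTensor D π →+ M := f.comp
    ((TensorProduct.rid ℂ (V P lam)).toLinearMap ∘ₗ LinearMap.lTensor (V P lam) ℓ).toAddMonoidHom
  have hev : ∀ v y, ev (v ⊗ₜ[ℂ] y : V P lam ⊗[ℂ] π) = f (ℓ y • v) := by
    intro v y
    change f ((TensorProduct.rid ℂ (V P lam)) (LinearMap.lTensor (V P lam) ℓ (v ⊗ₜ[ℂ] y))) = _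
    rw [LinearMap.lTensor_tmul, TensorProduct.rid_tmul]
  -- The type condition says precisely that `f`, read on `V(λ) ⊗ π` through the coordinate `ℓ`,
  -- respects the action of the crossed product with `G_λ`.
  have hlin : ∀ (b : CrossStab P lam) (z : VTensor D π),
      ev (b • z) = crossIncl P lam b • ev z := by
    intro b z
    induction b using SkewMonoidAlgebra.induction_on with
    | zero => rw [zero_smul, map_zero, map_zero, zero_smul]
    | add b b' hb hb' => rw [add_smul, map_add, hb, hb', map_add, add_smul]
    | single h r =>
      change ev (crossAct D π (SkewMonoidAlgebra.single h r) z) = _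
      rw [crossIncl_single]
      induction (show V P lam ⊗[ℂ] π from z) using TensorProduct.induction_on with
      | zero =>
        have h0 : ev (0 : V P lam ⊗[ℂ] π) = 0 := map_zero ev
        rw [map_zero, h0, smul_zero]
      | add a b ha hb =>
        have hadd : ∀ a b : V P lam ⊗[ℂ] π, ev (a + b : V P lam ⊗[ℂ] π) = ev a + ev b :=
          fun a b => map_add ev a b
        rw [map_add, hadd, ha, hb, hadd, smul_add]
      | tmul v y =>
        have hc : ℓ (D.c h • y) = χ h * ℓ y := by
          rw [← hℓx y, smul_comm, hx.c_smul, map_smul, map_smul, map_smul, hℓ]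
          simp [mul_comm]
        rw [crossAct_single, hev, hev, single_eq_mul, mul_smul, hf.group, ← hf.hecke, hc,
          (D.φ h).map_smul, smul_smul, smul_comm r]
  let B : Cross P n →+ VTensor D π →+ M :=
    { toFun := fun a => (DistribSMul.toAddMonoidHom M a).comp ev
      map_zero' := AddMonoidHom.ext fun z => zero_smul _ (ev z)
      map_add' := fun a b => AddMonoidHom.ext fun z => add_smul a b (ev z) }
  let F₁ : Cross P n ⊗[ℤ] VTensor D π →+ M := TensorProduct.liftAddHom B fun c a z => by
    rw [map_zsmul, map_zsmul]
    rfl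
  have hF₁ : ∀ a z, F₁ (a ⊗ₜ z) = a • ev z := fun _ _ => TensorProduct.liftAddHom_tmul _ _ _ _
  let F₀ : Cross P n ⊗[ℤ] VTensor D π →ₗ[Cross P n] M :=
    { F₁ with
      map_smul' := fun a t => by
        change F₁ (a • t) = a • F₁ t
        induction t using TensorProduct.induction_on with
        | zero => rw [smul_zero, map_zero, smul_zero]
        | add s t hs ht => rw [smul_add, map_add, hs, ht, map_add, smul_add]
        | tmul b z =>
          have h1 : a • (b ⊗ₜ[ℤ] z : Cross P n ⊗[ℤ] VTensor D π) = (a * b) ⊗ₜ z := rfl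
          rw [h1, hF₁, hF₁, mul_smul] }
  have hF₀ : ∀ a z, F₀ (a ⊗ₜ z) = a • ev z := hF₁
  refine ⟨Submodule.liftQ _ F₀ ?_, fun v => ?_⟩
  · rw [Submodule.span_le]
    rintro _ ⟨a, b, z, rfl⟩
    change F₀ _ = 0
    rw [map_sub, hF₀, hF₀, hlin, mul_smul, sub_self]
  · change F₀ ((1 : Cross P n) ⊗ₜ (v ⊗ₜ[ℂ] x : V P lam ⊗[ℂ] π)) = f v
    refine (hF₀ _ _).trans ((one_smul _ _).trans ((hev v x).trans ?_))
    rw [hℓ, one_smul]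

theorem IsTypeMap.nonempty_equiv (hss : IsSemisimpleRing (H P n)) [IsSimpleModule (Cross P n) M]
    {χ : Stab lam → ℂ} {x : π} (hx : IsSpanningVec D χ x)
    {f : V P lam →+ M} (hf : IsTypeMap D χ f) (h0 : f ≠ 0) :
    Nonempty (RG D π ≃ₗ[Cross P n] M) := by
  obtain ⟨F, hF⟩ := hf.exists_linearMap hx
  have := isSimpleModule_RG hss hx
  have hF0 : F ≠ 0 := by
    rintro rfl
    exact h0 (AddMonoidHom.ext fun v => (hF v).symm)
  exact ⟨LinearEquiv.ofBijective F (LinearMap.bijective_of_ne_zero hF0)⟩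

end Universal

/-! ### Exhaustion and the isomorphism criterion -/

section Classification

variable {p d n : ℕ} [NeZero p] {P : Params p d}

/-- A nonzero type map into `M` has some `χ`, and `χ` makes `ℂ` a simple module of the twisted group
algebra; the universal property then gives a nonzero map between simple modules. -/
theorem exists_equiv_RG (hss : IsSemisimpleRing (H P n))
    (D : ∀ lam : MultiPart p d n, CliffordDatum P lam)
    (M : Type*) [AddCommGroup M] [Module (Cross P n) M] [IsSimpleModule (Cross P n) M] :
    ∃ (lam : MultiPart p d n) (π : Type) (_ : AddCommGroup π) (_ : Module ℂ π)
      (_ : Module (D lam).Tw π) (_ : IsScalarTower ℂ (D lam).Tw π),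
      IsSimpleModule (D lam).Tw π ∧ Nonempty (M ≃ₗ[Cross P n] RG (D lam) π) := by
  have := IsSimpleModule.nontrivial (Cross P n) M
  obtain ⟨lam, χ, f, hf, h0⟩ := exists_isTypeMap (M := M) hss D
  let ψ := (D lam).character χ (hf.map_one hss h0) (hf.map_mul hss h0)
  let _ : Module (D lam).Tw ℂ := Module.compHom ℂ ψ.toRingHom
  have hsmul : ∀ (a : (D lam).Tw) (z : ℂ), a • z = ψ a * z := fun _ _ => rfl
  have : IsScalarTower ℂ (D lam).Tw ℂ := ⟨fun c a z => by
    rw [hsmul, hsmul, map_smul, smul_mul_assoc]⟩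
  have hx : IsSpanningVec (D lam) χ (1 : ℂ) :=
    { ne_zero := one_ne_zero
      exists_smul := fun y => ⟨y, mul_one y⟩
      c_smul := fun h => by
        rw [hsmul]
        exact congrArg (· * (1 : ℂ)) ((D lam).character_c χ _ _ h) }
  refine ⟨lam, ℂ, inferInstance, inferInstance, inferInstance, this, ?_, ?_⟩
  · rw [isSimpleModule_iff]
    refine { exists_pair_ne := ⟨⊥, ⊤, bot_ne_top⟩, eq_bot_or_eq_top := fun W => ?_ }
    rw [or_iff_not_imp_left]
    intro hW
    obtain ⟨z, hz, hz0⟩ := W.exists_mem_ne_zero_of_ne_bot hW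
    rw [eq_top_iff]
    intro y _
    have h1 := W.smul_mem (algebraMap ℂ (D lam).Tw (y * z⁻¹)) hz
    rw [hsmul, AlgHom.commutes] at h1
    have h2 : algebraMap ℂ ℂ (y * z⁻¹) * z = y := by
      rw [Algebra.algebraMap_self, RingHom.id_apply, mul_assoc, inv_mul_cancel₀ hz0, mul_one]
    rwa [h2] at h1
  · obtain ⟨e⟩ := hf.nonempty_equiv hss hx h0
    exact ⟨e.symm⟩

theorem mem_stab_smul {lam mu : MultiPart p d n} {k : G p} (hk : k • lam = mu) (h : G p) :
    h ∈ Stab mu ↔ h ∈ Stab lam := by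
  rw [MulAction.mem_stabilizer_iff, MulAction.mem_stabilizer_iff, ← hk, smul_smul, mul_comm,
    mul_smul, smul_left_cancel_iff]

/-- Under compatible choices, a type map pulls back along a relabelling to a type map. -/
theorem IsTypeMap.pullback {D : ∀ lam : MultiPart p d n, CliffordDatum P lam} (hD : Compatible D)
    (hg : P.Generic n) {lam mu : MultiPart p d n} {k : G p} (hk : k • lam = mu)
    {M : Type*} [AddCommGroup M] [Module (Cross P n) M] {χ : Stab mu → ℂ} {f : V P mu →+ M}
    (hf : IsTypeMap (D mu) χ f) :
    IsTypeMap (D lam) (fun h => χ ⟨h, (mem_stab_smul hk h).2 h.2⟩) (pullback hg hk f) where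
  hecke := hf.hecke.pullback
  group h v := by
    have h1 := hf.group ⟨h, (mem_stab_smul hk h).2 h.2⟩ (relabel hg hk v)
    have h2 := hD lam mu k (relabel hg hk) (relabel_smul hg hk) h h.2
      ((mem_stab_smul hk h).2 h.2) v
    rw [h2, ← (relabel hg hk).map_smul] at h1
    rw [pullback_apply, pullback_apply, groupIncl_smul_smul, mul_comm (h : G p),
      ← groupIncl_smul_smul]
    exact congrArg (fun m : M => groupIncl P n k⁻¹ • m) h1

theorem nonempty_RG_equiv_iff (hss : IsSemisimpleRing (H P n))
    (D : ∀ lam : MultiPart p d n, CliffordDatum P lam) (hD : Compatible D)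
    (lam mu : MultiPart p d n)
    (π : Type*) [AddCommGroup π] [Module ℂ π] [Module (D lam).Tw π] [IsScalarTower ℂ (D lam).Tw π]
    (π' : Type*) [AddCommGroup π'] [Module ℂ π'] [Module (D mu).Tw π']
    [IsScalarTower ℂ (D mu).Tw π']
    (hπ : IsSimpleModule (D lam).Tw π) (hπ' : IsSimpleModule (D mu).Tw π') :
    Nonempty (RG (D lam) π ≃ₗ[Cross P n] RG (D mu) π') ↔
      CyclicEquiv lam mu ∧ TwIso (D lam) (D mu) π π' := by
  have hg := P.generic_of_isSemisimpleRing hss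
  obtain ⟨χ, x, hx⟩ := exists_isSpanningVec hπ
  obtain ⟨χ', x', hx'⟩ := exists_isSpanningVec hπ'
  have hf := isTypeMap_indMap hx
  have hf' := isTypeMap_indMap hx'
  rw [cyclicEquiv_iff]
  constructor
  · rintro ⟨e⟩
    -- The canonical type map for `μ` is carried into the module induced from `λ`, where its
    -- nonvanishing forces `μ` to be a shift of `λ`.
    let f₁ : V P mu →+ RG (D lam) π := e.symm.toLinearMap.toAddMonoidHom.comp (indMap (D mu) x')
    have hf₁ : IsTypeMap (D mu) χ' f₁ :=
      { hecke := fun r v => (congrArg e.symm (hf'.hecke r v)).trans (e.symm.map_smul _ _)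
        group := fun h v => (e.symm.map_smul _ _).symm.trans (congrArg e.symm (hf'.group h v)) }
    have hf₁0 : f₁ ≠ 0 := fun h => indMap_ne_zero hg hx' (AddMonoidHom.ext fun v =>
      e.symm.map_eq_zero_iff.1 (DFunLike.congr_fun h v))
    obtain ⟨k, hk⟩ := (generates_indMap hx).exists_smul_eq hss hf.hecke hf₁.hecke hf₁0
    refine ⟨⟨k, hk⟩, ?_⟩
    have hf₂ := hf₁.pullback hD hg hk
    have hf₂0 : pullback hg hk f₁ ≠ 0 := mt pullback_eq_zero_iff.1 hf₁0
    obtain ⟨c, hc⟩ := (generates_indMap hx).eq_smul hss hf hf₂.hecke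
    have := nontrivial_V hg lam
    obtain ⟨v, hv⟩ := exists_ne (0 : V P lam)
    -- By compatibility the pulled back map has type `χ'`, but it is also a multiple of the
    -- canonical map of type `χ`.
    have hχ : ∀ (h : G p) (h₁ : h ∈ Stab lam) (h₂ : h ∈ Stab mu), χ ⟨h, h₁⟩ = χ' ⟨h, h₂⟩ := by
      intro h h₁ h₂
      have e1 := hf.group ⟨h, h₁⟩ (c • v)
      rw [← hc, ((D lam).φ _).map_smul, smul_comm, ← hc] at e1
      have e2 := e1.symm.trans (hf₂.group ⟨h, h₁⟩ v)
      exact hf₂.eq_of_apply_eq hss hf₂0 (fun h => hv (((D lam).φ _).map_eq_zero_iff.1 h)) e2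
    obtain ⟨ℓ, hℓ, hℓx⟩ := hx.exists_functional
    obtain ⟨ℓ', hℓ', hℓx'⟩ := hx'.exists_functional
    refine ⟨LinearEquiv.ofLinearMap (LinearMap.toSpanSingleton ℂ π' x' ∘ₗ ℓ)
      (LinearMap.toSpanSingleton ℂ π x ∘ₗ ℓ') ?_ ?_, fun h h₁ h₂ y => ?_⟩
    · refine LinearMap.ext fun y => ?_
      change ℓ (ℓ' y • x) • x' = y
      rw [map_smul, hℓ, smul_eq_mul, mul_one, hℓx']
    · refine LinearMap.ext fun y => ?_
      change ℓ' (ℓ y • x') • x = y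
      rw [map_smul, hℓ', smul_eq_mul, mul_one, hℓx]
    · change ℓ ((D lam).c ⟨h, h₁⟩ • y) • x' = (D mu).c ⟨h, h₂⟩ • ℓ y • x'
      obtain ⟨a, rfl⟩ := hx.exists_smul y
      rw [smul_comm, hx.c_smul, smul_smul, map_smul, map_smul, hℓ, smul_comm, hx'.c_smul,
        hχ h h₁ h₂, smul_smul]
      simp
  · rintro ⟨⟨k, hk⟩, F, hF⟩
    have hf₂ := hf'.pullback hD hg hk
    have hf₂0 : pullback hg hk (indMap (D mu) x') ≠ 0 :=
      mt pullback_eq_zero_iff.1 (indMap_ne_zero hg hx')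
    -- Conversely, isomorphic lines have equal characters, so the pulled back map has the type
    -- required by the universal property for `λ`.
    have hχ : ∀ h : Stab lam, χ h = χ' ⟨h, (mem_stab_smul hk h).2 h.2⟩ := by
      intro h
      have h2 := (mem_stab_smul hk h).2 h.2
      obtain ⟨a, ha⟩ := hx'.exists_smul (F x)
      have e1 := hF h h.2 h2 x
      rw [← ha, smul_comm, hx'.c_smul, smul_comm, ha] at e1
      have e2 : F ((D lam).c h • x) = χ h • F x := by rw [hx.c_smul, map_smul]
      have e3 := e2.symm.trans e1
      exact smul_left_injective ℂ (fun h => hx.ne_zero (F.map_eq_zero_iff.1 h)) e3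
    have hf₃ : IsTypeMap (D lam) χ (pullback hg hk (indMap (D mu) x')) := by
      have : χ = fun h : Stab lam => χ' ⟨h, (mem_stab_smul hk h).2 h.2⟩ := funext hχ
      rw [this]
      exact hf₂
    have := isSimpleModule_RG hss hx'
    exact hf₃.nonempty_equiv hss hx hf₂0

end Classification

end

end CliffordHecke

end

open CliffordHecke in
theorem mainTheorem7 (p d n : ℕ) [NeZero p] (P : Params p d)
    (hss : IsSemisimpleRing (H P n)) :
    -- the modules `V(λ)` are simple, with basis the vectors `v(𝕋)`
    (∀ lam : MultiPart p d n, IsSimpleModule (H P n) (V P lam) ∧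
      LinearIndependent ℂ (vec P : StdTab lam → V P lam) ∧
      Submodule.span ℂ (Set.range (vec P : StdTab lam → V P lam)) = ⊤) ∧
    -- intertwiners exist, compatibly, and every choice of them determines the function `α_λ`
    (∃ D : ∀ lam : MultiPart p d n, CliffordDatum P lam, Compatible D) ∧
    (∀ (lam : MultiPart p d n) (I : Intertwiners P lam),
      ∃! D : CliffordDatum P lam, D.toIntertwiners = I) ∧
    -- for simple `π`, which are one-dimensional, the module `RG^{V(λ), π}` is simple
    (∀ (lam : MultiPart p d n) (D : CliffordDatum P lam)
      (π : Type*) [AddCommGroup π] [Module ℂ π] [Module D.Tw π] [IsScalarTower ℂ D.Tw π],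
      IsSimpleModule D.Tw π →
        Module.finrank ℂ π = 1 ∧ IsSimpleModule (Cross P n) (RG D π)) ∧
    -- every simple module is of this form
    (∀ (D : ∀ lam : MultiPart p d n, CliffordDatum P lam)
      (M : Type*) [AddCommGroup M] [Module (Cross P n) M],
      IsSimpleModule (Cross P n) M →
        ∃ (lam : MultiPart p d n) (π : Type) (_ : AddCommGroup π) (_ : Module ℂ π)
          (_ : Module (D lam).Tw π) (_ : IsScalarTower ℂ (D lam).Tw π),
          IsSimpleModule (D lam).Tw π ∧ Nonempty (M ≃ₗ[Cross P n] RG (D lam) π)) ∧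
    -- the isomorphism criterion
    (∀ D : ∀ lam : MultiPart p d n, CliffordDatum P lam, Compatible D →
      ∀ (lam mu : MultiPart p d n)
        (π : Type*) [AddCommGroup π] [Module ℂ π] [Module (D lam).Tw π]
        [IsScalarTower ℂ (D lam).Tw π]
        (π' : Type*) [AddCommGroup π'] [Module ℂ π'] [Module (D mu).Tw π']
        [IsScalarTower ℂ (D mu).Tw π'],
        IsSimpleModule (D lam).Tw π → IsSimpleModule (D mu).Tw π' →
          (Nonempty (RG (D lam) π ≃ₗ[Cross P n] RG (D mu) π') ↔
            CyclicEquiv lam mu ∧ TwIso (D lam) (D mu) π π')) := by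
  have hg := P.generic_of_isSemisimpleRing hss
  refine ⟨fun lam => ⟨isSimpleModule_V hss lam, linearIndependent_vec hg, span_vec⟩,
    ⟨standardDatum hg, compatible_standardDatum hg⟩, existsUnique_cliffordDatum hg, ?_, ?_, ?_⟩
  · intro lam D π _ _ _ _ hπ
    obtain ⟨χ, x, hx⟩ := exists_isSpanningVec hπ
    exact ⟨hx.finrank, isSimpleModule_RG hss hx⟩
  · intro D M _ _ hM
    exact exists_equiv_RG hss D M
  · intro D hD lam mu π _ _ _ _ π' _ _ _ _ hπ hπ'
    exact nonempty_RG_equiv_iff hss D hD lam mu π π' hπ hπ'
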